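/- Fix the countable set of names $\mathbb N$. Processes, prefixes and update patterns of the calculus $\mathcal E$ are given by $$P ::= a[P] \mid P\parallel P \mid {!\pi.P} \mid \textstyle\sum_{i\in I}\pi_i.P_i,\qquad \pi ::= a \mid \bar a \mid \tilde a\{U\},$$ with finite index sets $I$ (the empty sum is $\mathbf 0$). In $\mathcal E^2$ the patterns in update prefixes are unguarded, $U ::= P \mid a[U] \mid U\parallel U \mid \bullet$; in $\mathcal E^3$ they are preserving, $U ::= a[U] \mid U\parallel P \mid \bullet$. For a process $Q$, let $U\langle Q\rangle$ be $U$ with every hole $\bullet$ not inside an update prefix replaced by $Q$. Transitions $P\xrightarrow{\alpha}P'$, with $\alpha ::= a\mid\bar a\mid a[P]\mid\tilde a\{U\}\mid\tau$, are generated by: $\sum_{i\in I}\pi_i.P_i\xrightarrow{\pi_j}P_j$ for $j\in I$; $!\pi.P\xrightarrow{\pi}P\parallel{!\pi.P}$; $a[P]\xrightarrow{a[P]}\star$, where $\star$ is a placeholder; if $P\xrightarrow{\alpha}P'$ then $a[P]\xrightarrow{\alpha}a[P']$ and $P\parallel Q\xrightarrow{\alpha}P'\parallel Q$; if $P\xrightarrow{a}P'$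 and $Q\xrightarrow{\bar a}Q'$ then $P\parallel Q\xrightarrow{\tau}P'\parallel Q'$; if $P\xrightarrow{a[R]}P'$ and $Q\xrightarrow{\tilde a\{U\}}Q'$ then $P\parallel Q\xrightarrow{\tau}P'\{U\langle R\rangle/\star\}\parallel Q'$; and the symmetric counterparts of the rules for $\parallel$. Write $\to$ for $\xrightarrow{\tau}$. The calculi $\mathcal E^2_d,\mathcal E^3_d$ with dynamic topology consist of all processes of $\mathcal E^2,\mathcal E^3$ with these transitions. The calculus $\mathcal E^2_s$ with static topology consists of the processes of $\mathcal E^2$ in which (also inside the patterns of update prefixes) no located process $b[\cdot]$ occurs in the continuation $P$ of a prefixed term $\pi.P$ or $!\pi.P$, and in which the pattern $U$ of every update prefix $\tilde a\{U\}$ contains exactly one located process, at the name $a$ (in both conditions, located processes inside further update prefixes are not counted); moreover, an update of $a[R]$ by $\tilde a\{U\}$ is possible only if $U\langle R\rangle$ and $a[R]$ have the same nesting structure, i.e. the unordered forests formed by their located processes coincide. A barb $e$ is an input $a$ or an output $\bar a$; a process $P$ is an error state for $e$ if $P\xrightarrow{e}P'$ for some $P'$. A process $P$ satisfies eventual adaptation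 for $e$ if there is no infinite computation $P\to^* Q_0\to Q_1\to Q_2\to\cdots$ in which all $Q_i$, $i\ge 0$, are error states. It satisfies bounded adaptation for $e$ and $k\in\mathbb N$ if at most $k$ consecutive error states arise in its computations, i.e. there is no computation $P\to^* Q_0\to\cdots\to Q_k$ in which all of $Q_0,\dots,Q_k$ are error states. Then for each of the three calculi $\mathcal E^2_d$, $\mathcal E^2_s$ and $\mathcal E^3_d$: 1. for every barb $e$, it is undecidable, given a process $P$ of the calculus, whether $P$ satisfies eventual adaptation for $e$; 2. it is decidable, given a process $P$ of the calculus, a barb $e$ and a number $k\in\mathbb N$, whether $P$ satisfies bounded adaptation for $e$ and $k$. -/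

import Mathlib

namespace Evol

/-! ## Syntax -/

mutual
/-- Raw terms over the countable set of names `ℕ`.  They comprise processes, update patterns (which
may contain the hole `•`), and the residuals of the transitions `a[P]` (which contain the
placeholder `⋆`). -/
inductive Term : Type
  /-- `a[P]`, the process `P` located at `a` -/
  | loc (a : ℕ) (P : Term)
  /-- `P ∥ Q` -/
  | par (P Q : Term)
  /-- guarded replication `!π.P` -/
  | repl (π : Prefix) (P : Term)
  /-- guarded finite sum `∑ πᵢ.Pᵢ` -/
  | sum (B : Branches)
  /-- the hole `•` of update patterns -/
  | hole
  /-- the placeholder `⋆` of the operational semantics -/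
  | star

/-- Prefixes: input `a`, output `ā`, update `ã{U}`. -/
inductive Prefix : Type
  | inp (a : ℕ)
  | out (a : ℕ)
  | upd (a : ℕ) (U : Term)

/-- The finite family of summands `πᵢ.Pᵢ` of a guarded sum. -/
inductive Branches : Type
  | nil
  | cons (π : Prefix) (P : Term) (B : Branches)
end

/-- The inactive process: the empty sum. -/
def Term.zero : Term := .sum .nil

/-- `B.Mem π P`: `π.P` is one of the summands listed in `B`. -/
inductive Branches.Mem : Branches → Prefix → Term → Prop
  | head (π : Prefix) (P : Term) (B : Branches) : Mem (.cons π P B) π P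
  | tail (ρ : Prefix) (R : Term) {B : Branches} {π : Prefix} {P : Term} :
      Mem B π P → Mem (.cons ρ R B) π P

mutual
/-- `U.fill Q` is `U⟨Q⟩`: the holes of `U` that do not occur inside update prefixes are
replaced by `Q`. -/
def Term.fill : Term → Term → Term
  | .loc a U, Q => .loc a (U.fill Q)
  | .par U V, Q => .par (U.fill Q) (V.fill Q)
  | .repl π U, Q => .repl π (U.fill Q)
  | .sum B, Q => .sum (B.fill Q)
  | .hole, Q => Q
  | .star, _ => .star
def Branches.fill : Branches → Term → Branches
  | .nil, _ => .nil
  | .cons π U B, Q => .cons π (U.fill Q) (B.fill Q)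
end

mutual
/-- `P.substStar R` is `P{R/⋆}`.  (The placeholder never occurs inside update prefixes.) -/
def Term.substStar : Term → Term → Term
  | .loc a P, R => .loc a (P.substStar R)
  | .par P Q, R => .par (P.substStar R) (Q.substStar R)
  | .repl π P, R => .repl π (P.substStar R)
  | .sum B, R => .sum (B.substStar R)
  | .hole, _ => .hole
  | .star, R => R
def Branches.substStar : Branches → Term → Branches
  | .nil, _ => .nil
  | .cons π P B, R => .cons π (P.substStar R) (B.substStar R)
end

/-! ## The classes of processes -/

/-- The two restricted kinds of update patterns: unguarded (`𝓔²`) and preserving (`𝓔³`). -/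
inductive Variant : Type
  | unguarded
  | preserving

mutual
/-- Processes `P ::= a[P] | P ∥ P | !π.P | ∑ πᵢ.Pᵢ` of the given variant. -/
inductive IsProc : Variant → Term → Prop
  | loc {v : Variant} {P : Term} (a : ℕ) : IsProc v P → IsProc v (.loc a P)
  | par {v : Variant} {P Q : Term} : IsProc v P → IsProc v Q → IsProc v (.par P Q)
  | repl {v : Variant} {π : Prefix} {P : Term} :
      IsPrefix v π → IsProc v P → IsProc v (.repl π P)
  | sum {v : Variant} {B : Branches} : IsBranches v B → IsProc v (.sum B)

/-- Families of summands `πᵢ.Pᵢ` of the given variant. -/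
inductive IsBranches : Variant → Branches → Prop
  | nil {v : Variant} : IsBranches v .nil
  | cons {v : Variant} {π : Prefix} {P : Term} {B : Branches} :
      IsPrefix v π → IsProc v P → IsBranches v B → IsBranches v (.cons π P B)

/-- Prefixes `π ::= a | ā | ã{U}` of the given variant. -/
inductive IsPrefix : Variant → Prefix → Prop
  | inp {v : Variant} (a : ℕ) : IsPrefix v (.inp a)
  | out {v : Variant} (a : ℕ) : IsPrefix v (.out a)
  | upd {v : Variant} {U : Term} (a : ℕ) : IsPattern v U → IsPrefix v (.upd a U)

/-- Update patterns.  Unguarded: `U ::= P | a[U] | U ∥ U | •`.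
Preserving: `U ::= a[U] | U ∥ P | •`. -/
inductive IsPattern : Variant → Term → Prop
  | proc {P : Term} : IsProc .unguarded P → IsPattern .unguarded P
  | parPattern {U V : Term} :
      IsPattern .unguarded U → IsPattern .unguarded V → IsPattern .unguarded (.par U V)
  | parProc {U P : Term} :
      IsPattern .preserving U → IsProc .preserving P → IsPattern .preserving (.par U P)
  | loc {v : Variant} {U : Term} (a : ℕ) : IsPattern v U → IsPattern v (.loc a U)
  | hole {v : Variant} : IsPattern v .hole
end

mutual
/-- The list of the names at which a process is located in the term, update prefixes
not being inspected. -/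
def Term.locs : Term → List ℕ
  | .loc a P => a :: P.locs
  | .par P Q => P.locs ++ Q.locs
  | .repl _ P => P.locs
  | .sum B => B.locs
  | .hole => []
  | .star => []
def Branches.locs : Branches → List ℕ
  | .nil => []
  | .cons _ P B => P.locs ++ B.locs
end

mutual
/-- The syntactic constraint of static topologies: executing a prefix `π` in `π.P` or `!π.P` does
not release a located process, and a pattern `U` that updates `a` recreates `a` and introduces no
further located process. -/
def Term.Static : Term → Prop
  | .loc _ P => P.Static
  | .par P Q => P.Static ∧ Q.Static
  | .repl π P => π.Static ∧ P.Static ∧ P.locs = []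
  | .sum B => B.Static
  | .hole => True
  | .star => True
def Branches.Static : Branches → Prop
  | .nil => True
  | .cons π P B => π.Static ∧ (P.Static ∧ P.locs = []) ∧ B.Static
def Prefix.Static : Prefix → Prop
  | .inp _ => True
  | .out _ => True
  | .upd a U => U.Static ∧ U.locs = [a]
end

/-- Dynamic and static topologies of located processes. -/
inductive Topology : Type
  | dynamic
  | static

/-- The processes of the calculus with update patterns `v` and topology `t`. -/
def calculus (v : Variant) : Topology → Set Term
  | .dynamic => {P | IsProc v P}
  | .static => {P | IsProc v P ∧ P.Static}

/-! ## Operational semantics -/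

/-- `P` and `Q` have the same nesting structure: the unordered forests formed by their located
processes coincide. -/
inductive SameNesting : Term → Term → Prop
  | refl (P : Term) : SameNesting P P
  | symm {P Q : Term} : SameNesting P Q → SameNesting Q P
  | trans {P Q R : Term} : SameNesting P Q → SameNesting Q R → SameNesting P R
  | loc {P Q : Term} (a : ℕ) : SameNesting P Q → SameNesting (.loc a P) (.loc a Q)
  | par {P P' Q Q' : Term} :
      SameNesting P P' → SameNesting Q Q' → SameNesting (.par P Q) (.par P' Q')
  | comm (P Q : Term) : SameNesting (.par P Q) (.par Q P)
  | assoc (P Q R : Term) : SameNesting (.par (.par P Q) R) (.par P (.par Q R))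
  | unit (P : Term) : SameNesting (.par P .zero) P
  | repl (π : Prefix) (P : Term) : SameNesting (.repl π P) .zero
  | sum (B : Branches) : SameNesting (.sum B) .zero

/-- Whether the update of `a[Q]` by `ã{U}` is allowed: always in a dynamic topology; in a static one
only if replacing `a[Q]` by `U⟨Q⟩` does not modify the nesting structure. -/
def Allowed : Topology → ℕ → Term → Term → Prop
  | .dynamic, _, _, _ => True
  | .static, a, Q, U => SameNesting (.loc a Q) (U.fill Q)

/-- Transition labels `α ::= a | ā | a[P] | ã{U} | τ`. -/
inductive Label : Type
  | inp (a : ℕ)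
  | out (a : ℕ)
  | comp (a : ℕ) (P : Term)
  | upd (a : ℕ) (U : Term)
  | tau

/-- A prefix, seen as a transition label. -/
def Prefix.label : Prefix → Label
  | .inp a => .inp a
  | .out a => .out a
  | .upd a U => .upd a U

/-- The labelled transition system. -/
inductive Trans (t : Topology) : Term → Label → Term → Prop
  | sum {B : Branches} {π : Prefix} {P : Term} : B.Mem π P → Trans t (.sum B) π.label P
  | repl (π : Prefix) (P : Term) : Trans t (.repl π P) π.label (.par P (.repl π P))
  | comp (a : ℕ) (P : Term) : Trans t (.loc a P) (.comp a P) .star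
  | loc {P P' : Term} {α : Label} (a : ℕ) : Trans t P α P' → Trans t (.loc a P) α (.loc a P')
  | act1 {P P' : Term} {α : Label} (Q : Term) : Trans t P α P' → Trans t (.par P Q) α (.par P' Q)
  | act2 {Q Q' : Term} {α : Label} (P : Term) : Trans t Q α Q' → Trans t (.par P Q) α (.par P Q')
  | tau1 {P P' Q Q' : Term} {a : ℕ} : Trans t P (.inp a) P' → Trans t Q (.out a) Q' →
      Trans t (.par P Q) .tau (.par P' Q')
  | tau2 {P P' Q Q' : Term} {a : ℕ} : Trans t P (.out a) P' → Trans t Q (.inp a) Q' →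
      Trans t (.par P Q) .tau (.par P' Q')
  | tau3 {P P' Q Q' R U : Term} {a : ℕ} : Trans t P (.comp a R) P' → Trans t Q (.upd a U) Q' →
      Allowed t a R U → Trans t (.par P Q) .tau (.par (P'.substStar (U.fill R)) Q')
  | tau4 {P P' Q Q' R U : Term} {a : ℕ} : Trans t P (.upd a U) P' → Trans t Q (.comp a R) Q' →
      Allowed t a R U → Trans t (.par P Q) .tau (.par P' (Q'.substStar (U.fill R)))

/-- The reduction relation `P ⟶ P'`. -/
def Step (t : Topology) (P P' : Term) : Prop := Trans t P .tau P'

/-! ## Adaptation problems -/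

/-- Observable actions: `inl a` is the input `a`, `inr a` is the output `ā`. -/
abbrev Barb : Type := ℕ ⊕ ℕ

/-- A barb, seen as a transition label. -/
def Barb.label : Barb → Label
  | .inl a => .inp a
  | .inr a => .out a

/-- `P` exhibits the barb `e`; for the error barb `e`, `P` is an error state. -/
def HasBarb (t : Topology) (P : Term) (e : Barb) : Prop := ∃ P', Trans t P (Barb.label e) P'

/-- Bounded adaptation: at most `k` consecutive error states arise in the computations of `P`, that
is, no computation of `P` traverses `k + 1` consecutive error states. -/
def BoundedAdaptation (t : Topology) (P : Term) (e : Barb) (k : ℕ) : Prop :=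
  ¬ ∃ Q : ℕ → Term, Relation.ReflTransGen (Step t) P (Q 0) ∧
    (∀ i < k, Step t (Q i) (Q (i + 1))) ∧ ∀ i ≤ k, HasBarb t (Q i) e

/-- Eventual adaptation: no computation of `P` enters an infinite sequence of consecutive
error states. -/
def EventualAdaptation (t : Topology) (P : Term) (e : Barb) : Prop :=
  ¬ ∃ Q : ℕ → Term, Relation.ReflTransGen (Step t) P (Q 0) ∧
    (∀ i, Step t (Q i) (Q (i + 1))) ∧ ∀ i, HasBarb t (Q i) e

/-! ## Decidability -/

mutual
/-- Gödel numbering of terms. -/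
def Term.code : Term → ℕ
  | .loc a P => Nat.pair 0 (Nat.pair a P.code)
  | .par P Q => Nat.pair 1 (Nat.pair P.code Q.code)
  | .repl π P => Nat.pair 2 (Nat.pair π.code P.code)
  | .sum B => Nat.pair 3 B.code
  | .hole => Nat.pair 4 0
  | .star => Nat.pair 5 0
def Prefix.code : Prefix → ℕ
  | .inp a => Nat.pair 0 a
  | .out a => Nat.pair 1 a
  | .upd a U => Nat.pair 2 (Nat.pair a U.code)
def Branches.code : Branches → ℕ
  | .nil => 0
  | .cons π P B => Nat.pair π.code (Nat.pair P.code B.code) + 1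
end

mutual
theorem Term.code_inj : ∀ P Q : Term, P.code = Q.code → P = Q
  | .loc a P, Q, h => by
      cases Q <;> simp [Term.code] at h
      simp [h.1, Term.code_inj P _ h.2]
  | .par P P', Q, h => by
      cases Q <;> simp [Term.code] at h
      simp [Term.code_inj P _ h.1, Term.code_inj P' _ h.2]
  | .repl π P, Q, h => by
      cases Q <;> simp [Term.code] at h
      simp [Prefix.code_inj π _ h.1, Term.code_inj P _ h.2]
  | .sum B, Q, h => by
      cases Q <;> simp [Term.code] at h
      simp [Branches.code_inj B _ h]
  | .hole, Q, h => by cases Q <;> simp [Term.code] at h ⊢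
  | .star, Q, h => by cases Q <;> simp [Term.code] at h ⊢
theorem Prefix.code_inj : ∀ π ρ : Prefix, π.code = ρ.code → π = ρ
  | .inp a, ρ, h => by cases ρ <;> simp [Prefix.code] at h ⊢; exact h
  | .out a, ρ, h => by cases ρ <;> simp [Prefix.code] at h ⊢; exact h
  | .upd a U, ρ, h => by
      cases ρ <;> simp [Prefix.code] at h
      simp [h.1, Term.code_inj U _ h.2]
theorem Branches.code_inj : ∀ B C : Branches, B.code = C.code → B = C
  | .nil, C, h => by cases C <;> simp [Branches.code] at h ⊢
  | .cons π P B, C, h => by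
      cases C <;> simp [Branches.code] at h
      simp [Prefix.code_inj π _ h.1, Term.code_inj P _ h.2.1, Branches.code_inj B _ h.2.2]
end

/-- The decision problem with instances `x ∈ S`, presented to the algorithm as `enc x`, and
question `p x` is decidable. -/
def DecidableProblem {α β : Type} [Primcodable β] (enc : α → β) (S : Set α) (p : α → Prop) : Prop :=
  ∃ f : β → Bool, Computable f ∧ ∀ x ∈ S, (f (enc x) = true ↔ p x)

/-- Eventual adaptation with designated error barb `e` is decidable for the processes of the
calculus; the input is a process `P`. -/
def EventualAdaptationDecidable (v : Variant) (t : Topology) (e : Barb) : Prop :=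
  DecidableProblem Term.code (calculus v t) (fun P => EventualAdaptation t P e)

/-- Bounded adaptation is decidable for the processes of the calculus; the input consists of a
process `P`, an error barb `e`, and a bound `k`. -/
def BoundedAdaptationDecidable (v : Variant) (t : Topology) : Prop :=
  DecidableProblem (fun x : Term × Barb × ℕ => (x.1.code, x.2.1, x.2.2))
    {x | x.1 ∈ calculus v t} (fun x => BoundedAdaptation t x.1 x.2.1 x.2.2)

end Evol

-- Decidability: the calculus as a transition system on trees.

namespace Evol

/-! ## Abstract trees -/

/-- Trees of located processes; guarded processes (and the hole) are leaves carrying their code. -/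
inductive Tr : Type
  | leaf (c : ℕ)
  | loc (a : ℕ) (P : Tr)
  | par (P Q : Tr)

/-- The code of the hole. -/
def holeCode : ℕ := Nat.pair 4 0

namespace Tr

/-- Filling the holes of a tree; leaves are not inspected. -/
def fill : Tr → Tr → Tr
  | leaf c, R => if c = holeCode then R else leaf c
  | loc a U, R => loc a (U.fill R)
  | par U V, R => par (U.fill R) (V.fill R)

/-- The number of locations. -/
def nloc : Tr → ℕ
  | leaf _ => 0
  | loc _ P => P.nloc + 1
  | par P Q => P.nloc + Q.nloc

/-- The number of holes. -/
def holes : Tr → ℕ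
  | leaf c => if c = holeCode then 1 else 0
  | loc _ P => P.holes
  | par P Q => P.holes + Q.holes

/-- The number of holes outside all locations. -/
def outerHoles : Tr → ℕ
  | leaf c => if c = holeCode then 1 else 0
  | loc _ _ => 0
  | par P Q => P.outerHoles + Q.outerHoles

/-- The number of outermost locations. -/
def roots : Tr → ℕ
  | leaf _ => 0
  | loc _ _ => 1
  | par P Q => P.roots + Q.roots

end Tr

/-- Makes the decoding of locations well founded. The numbers `0` and `1` have to be excluded
because both are fixed points of `n ↦ n.unpair.2.unpair.2`; codes of terms are never that small. -/
theorem unpair_lt_of_two_le {n : ℕ} (h : n.unpair.1 = 0 ∧ 2 ≤ n) : n.unpair.2.unpair.2 < n := by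
  have h1 := Nat.pair_unpair n
  rw [h.1] at h1
  have h2 : n.unpair.2.unpair.2 ≤ n.unpair.2 := Nat.unpair_right_le _
  generalize n.unpair.2 = x at *
  rcases Nat.eq_zero_or_pos x with hx | hx
  · rw [hx] at h1; have h3 : Nat.pair 0 0 = 0 := by decide
    omega
  · simp [Nat.pair, hx] at h1
    have : 2 ≤ x := by
      by_contra hc
      have : x = 1 := by omega
      subst this; omega
    nlinarith

theorem unpair_two_lt_of_pos {n : ℕ} (h : 0 < n.unpair.1) : n.unpair.2 < n := by
  have h1 := Nat.add_le_pair n.unpair.1 n.unpair.2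
  rw [Nat.pair_unpair] at h1
  omega

/-- The tree with a given code. -/
def ofCode (n : ℕ) : Tr :=
  if _h : n.unpair.1 = 0 ∧ 2 ≤ n then .loc n.unpair.2.unpair.1 (ofCode n.unpair.2.unpair.2)
  else if _h' : n.unpair.1 = 1 then
    .par (ofCode n.unpair.2.unpair.1) (ofCode n.unpair.2.unpair.2)
  else .leaf n
termination_by n
decreasing_by
  · exact unpair_lt_of_two_le _h
  · exact (Nat.unpair_left_le _).trans_lt (unpair_two_lt_of_pos (by omega))
  · exact (Nat.unpair_right_le _).trans_lt (unpair_two_lt_of_pos (by omega))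

/-- Labels: `(0, a, _)` is the input `a`, `(1, a, _)` the output `a`, `(2, a, U)` an update of `a`
by `U`, and `(3, a, U)` the absorption of such an update. -/
abbrev Lab : Type := ℕ × ℕ × Tr

/-- The complementary label. -/
def Lab.dual (α : Lab) : Lab :=
  (if α.1 = 0 then 1 else if α.1 = 1 then 0 else if α.1 = 2 then 3 else 2, α.2)

/-- The label of the prefix with a given code. -/
def labOf (p : ℕ) : Lab :=
  if p.unpair.1 = 0 then (0, p.unpair.2, .leaf 0)
  else if p.unpair.1 = 1 then (1, p.unpair.2, .leaf 0)
  else (2, p.unpair.2.unpair.1, ofCode p.unpair.2.unpair.2)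

/-- The summands of the family of branches with a given code. -/
def branchActs : ℕ → List (Lab × Tr)
  | 0 => []
  | n + 1 => (labOf n.unpair.1, ofCode n.unpair.2.unpair.1) :: branchActs n.unpair.2.unpair.2
decreasing_by
  exact Nat.lt_succ_of_le ((Nat.unpair_right_le _).trans (Nat.unpair_right_le _))

/-- The actions of the leaf with a given code. -/
def acts (c : ℕ) : List (Lab × Tr) :=
  if c.unpair.1 = 2 then
    [(labOf c.unpair.2.unpair.1, .par (ofCode c.unpair.2.unpair.2) (.leaf c))]
  else if c.unpair.1 = 3 then branchActs c.unpair.2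
  else []

/-- Whether `a[R]` may be updated by `U`. -/
def Perm (t : Topology) (R U : Tr) : Prop :=
  t = .static → R.nloc = 0 ∨ (U.holes = 1 ∧ U.outerHoles = 0)

/-- Labelled transitions of trees. -/
inductive TT (t : Topology) : Tr → Lab → Tr → Prop
  | leaf {c : ℕ} {α : Lab} {T : Tr} : (α, T) ∈ acts c → TT t (.leaf c) α T
  | abs (a : ℕ) {R U : Tr} : Perm t R U → TT t (.loc a R) (3, a, U) (U.fill R)
  | loc (a : ℕ) {P P' : Tr} {α : Lab} : TT t P α P' → TT t (.loc a P) α (.loc a P')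
  | parL {P P' : Tr} (Q : Tr) {α : Lab} : TT t P α P' → TT t (.par P Q) α (.par P' Q)
  | parR (P : Tr) {Q Q' : Tr} {α : Lab} : TT t Q α Q' → TT t (.par P Q) α (.par P Q')

/-- Reductions of trees. -/
inductive TStep (t : Topology) : Tr → Tr → Prop
  | sync {P P' Q Q' : Tr} {α : Lab} : TT t P α P' → TT t Q α.dual Q' →
      TStep t (.par P Q) (.par P' Q')
  | loc (a : ℕ) {P P' : Tr} : TStep t P P' → TStep t (.loc a P) (.loc a P')
  | parL {P P' : Tr} (Q : Tr) : TStep t P P' → TStep t (.par P Q) (.par P' Q)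
  | parR (P : Tr) {Q Q' : Tr} : TStep t Q Q' → TStep t (.par P Q) (.par P Q')

/-- The label of a barb. -/
def Barb.lab : Barb → Lab
  | .inl a => (0, a, .leaf 0)
  | .inr a => (1, a, .leaf 0)

/-- The tree exhibits the barb. -/
def TBarb (t : Topology) (P : Tr) (e : Barb) : Prop := ∃ P', TT t P e.lab P'

/-! ## Terms as trees -/

/-- Guarantees that `ofCode` does not treat the code of a location as a leaf. -/
theorem Term.two_le_code : ∀ P : Term, 2 ≤ P.code
  | .loc a P => by
      have h := P.two_le_code
      have h1 := Nat.add_le_pair a P.code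
      have h2 := Nat.add_le_pair 0 (Nat.pair a P.code)
      simp only [Term.code]; omega
  | .par P Q => by
      have h := Q.two_le_code
      have h1 := Nat.add_le_pair P.code Q.code
      have h2 := Nat.add_le_pair 1 (Nat.pair P.code Q.code)
      simp only [Term.code]; omega
  | .repl π P => by
      have h2 := Nat.add_le_pair 2 (Nat.pair π.code P.code)
      simp only [Term.code]; omega
  | .sum B => by
      have h2 := Nat.add_le_pair 3 B.code
      simp only [Term.code]; omega
  | .hole => by simp [Term.code, Nat.pair]
  | .star => by simp [Term.code, Nat.pair]

/-- The tree of a term. -/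
def Term.tr (P : Term) : Tr := ofCode P.code

@[simp] theorem Term.tr_loc (a : ℕ) (P : Term) : (Term.loc a P).tr = .loc a P.tr := by
  have := (Term.loc a P).two_le_code
  rw [Term.tr, ofCode]
  simp only [Term.code] at this ⊢
  simp [this, Term.tr]

@[simp] theorem Term.tr_par (P Q : Term) : (Term.par P Q).tr = .par P.tr Q.tr := by
  rw [Term.tr, ofCode]; simp [Term.code, Term.tr]

@[simp] theorem Term.tr_repl (π : Prefix) (P : Term) :
    (Term.repl π P).tr = .leaf (Term.repl π P).code := by
  rw [Term.tr, ofCode]; simp [Term.code]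

@[simp] theorem Term.tr_sum (B : Branches) : (Term.sum B).tr = .leaf (Term.sum B).code := by
  rw [Term.tr, ofCode]; simp [Term.code]

@[simp] theorem Term.tr_hole : Term.hole.tr = .leaf holeCode := by
  rw [Term.tr, ofCode]; simp [Term.code, holeCode]

/-- The label of a prefix. -/
def Prefix.lab : Prefix → Lab
  | .inp a => (0, a, .leaf 0)
  | .out a => (1, a, .leaf 0)
  | .upd a U => (2, a, U.tr)

@[simp] theorem labOf_code (π : Prefix) : labOf π.code = π.lab := by
  cases π <;> simp [labOf, Prefix.code, Prefix.lab, Term.tr]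

theorem acts_repl (π : Prefix) (P : Term) :
    acts (Term.repl π P).code = [(π.lab, .par P.tr (.leaf (Term.repl π P).code))] := by
  simp [acts, Term.code, Term.tr]

theorem mem_branchActs {α : Lab} {T : Tr} : ∀ B : Branches,
    (α, T) ∈ branchActs B.code ↔ ∃ π P, B.Mem π P ∧ α = π.lab ∧ T = P.tr
  | .nil => by
      simp only [Branches.code, branchActs, List.not_mem_nil, false_iff]
      rintro ⟨π, P, h, -⟩; cases h
  | .cons π P B => by
      simp only [Branches.code, branchActs, Nat.unpair_pair, labOf_code, List.mem_cons,
        mem_branchActs B, Prod.mk.injEq]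
      constructor
      · rintro (⟨rfl, rfl⟩ | ⟨ρ, R, h, rfl, rfl⟩)
        · exact ⟨_, _, .head _ _ _, rfl, rfl⟩
        · exact ⟨_, _, .tail _ _ h, rfl, rfl⟩
      · rintro ⟨ρ, R, h, rfl, rfl⟩
        cases h with
        | head => exact .inl ⟨rfl, rfl⟩
        | tail _ _ h => exact .inr ⟨_, _, h, rfl, rfl⟩

theorem mem_acts_sum {α : Lab} {T : Tr} (B : Branches) :
    (α, T) ∈ acts (Term.sum B).code ↔ ∃ π P, B.Mem π P ∧ α = π.lab ∧ T = P.tr := by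
  rw [← mem_branchActs]; simp [acts, Term.code]

mutual
theorem Term.fill_of_isProc {v : Variant} : ∀ {P : Term}, IsProc v P → ∀ Q, P.fill Q = P
  | .loc a P, h, Q => by cases h with | loc _ h => simp [Term.fill, Term.fill_of_isProc h]
  | .par P P', h, Q => by
      cases h with | par h h' => simp [Term.fill, Term.fill_of_isProc h, Term.fill_of_isProc h']
  | .repl π P, h, Q => by cases h with | repl _ h => simp [Term.fill, Term.fill_of_isProc h]
  | .sum B, h, Q => by cases h with | sum h => simp [Term.fill, Branches.fill_of_isBranches h]
  | .hole, h, Q => by cases h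
  | .star, h, Q => by cases h
theorem Branches.fill_of_isBranches {v : Variant} :
    ∀ {B : Branches}, IsBranches v B → ∀ Q, B.fill Q = B
  | .nil, _, _ => rfl
  | .cons π P B, h, Q => by
      cases h with
      | cons _ h h' =>
        simp [Branches.fill, Term.fill_of_isProc h, Branches.fill_of_isBranches h']
end

mutual
theorem Term.substStar_of_isProc {v : Variant} :
    ∀ {P : Term}, IsProc v P → ∀ Q, P.substStar Q = P
  | .loc a P, h, Q => by
      cases h with | loc _ h => simp [Term.substStar, Term.substStar_of_isProc h]
  | .par P P', h, Q => by
      cases h with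
      | par h h' =>
        simp [Term.substStar, Term.substStar_of_isProc h, Term.substStar_of_isProc h']
  | .repl π P, h, Q => by
      cases h with | repl _ h => simp [Term.substStar, Term.substStar_of_isProc h]
  | .sum B, h, Q => by
      cases h with | sum h => simp [Term.substStar, Branches.substStar_of_isBranches h]
  | .hole, h, Q => by cases h
  | .star, h, Q => by cases h
theorem Branches.substStar_of_isBranches {v : Variant} :
    ∀ {B : Branches}, IsBranches v B → ∀ Q, B.substStar Q = B
  | .nil, _, _ => rfl
  | .cons π P B, h, Q => by
      cases h with
      | cons _ h h' =>
        simp [Branches.substStar, Term.substStar_of_isProc h, Branches.substStar_of_isBranches h']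
end

theorem Term.tr_fill_of_isProc {v : Variant} : ∀ {P : Term}, IsProc v P → ∀ R, P.tr.fill R = P.tr
  | .loc a P, h, Q => by cases h with | loc _ h => simp [Tr.fill, Term.tr_fill_of_isProc h]
  | .par P P', h, Q => by
      cases h with
      | par h h' => simp [Tr.fill, Term.tr_fill_of_isProc h, Term.tr_fill_of_isProc h']
  | .repl π P, h, Q => by simp [Tr.fill, Term.code, holeCode]
  | .sum B, h, Q => by simp [Tr.fill, Term.code, holeCode]
  | .hole, h, Q => by cases h
  | .star, h, Q => by cases h

/-- The two fillings differ in that `Term.fill` enters guarded terms while `Tr.fill` stops at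
leaves. In a pattern of the grammar every guarded subterm is a process and has no hole that counts,
so the difference is invisible. -/
theorem Term.tr_fill {U : Term} (h : IsPattern .unguarded U) (R : Term) :
    (U.fill R).tr = U.tr.fill R.tr := by
  suffices H : ∀ U : Term, IsPattern .unguarded U → (U.fill R).tr = U.tr.fill R.tr from H U h
  intro U
  induction U using Term.rec (motive_2 := fun _ => True) (motive_3 := fun _ => True) with
  | loc a P ih =>
    intro h
    cases h with
    | proc h => rw [Term.fill_of_isProc h, Term.tr_fill_of_isProc h]
    | loc _ h => simp [Term.fill, Tr.fill, ih h]
  | par P Q ihP ihQ =>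
    intro h
    cases h with
    | proc h => rw [Term.fill_of_isProc h, Term.tr_fill_of_isProc h]
    | parPattern h h' => simp [Term.fill, Tr.fill, ihP h, ihQ h']
  | repl => intro h; cases h with | proc h => rw [Term.fill_of_isProc h, Term.tr_fill_of_isProc h]
  | sum => intro h; cases h with | proc h => rw [Term.fill_of_isProc h, Term.tr_fill_of_isProc h]
  | hole => intro h; simp [Term.fill, Tr.fill]
  | star => intro h; cases h with | proc h => cases h
  | _ => trivial

theorem IsPattern.fill_isProc {U R : Term} (h : IsPattern .unguarded U)
    (hR : IsProc .unguarded R) : IsProc .unguarded (U.fill R) := by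
  suffices H : ∀ U : Term, IsPattern .unguarded U → IsProc .unguarded (U.fill R) from H U h
  intro U
  induction U using Term.rec (motive_2 := fun _ => True) (motive_3 := fun _ => True) with
  | loc a P ih =>
    intro h
    cases h with
    | proc h => rw [Term.fill_of_isProc h]; exact h
    | loc _ h => exact .loc _ (ih h)
  | par P Q ihP ihQ =>
    intro h
    cases h with
    | proc h => rw [Term.fill_of_isProc h]; exact h
    | parPattern h h' => exact .par (ihP h) (ihQ h')
  | repl => intro h; cases h with | proc h => rw [Term.fill_of_isProc h]; exact h
  | sum => intro h; cases h with | proc h => rw [Term.fill_of_isProc h]; exact h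
  | hole => intro h; exact hR
  | star => intro h; cases h with | proc h => cases h
  | _ => trivial

mutual
-- The clause `U ∥ P` of preserving patterns is an instance of `U ∥ V`, since a process is an
-- unguarded pattern. This lets all later arguments treat unguarded terms only.
theorem IsProc.toUnguarded : ∀ {P : Term}, IsProc .preserving P → IsProc .unguarded P
  | .loc a P, h => by cases h with | loc _ h => exact .loc _ h.toUnguarded
  | .par P P', h => by cases h with | par h h' => exact .par h.toUnguarded h'.toUnguarded
  | .repl π P, h => by cases h with | repl hp h => exact .repl hp.toUnguarded h.toUnguarded
  | .sum B, h => by cases h with | sum h => exact .sum h.toUnguarded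
  | .hole, h => by cases h
  | .star, h => by cases h
theorem IsBranches.toUnguarded :
    ∀ {B : Branches}, IsBranches .preserving B → IsBranches .unguarded B
  | .nil, _ => .nil
  | .cons π P B, h => by
      cases h with | cons hp h h' => exact .cons hp.toUnguarded h.toUnguarded h'.toUnguarded
theorem IsPrefix.toUnguarded : ∀ {π : Prefix}, IsPrefix .preserving π → IsPrefix .unguarded π
  | .inp a, _ => .inp a
  | .out a, _ => .out a
  | .upd a U, h => by cases h with | upd _ h => exact .upd _ h.toUnguarded
theorem IsPattern.toUnguarded : ∀ {U : Term}, IsPattern .preserving U → IsPattern .unguarded U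
  | .loc a P, h => by cases h with | loc _ h => exact .loc _ h.toUnguarded
  | .par P P', h => by
      cases h with | parProc h h' => exact .parPattern h.toUnguarded (.proc h'.toUnguarded)
  | .repl π P, h => by cases h
  | .sum B, h => by cases h
  | .hole, h => .hole
  | .star, h => by cases h
end

end Evol

namespace Evol

/-! ## Nesting structures -/

theorem Tr.nloc_fill (U R : Tr) : (U.fill R).nloc = U.nloc + U.holes * R.nloc := by
  induction U with
  | leaf c => by_cases h : c = holeCode <;> simp [fill, nloc, holes, h]
  | loc a P ih => simp [fill, nloc, holes, ih]; ring
  | par P Q ihP ihQ => simp [fill, nloc, holes, ihP, ihQ]; ring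

theorem Tr.roots_fill (U R : Tr) : (U.fill R).roots = U.roots + U.outerHoles * R.roots := by
  induction U with
  | leaf c => by_cases h : c = holeCode <;> simp [fill, roots, outerHoles, h]
  | loc a P ih => simp [fill, roots, outerHoles]
  | par P Q ihP ihQ => simp [fill, roots, outerHoles, ihP, ihQ]; ring

theorem Tr.nloc_eq_zero_of_roots {R : Tr} (h : R.roots = 0) : R.nloc = 0 := by
  induction R with
  | leaf c => rfl
  | loc a P ih => simp [roots] at h
  | par P Q ihP ihQ => simp [roots] at h; simp [nloc, ihP h.1, ihQ h.2]

theorem Tr.outerHoles_of_nloc {U : Tr} (h : U.nloc = 0) : U.outerHoles = U.holes := by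
  induction U with
  | leaf c => rfl
  | loc a P ih => simp [nloc] at h
  | par P Q ihP ihQ => simp [nloc] at h; simp [outerHoles, holes, ihP h.1, ihQ h.2]

theorem Term.tr_star_nloc : Term.star.tr.nloc = 0 ∧ Term.star.tr.roots = 0 := by
  rw [Term.tr, ofCode]; simp [Term.code, Tr.nloc, Tr.roots]

/-- The number of nodes and the number of roots are the only invariants of the forest that the
characterization of allowed updates needs. -/
theorem SameNesting.nloc_roots {P Q : Term} (h : SameNesting P Q) :
    P.tr.nloc = Q.tr.nloc ∧ P.tr.roots = Q.tr.roots := by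
  induction h with
  | refl => exact ⟨rfl, rfl⟩
  | symm _ ih => exact ⟨ih.1.symm, ih.2.symm⟩
  | trans _ _ ih ih' => exact ⟨ih.1.trans ih'.1, ih.2.trans ih'.2⟩
  | loc a _ ih => simp [Tr.nloc, Tr.roots, ih.1]
  | par _ _ ih ih' => simp [Tr.nloc, Tr.roots, ih, ih']
  | comm => simp [Tr.nloc, Tr.roots, add_comm]
  | assoc => simp [Tr.nloc, Tr.roots, add_assoc]
  | unit => simp [Tr.nloc, Tr.roots, Term.zero]
  | repl => simp [Tr.nloc, Tr.roots, Term.zero]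
  | sum => simp [Tr.nloc, Tr.roots, Term.zero]

theorem Branches.locs_of_static : ∀ {B : Branches}, B.Static → B.locs = []
  | .nil, _ => rfl
  | .cons π P B, h => by
      simp only [Branches.Static] at h
      simp [Branches.locs, h.2.1.2, Branches.locs_of_static h.2.2]

theorem Term.nloc_tr_of_static : ∀ {P : Term}, P.Static → P.tr.nloc = P.locs.length
  | .loc a P, h => by simp [Tr.nloc, Term.locs, Term.nloc_tr_of_static (P := P) h]
  | .par P Q, h => by
      simp [Tr.nloc, Term.locs, Term.nloc_tr_of_static h.1, Term.nloc_tr_of_static h.2]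
  | .repl π P, h => by simp only [Term.Static] at h; simp [Tr.nloc, Term.locs, h.2.2]
  | .sum B, h => by
      simp only [Term.Static] at h; simp [Tr.nloc, Term.locs, Branches.locs_of_static h]
  | .hole, _ => by simp [Tr.nloc, Term.locs]
  | .star, _ => by simp [Term.locs, Term.tr_star_nloc]

theorem SameNesting.of_locs_nil : ∀ {P : Term}, IsProc .unguarded P → P.Static → P.locs = [] →
    SameNesting P .zero
  | .loc a P, _, _, h => by simp [Term.locs] at h
  | .par P Q, hp, hs, h => by
      cases hp with
      | par hp hp' =>
        simp [Term.locs] at h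
        exact (SameNesting.par (of_locs_nil hp hs.1 h.1) (of_locs_nil hp' hs.2 h.2)).trans
          (.unit _)
  | .repl π P, _, _, _ => .repl _ _
  | .sum B, _, _, _ => .sum _
  | .hole, h, _, _ => by cases h
  | .star, h, _, _ => by cases h

theorem SameNesting.of_locs_singleton {a : ℕ} : ∀ {P : Term}, IsProc .unguarded P → P.Static →
    P.locs = [a] → SameNesting P (.loc a .zero)
  | .loc b P, hp, hs, h => by
      simp [Term.locs] at h
      cases hp with
      | loc _ hp => rw [h.1]; exact .loc _ (of_locs_nil hp hs h.2)
  | .par P Q, hp, hs, h => by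
      cases hp with
      | par hp hp' =>
        simp only [Term.locs, List.append_eq_singleton_iff] at h
        rcases h with ⟨h, h'⟩ | ⟨h, h'⟩
        · exact (SameNesting.par (of_locs_nil hp hs.1 h) (of_locs_singleton hp' hs.2 h')).trans
            ((SameNesting.comm _ _).trans (.unit _))
        · exact (SameNesting.par (of_locs_singleton hp hs.1 h) (of_locs_nil hp' hs.2 h')).trans
            (.unit _)
  | .repl π P, _, hs, h => by
      simp only [Term.Static] at hs
      simp [Term.locs, hs.2.2] at h
  | .sum B, _, hs, h => by
      simp only [Term.Static] at hs
      simp [Term.locs, Branches.locs_of_static hs] at h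
  | .hole, h, _, _ => by cases h
  | .star, h, _, _ => by cases h

theorem IsPattern.par_cases {U V : Term} (h : IsPattern .unguarded (.par U V)) :
    IsPattern .unguarded U ∧ IsPattern .unguarded V := by
  cases h with
  | proc h => cases h with | par h h' => exact ⟨.proc h, .proc h'⟩
  | parPattern h h' => exact ⟨h, h'⟩

theorem IsPattern.loc_cases {a : ℕ} {U : Term} (h : IsPattern .unguarded (.loc a U)) :
    IsPattern .unguarded U := by
  cases h with
  | proc h => cases h with | loc _ h => exact .proc h
  | loc _ h => exact h

theorem IsPattern.not_star : ¬ IsPattern .unguarded .star := by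
  intro h; cases h with | proc h => cases h

theorem IsPattern.repl_cases {π : Prefix} {P : Term} (h : IsPattern .unguarded (.repl π P)) :
    IsProc .unguarded (.repl π P) := by
  cases h with | proc h => exact h

theorem IsPattern.sum_cases {B : Branches} (h : IsPattern .unguarded (.sum B)) :
    IsProc .unguarded (.sum B) := by
  cases h with | proc h => exact h

theorem static_fill {R : Term} (hR : R.Static) : ∀ {U : Term}, IsPattern .unguarded U → U.Static →
    (U.fill R).Static
  | .loc a P, hp, hs => by
      simp only [Term.fill, Term.Static] at hs ⊢
      exact static_fill hR hp.loc_cases hs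
  | .par P Q, hp, hs => by
      simp only [Term.fill, Term.Static] at hs ⊢
      exact ⟨static_fill hR hp.par_cases.1 hs.1, static_fill hR hp.par_cases.2 hs.2⟩
  | .repl π P, hp, hs => by rw [Term.fill_of_isProc hp.repl_cases]; exact hs
  | .sum B, hp, hs => by rw [Term.fill_of_isProc hp.sum_cases]; exact hs
  | .hole, _, _ => hR
  | .star, h, _ => (IsPattern.not_star h).elim

theorem mem_locs_fill {R : Term} {a : ℕ} : ∀ {U : Term}, IsPattern .unguarded U → a ∈ U.locs →
    a ∈ (U.fill R).locs
  | .loc b P, hp, h => by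
      simp only [Term.fill, Term.locs, List.mem_cons] at h ⊢
      exact h.imp_right (mem_locs_fill hp.loc_cases)
  | .par P Q, hp, h => by
      simp only [Term.fill, Term.locs, List.mem_append] at h ⊢
      exact h.imp (mem_locs_fill hp.par_cases.1) (mem_locs_fill hp.par_cases.2)
  | .repl π P, hp, h => by rw [Term.fill_of_isProc hp.repl_cases]; exact h
  | .sum B, hp, h => by rw [Term.fill_of_isProc hp.sum_cases]; exact h
  | .hole, _, h => by simp [Term.locs] at h
  | .star, h, _ => (IsPattern.not_star h).elim

theorem SameNesting.fill_of_holes_eq_zero {R : Term} : ∀ {U : Term}, IsPattern .unguarded U →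
    U.Static → U.locs = [] → U.tr.holes = 0 → SameNesting (U.fill R) .zero
  | .loc a P, _, _, h, _ => by simp [Term.locs] at h
  | .par P Q, hp, hs, h, hh => by
      simp [Term.locs] at h
      simp [Tr.holes] at hh
      exact (SameNesting.par (fill_of_holes_eq_zero hp.par_cases.1 hs.1 h.1 hh.1)
        (fill_of_holes_eq_zero hp.par_cases.2 hs.2 h.2 hh.2)).trans (.unit _)
  | .repl π P, _, _, _, _ => .repl _ _
  | .sum B, _, _, _, _ => .sum _
  | .hole, _, _, _, h => by simp [Tr.holes] at h
  | .star, h, _, _, _ => (IsPattern.not_star h).elim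

theorem SameNesting.fill_of_locs_nil {R : Term} : ∀ {U : Term}, IsPattern .unguarded U →
    U.Static → U.locs = [] → U.tr.holes = 1 → SameNesting (U.fill R) R
  | .loc a P, _, _, h, _ => by simp [Term.locs] at h
  | .par P Q, hp, hs, h, hh => by
      simp [Term.locs] at h
      simp [Tr.holes, Nat.add_eq_one_iff] at hh
      rcases hh with hh | hh
      · exact ((SameNesting.par (fill_of_holes_eq_zero hp.par_cases.1 hs.1 h.1 hh.1)
          (fill_of_locs_nil hp.par_cases.2 hs.2 h.2 hh.2)).trans (.comm _ _)).trans (.unit _)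
      · exact (SameNesting.par (fill_of_locs_nil hp.par_cases.1 hs.1 h.1 hh.1)
          (fill_of_holes_eq_zero hp.par_cases.2 hs.2 h.2 hh.2)).trans (.unit _)
  | .repl π P, _, _, _, h => by simp [Tr.holes, Term.code, holeCode] at h
  | .sum B, _, _, _, h => by simp [Tr.holes, Term.code, holeCode] at h
  | .hole, _, _, _, _ => .refl _
  | .star, h, _, _, _ => (IsPattern.not_star h).elim

/-- Since the only hole is not outermost, it lies inside the single location `a`. All other parts of
the pattern are free of locations and vanish from the forest. -/
theorem SameNesting.fill_of_inner_hole {R : Term} {a : ℕ} : ∀ {U : Term},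
    IsPattern .unguarded U → U.Static → U.locs = [a] → U.tr.holes = 1 → U.tr.outerHoles = 0 →
    SameNesting (U.fill R) (.loc a R)
  | .loc b P, hp, hs, h, hh, _ => by
      simp [Term.locs] at h
      simp [Tr.holes] at hh
      rw [Term.fill, h.1]
      exact .loc _ (fill_of_locs_nil hp.loc_cases hs h.2 hh)
  | .par P Q, hp, hs, h, hh, ho => by
      simp only [Term.locs, List.append_eq_singleton_iff] at h
      simp [Tr.outerHoles] at ho
      have key : ∀ X : Term, X.Static → X.locs = [] → X.tr.outerHoles = 0 → X.tr.holes = 0 := by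
        intro X hs hX h0
        rwa [← Tr.outerHoles_of_nloc]
        simp [Term.nloc_tr_of_static hs, hX]
      rcases h with ⟨h, h'⟩ | ⟨h, h'⟩
      · have := key P hs.1 h ho.1
        simp [Tr.holes, this] at hh
        exact ((SameNesting.par (fill_of_holes_eq_zero hp.par_cases.1 hs.1 h this)
          (fill_of_inner_hole hp.par_cases.2 hs.2 h' hh ho.2)).trans (.comm _ _)).trans (.unit _)
      · have := key Q hs.2 h' ho.2
        simp [Tr.holes, this] at hh
        exact (SameNesting.par (fill_of_inner_hole hp.par_cases.1 hs.1 h hh ho.1)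
          (fill_of_holes_eq_zero hp.par_cases.2 hs.2 h' this)).trans (.unit _)
  | .repl π P, _, hs, h, _, _ => by
      simp only [Term.Static] at hs; simp [Term.locs, hs.2.2] at h
  | .sum B, _, hs, h, _, _ => by
      simp only [Term.Static] at hs; simp [Term.locs, Branches.locs_of_static hs] at h
  | .hole, _, _, h, _, _ => by simp [Term.locs] at h
  | .star, h, _, _, _, _ => (IsPattern.not_star h).elim

/-- Processes of the calculus with unguarded patterns. -/
def Good (t : Topology) (P : Term) : Prop := IsProc .unguarded P ∧ (t = .static → P.Static)

/-- Patterns that may occur in an update of `a`. -/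
def GoodPat (t : Topology) (a : ℕ) (U : Term) : Prop :=
  IsPattern .unguarded U ∧ (t = .static → U.Static ∧ U.locs = [a])

/-- If `R` has locations, comparing the numbers of nodes forces exactly one hole, and comparing the
numbers of roots forces it inside the location of `U`. If `R` has none, the filled pattern has the
one location of `U`, at the right name. The gain is a computable condition that depends on `R` only
through whether it contains a location, hence one that is stable under embedding. -/
theorem allowed_iff_perm {t : Topology} {a : ℕ} {R U : Term} (hR : Good t R)
    (hU : GoodPat t a U) : Allowed t a R U ↔ Perm t R.tr U.tr := by
  cases t with
  | dynamic => simp [Allowed, Perm]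
  | static =>
    obtain ⟨hR, hRs⟩ := hR
    obtain ⟨hU, hUs⟩ := hU
    specialize hRs rfl
    obtain ⟨hUs, hUl⟩ := hUs rfl
    simp only [Allowed, Perm, forall_const]
    constructor
    · intro h
      have h := h.nloc_roots
      rw [Term.tr_fill hU, Tr.nloc_fill, Tr.roots_fill, Term.nloc_tr_of_static hUs, hUl] at h
      simp only [Term.tr_loc, Tr.nloc, Tr.roots, List.length_singleton] at h
      -- The location of `U` provides a root already, so the single root of `a[R]` leaves none for
      -- an outermost hole.
      have hr : 1 ≤ U.tr.roots := by
        by_contra hc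
        have := Tr.nloc_eq_zero_of_roots (R := U.tr) (by omega)
        rw [Term.nloc_tr_of_static hUs, hUl] at this
        simp at this
      by_cases h0 : R.tr.nloc = 0
      · exact .inl h0
      · right
        have h1 : U.tr.holes * R.tr.nloc = R.tr.nloc := by omega
        have h2 : U.tr.outerHoles * R.tr.roots = 0 := by omega
        refine ⟨Nat.eq_of_mul_eq_mul_right (Nat.pos_of_ne_zero h0) (by simpa using h1), ?_⟩
        rcases Nat.mul_eq_zero.1 h2 with h | h
        · exact h
        · exact (h0 (Tr.nloc_eq_zero_of_roots h)).elim
    · rintro (h | ⟨h, h'⟩)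
      · have hRl : R.locs = [] := by
          rw [Term.nloc_tr_of_static hRs] at h; simpa using h
        refine (SameNesting.loc a (.of_locs_nil hR hRs hRl)).trans (SameNesting.symm ?_)
        have hs := static_fill hRs hU hUs
        refine .of_locs_singleton (hU.fill_isProc hR) hs ?_
        have hl := Term.nloc_tr_of_static hs
        rw [Term.tr_fill hU, Tr.nloc_fill, h, Term.nloc_tr_of_static hUs, hUl] at hl
        simp only [List.length_singleton, mul_zero, add_zero] at hl
        obtain ⟨b, hb⟩ := List.length_eq_one_iff.1 hl.symm
        have hm := mem_locs_fill (R := R) (a := a) hU (by simp [hUl])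
        rw [hb] at hm ⊢
        simp at hm
        rw [hm]
      · exact (SameNesting.fill_of_inner_hole hU hUs hUl h h').symm

/-! ## Transitions of terms and of trees -/

theorem Good.loc_iff {t : Topology} {a : ℕ} {P : Term} : Good t (.loc a P) ↔ Good t P := by
  constructor
  · rintro ⟨h, hs⟩; cases h with | loc _ h => exact ⟨h, hs⟩
  · rintro ⟨h, hs⟩; exact ⟨.loc _ h, hs⟩

theorem Good.par_iff {t : Topology} {P Q : Term} :
    Good t (.par P Q) ↔ Good t P ∧ Good t Q := by
  constructor
  · rintro ⟨h, hs⟩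
    cases h with | par h h' => exact ⟨⟨h, fun ht => (hs ht).1⟩, ⟨h', fun ht => (hs ht).2⟩⟩
  · rintro ⟨⟨h, hs⟩, ⟨h', hs'⟩⟩; exact ⟨.par h h', fun ht => ⟨hs ht, hs' ht⟩⟩

/-- Prefixes of the calculus. -/
def GoodPre (t : Topology) : Prefix → Prop
  | .upd a U => GoodPat t a U
  | _ => True

theorem Good.of_mem {t : Topology} {π : Prefix} {P : Term} : ∀ {B : Branches},
    Good t (.sum B) → B.Mem π P → GoodPre t π ∧ Good t P ∧ (t = .static → P.locs = [])
  | .nil, _, h => by cases h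
  | .cons ρ R B, ⟨h, hs⟩, hm => by
      cases h with
      | sum h =>
      cases h with
      | cons hρ hR hB =>
        cases hm with
        | head =>
          refine ⟨?_, ⟨hR, fun ht => (hs ht).2.1.1⟩, fun ht => (hs ht).2.1.2⟩
          cases π with
          | upd a U => cases hρ with | upd _ h => exact ⟨h, fun ht => (hs ht).1⟩
          | _ => trivial
        | tail _ _ hm => exact Good.of_mem ⟨.sum hB, fun ht => (hs ht).2.2⟩ hm

theorem Good.of_repl {t : Topology} {π : Prefix} {P : Term} (h : Good t (.repl π P)) :
    GoodPre t π ∧ Good t P ∧ (t = .static → P.locs = []) := by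
  obtain ⟨h, hs⟩ := h
  cases h with
  | repl hπ hP =>
    refine ⟨?_, ⟨hP, fun ht => (hs ht).2.1⟩, fun ht => (hs ht).2.2⟩
    cases π with
    | upd a U => cases hπ with | upd _ h => exact ⟨h, fun ht => (hs ht).1⟩
    | _ => trivial

theorem Good.fill {t : Topology} {a : ℕ} {U R : Term} (hU : GoodPat t a U) (hR : Good t R) :
    Good t (U.fill R) :=
  ⟨hU.1.fill_isProc hR.1, fun ht => static_fill (hR.2 ht) hU.1 (hU.2 ht).1⟩

/-- The transitions agree because codes of leaves decode to their summands. The last conjunct holds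
since static continuations release no location; it contributes to the invariance of the number of
locations along computations. -/
theorem trans_prefix_to_tree {t : Topology} {P P' : Term} {π : Prefix} {α : Label}
    (h : Trans t P α P') (hα : α = π.label) (hP : Good t P) :
    TT t P.tr π.lab P'.tr ∧ GoodPre t π ∧ Good t P' ∧ (t = .static → P'.tr.nloc = P.tr.nloc) := by
  have hinj : ∀ {π ρ : Prefix}, π.label = ρ.label → π = ρ := by
    intro π ρ h; cases π <;> cases ρ <;> simp [Prefix.label] at h ⊢ <;> assumption
  have hcomp : ∀ {π : Prefix} {a : ℕ} {R : Term}, π.label ≠ .comp a R := by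
    intro π a R; cases π <;> simp [Prefix.label]
  have htau : ∀ {π : Prefix}, π.label ≠ .tau := by intro π; cases π <;> simp [Prefix.label]
  induction h generalizing π with
  | sum hm =>
    cases hinj hα
    have := Good.of_mem hP hm
    refine ⟨?_, this.1, this.2.1, fun ht => ?_⟩
    · rw [Term.tr_sum]; exact .leaf ((mem_acts_sum _).2 ⟨_, _, hm, rfl, rfl⟩)
    · rw [Term.nloc_tr_of_static (this.2.1.2 ht), this.2.2 ht]; simp [Tr.nloc]
  | repl ρ P =>
    cases hinj hα
    have := Good.of_repl hP
    refine ⟨?_, this.1, Good.par_iff.2 ⟨this.2.1, hP⟩, fun ht => ?_⟩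
    · rw [Term.tr_par, Term.tr_repl]; exact .leaf (by rw [acts_repl]; simp)
    · simp [Term.nloc_tr_of_static (this.2.1.2 ht), this.2.2 ht, Tr.nloc]
  | comp => exact (hcomp hα.symm).elim
  | loc a _ ih =>
    obtain ⟨h1, h2, h3, h4⟩ := ih hα (Good.loc_iff.1 hP)
    exact ⟨by simpa using TT.loc a h1, h2, Good.loc_iff.2 h3,
      fun ht => by simp [Tr.nloc, h4 ht]⟩
  | act1 Q _ ih =>
    have hg := Good.par_iff.1 hP
    obtain ⟨h1, h2, h3, h4⟩ := ih hα hg.1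
    exact ⟨by simpa using TT.parL _ h1, h2, Good.par_iff.2 ⟨h3, hg.2⟩,
      fun ht => by simp [Tr.nloc, h4 ht]⟩
  | act2 Q _ ih =>
    have hg := Good.par_iff.1 hP
    obtain ⟨h1, h2, h3, h4⟩ := ih hα hg.2
    exact ⟨by simpa using TT.parR _ h1, h2, Good.par_iff.2 ⟨hg.1, h3⟩,
      fun ht => by simp [Tr.nloc, h4 ht]⟩
  | tau1 => exact (htau hα.symm).elim
  | tau2 => exact (htau hα.symm).elim
  | tau3 => exact (htau hα.symm).elim
  | tau4 => exact (htau hα.symm).elim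

theorem Allowed.nloc_fill {a : ℕ} {R U : Term} (h : Allowed .static a R U) :
    (U.fill R).tr.nloc = R.tr.nloc + 1 := by
  have := h.nloc_roots.1
  rw [← this]; simp [Tr.nloc]

/-- Emitting `a[R]` and substituting for `⋆` afterwards is folded into one absorption. The
substitution does not touch the idle parallel components, which are processes and have no
placeholder. -/
theorem trans_comp_to_tree {t : Topology} {P P' : Term} {α : Label} (h : Trans t P α P')
    {a : ℕ} {R U : Term} (hα : α = .comp a R) (hP : Good t P) (hU : GoodPat t a U)
    (hal : Allowed t a R U) :
    TT t P.tr (3, a, U.tr) (P'.substStar (U.fill R)).tr ∧ Good t (P'.substStar (U.fill R)) ∧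
      (t = .static → (P'.substStar (U.fill R)).tr.nloc = P.tr.nloc) := by
  induction h with
  | sum => rename_i π _ _; cases π <;> simp [Prefix.label] at hα
  | repl π P => cases π <;> simp [Prefix.label] at hα
  | comp b P =>
    cases hα
    have hP := Good.loc_iff.1 hP
    rw [Term.substStar, Term.tr_loc, Term.tr_fill hU.1]
    refine ⟨.abs _ ((allowed_iff_perm hP hU).1 hal), Good.fill hU hP, fun ht => ?_⟩
    subst ht
    rw [← Term.tr_fill hU.1, hal.nloc_fill]; simp [Tr.nloc]
  | loc b _ ih =>
    obtain ⟨h1, h2, h3⟩ := ih hα (Good.loc_iff.1 hP)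
    exact ⟨by simpa [Term.substStar] using TT.loc b h1, by
      simpa [Term.substStar] using Good.loc_iff.2 h2,
      fun ht => by simp [Term.substStar, Tr.nloc, h3 ht]⟩
  | act1 Q _ ih =>
    have hg := Good.par_iff.1 hP
    obtain ⟨h1, h2, h3⟩ := ih hα hg.1
    rw [Term.substStar, Term.substStar_of_isProc hg.2.1]
    exact ⟨by simpa using TT.parL _ h1, Good.par_iff.2 ⟨h2, hg.2⟩,
      fun ht => by simp [Tr.nloc, h3 ht]⟩
  | act2 Q _ ih =>
    have hg := Good.par_iff.1 hP
    obtain ⟨h1, h2, h3⟩ := ih hα hg.2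
    rw [Term.substStar, Term.substStar_of_isProc hg.1.1]
    exact ⟨by simpa using TT.parR _ h1, Good.par_iff.2 ⟨hg.1, h2⟩,
      fun ht => by simp [Tr.nloc, h3 ht]⟩
  | tau1 => cases hα
  | tau2 => cases hα
  | tau3 => cases hα
  | tau4 => cases hα

theorem step_to_tree {t : Topology} {P P' : Term} (h : Step t P P') (hP : Good t P) :
    TStep t P.tr P'.tr ∧ Good t P' ∧ (t = .static → P'.tr.nloc = P.tr.nloc) := by
  unfold Step at h
  generalize hα : Label.tau = α at h
  induction h with
  | sum => rename_i π _ _; cases π <;> simp [Prefix.label] at hα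
  | repl π P => cases π <;> simp [Prefix.label] at hα
  | comp b P => cases hα
  | loc b _ ih =>
    obtain ⟨h1, h2, h3⟩ := ih (Good.loc_iff.1 hP) hα
    exact ⟨by simpa using TStep.loc b h1, Good.loc_iff.2 h2,
      fun ht => by simp [Tr.nloc, h3 ht]⟩
  | act1 Q _ ih =>
    have hg := Good.par_iff.1 hP
    obtain ⟨h1, h2, h3⟩ := ih hg.1 hα
    exact ⟨by simpa using TStep.parL _ h1, Good.par_iff.2 ⟨h2, hg.2⟩,
      fun ht => by simp [Tr.nloc, h3 ht]⟩
  | act2 Q _ ih =>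
    have hg := Good.par_iff.1 hP
    obtain ⟨h1, h2, h3⟩ := ih hg.2 hα
    exact ⟨by simpa using TStep.parR _ h1, Good.par_iff.2 ⟨hg.1, h2⟩,
      fun ht => by simp [Tr.nloc, h3 ht]⟩
  | @tau1 P P' Q Q' a h1 h2 =>
    have hg := Good.par_iff.1 hP
    obtain ⟨h1, -, h3, h4⟩ := trans_prefix_to_tree (π := .inp a) h1 rfl hg.1
    obtain ⟨k1, -, k3, k4⟩ := trans_prefix_to_tree (π := .out a) h2 rfl hg.2
    exact ⟨by simpa using TStep.sync h1 k1, Good.par_iff.2 ⟨h3, k3⟩,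
      fun ht => by simp [Tr.nloc, h4 ht, k4 ht]⟩
  | @tau2 P P' Q Q' a h1 h2 =>
    have hg := Good.par_iff.1 hP
    obtain ⟨h1, -, h3, h4⟩ := trans_prefix_to_tree (π := .out a) h1 rfl hg.1
    obtain ⟨k1, -, k3, k4⟩ := trans_prefix_to_tree (π := .inp a) h2 rfl hg.2
    exact ⟨by simpa using TStep.sync h1 k1, Good.par_iff.2 ⟨h3, k3⟩,
      fun ht => by simp [Tr.nloc, h4 ht, k4 ht]⟩
  | @tau3 P P' Q Q' R U a h1 h2 hal =>
    have hg := Good.par_iff.1 hP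
    obtain ⟨k1, k2, k3, k4⟩ := trans_prefix_to_tree (π := .upd a U) h2 rfl hg.2
    obtain ⟨h1, h3, h4⟩ := trans_comp_to_tree h1 rfl hg.1 k2 hal
    exact ⟨by simpa using TStep.sync h1 k1, Good.par_iff.2 ⟨h3, k3⟩,
      fun ht => by simp [Tr.nloc, h4 ht, k4 ht]⟩
  | @tau4 P P' Q Q' R U a h1 h2 hal =>
    have hg := Good.par_iff.1 hP
    obtain ⟨k1, k2, k3, k4⟩ := trans_prefix_to_tree (π := .upd a U) h1 rfl hg.1
    obtain ⟨h1, h3, h4⟩ := trans_comp_to_tree h2 rfl hg.2 k2 hal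
    exact ⟨by simpa using TStep.sync k1 h1, Good.par_iff.2 ⟨k3, h3⟩,
      fun ht => by simp [Tr.nloc, h4 ht, k4 ht]⟩

theorem Prefix.lab_kind (π : Prefix) : π.lab.1 ≠ 3 := by cases π <;> simp [Prefix.lab]

theorem tree_to_trans_prefix {t : Topology} {α : Lab} (hα : α.1 ≠ 3) : ∀ {P : Term} {T : Tr},
    Good t P → TT t P.tr α T → ∃ (π : Prefix) (P' : Term), Trans t P π.label P' ∧ π.lab = α ∧ P'.tr = T
  | .loc a P, T, hP, h => by
      rw [Term.tr_loc] at h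
      cases h with
      | abs => exact (hα rfl).elim
      | loc _ h =>
        obtain ⟨π, P', h1, h2, h3⟩ := tree_to_trans_prefix hα (Good.loc_iff.1 hP) h
        exact ⟨π, _, .loc a h1, h2, by simp [h3]⟩
  | .par P Q, T, hP, h => by
      have hg := Good.par_iff.1 hP
      rw [Term.tr_par] at h
      cases h with
      | parL _ h =>
        obtain ⟨π, P', h1, h2, h3⟩ := tree_to_trans_prefix hα hg.1 h
        exact ⟨π, _, .act1 _ h1, h2, by simp [h3]⟩
      | parR _ h =>
        obtain ⟨π, P', h1, h2, h3⟩ := tree_to_trans_prefix hα hg.2 h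
        exact ⟨π, _, .act2 _ h1, h2, by simp [h3]⟩
  | .repl π P, T, hP, h => by
      rw [Term.tr_repl] at h
      cases h with
      | leaf h =>
        rw [acts_repl] at h
        simp at h
        exact ⟨π, .par P (.repl π P), .repl π P, h.1.symm, by simp [h.2]⟩
  | .sum B, T, hP, h => by
      rw [Term.tr_sum] at h
      cases h with
      | leaf h =>
        obtain ⟨π, P', h1, h2, h3⟩ := (mem_acts_sum B).1 h
        exact ⟨π, P', .sum h1, h2.symm, h3.symm⟩
  | .hole, _, h, _ => by cases h.1
  | .star, _, h, _ => by cases h.1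

theorem tree_to_trans_comp {t : Topology} {a : ℕ} {U : Term} (hU : GoodPat t a U) :
    ∀ {P : Term} {T : Tr}, Good t P → TT t P.tr (3, a, U.tr) T →
    ∃ R P', Trans t P (.comp a R) P' ∧ Allowed t a R U ∧ (P'.substStar (U.fill R)).tr = T
  | .loc b P, T, hP, h => by
      rw [Term.tr_loc] at h
      have hP' := Good.loc_iff.1 hP
      cases h with
      | abs _ hp =>
        exact ⟨P, .star, .comp _ _, (allowed_iff_perm hP' hU).2 hp, by
          rw [Term.substStar, Term.tr_fill hU.1]⟩
      | loc _ h =>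
        obtain ⟨π, P', h1, h2, h3⟩ := tree_to_trans_comp hU hP' h
        exact ⟨π, _, .loc b h1, h2, by simp [Term.substStar, h3]⟩
  | .par P Q, T, hP, h => by
      have hg := Good.par_iff.1 hP
      rw [Term.tr_par] at h
      cases h with
      | parL _ h =>
        obtain ⟨π, P', h1, h2, h3⟩ := tree_to_trans_comp hU hg.1 h
        exact ⟨π, _, .act1 _ h1, h2, by
          simp [Term.substStar, h3, Term.substStar_of_isProc hg.2.1]⟩
      | parR _ h =>
        obtain ⟨π, P', h1, h2, h3⟩ := tree_to_trans_comp hU hg.2 h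
        exact ⟨π, _, .act2 _ h1, h2, by
          simp [Term.substStar, h3, Term.substStar_of_isProc hg.1.1]⟩
  | .repl π P, T, hP, h => by
      rw [Term.tr_repl] at h
      cases h with
      | leaf h =>
        rw [acts_repl] at h
        simp at h
        exact (Prefix.lab_kind π (by rw [← h.1])).elim
  | .sum B, T, hP, h => by
      rw [Term.tr_sum] at h
      cases h with
      | leaf h =>
        obtain ⟨π, P', h1, h2, h3⟩ := (mem_acts_sum B).1 h
        exact (Prefix.lab_kind π (by rw [← h2])).elim
  | .hole, _, h, _ => by cases h.1
  | .star, _, h, _ => by cases h.1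

theorem TT.kind_le {t : Topology} {P P' : Tr} {α : Lab} (h : TT t P α P') : α.1 ≤ 3 := by
  have hl : ∀ p, (labOf p).1 ≤ 3 := by intro p; unfold labOf; split_ifs <;> simp
  have hb : ∀ n, ∀ x ∈ branchActs n, x.1.1 ≤ 3 := by
    intro n
    induction n using branchActs.induct with
    | case1 => simp [branchActs]
    | case2 n ih =>
      intro x hx
      rw [branchActs, List.mem_cons] at hx
      rcases hx with rfl | hx
      · exact hl _
      · exact ih x hx
  induction h with
  | leaf h =>
    unfold acts at h
    split_ifs at h
    · simp at h; rw [h.1]; exact hl _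
    · exact hb _ _ h
    · simp at h
  | abs => simp
  | _ => assumption

/-- For updates the side with the prefix is treated first: it shows that the pattern of the label is
the tree of an admissible term, without which the absorption on the other side could not be traced
back to a transition of terms. -/
theorem tree_sync {t : Topology} {P Q : Term} {T T' : Tr} {α : Lab} (hP : Good t P)
    (hQ : Good t Q) (h : TT t P.tr α T) (h' : TT t Q.tr α.dual T') :
    ∃ R, Step t (.par P Q) R ∧ R.tr = .par T T' := by
  by_cases hα : α.1 = 3
  · obtain ⟨k, a, X⟩ := α
    simp only at hα; subst hα
    obtain ⟨π, Q', k1, k2, k3⟩ := tree_to_trans_prefix (by simp [Lab.dual]) hQ h'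
    cases π with
    | upd b U =>
      have hg := (trans_prefix_to_tree k1 rfl hQ).2.1
      simp [Prefix.lab, Lab.dual] at k2
      obtain ⟨rfl, rfl⟩ := k2
      obtain ⟨R, P', h1, h2, h3⟩ := tree_to_trans_comp hg hP h
      exact ⟨_, .tau3 h1 k1 h2, by simp [h3, k3]⟩
    | _ => simp [Prefix.lab, Lab.dual] at k2
  · obtain ⟨π, P', h1, h2, h3⟩ := tree_to_trans_prefix hα hP h
    cases π with
    | upd b U =>
      have hg := (trans_prefix_to_tree h1 rfl hP).2.1
      subst h2
      obtain ⟨R, Q', k1, k2, k3⟩ := tree_to_trans_comp hg hQ h'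
      exact ⟨_, .tau4 h1 k1 k2, by simp [h3, k3]⟩
    | inp a =>
      subst h2
      obtain ⟨ρ, Q', k1, k2, k3⟩ := tree_to_trans_prefix (by simp [Lab.dual, Prefix.lab]) hQ h'
      cases ρ <;> simp [Prefix.lab, Lab.dual] at k2
      subst k2
      exact ⟨_, .tau1 h1 k1, by simp [h3, k3]⟩
    | out a =>
      subst h2
      obtain ⟨ρ, Q', k1, k2, k3⟩ := tree_to_trans_prefix (by simp [Lab.dual, Prefix.lab]) hQ h'
      cases ρ <;> simp [Prefix.lab, Lab.dual] at k2
      subst k2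
      exact ⟨_, .tau2 h1 k1, by simp [h3, k3]⟩

theorem tree_to_step {t : Topology} : ∀ {P : Term} {T : Tr}, Good t P → TStep t P.tr T →
    ∃ P', Step t P P' ∧ P'.tr = T
  | .loc b P, T, hP, h => by
      rw [Term.tr_loc] at h
      cases h with
      | loc _ h =>
        obtain ⟨P', h1, h2⟩ := tree_to_step (Good.loc_iff.1 hP) h
        exact ⟨_, .loc b h1, by simp [h2]⟩
  | .par P Q, T, hP, h => by
      have hg := Good.par_iff.1 hP
      rw [Term.tr_par] at h
      cases h with
      | sync h h' => exact tree_sync hg.1 hg.2 h h'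
      | parL _ h =>
        obtain ⟨P', h1, h2⟩ := tree_to_step hg.1 h
        exact ⟨_, .act1 _ h1, by simp [h2]⟩
      | parR _ h =>
        obtain ⟨P', h1, h2⟩ := tree_to_step hg.2 h
        exact ⟨_, .act2 _ h1, by simp [h2]⟩
  | .repl π P, T, hP, h => by rw [Term.tr_repl] at h; cases h
  | .sum B, T, hP, h => by rw [Term.tr_sum] at h; cases h
  | .hole, _, h, _ => by cases h.1
  | .star, _, h, _ => by cases h.1

theorem hasBarb_iff {t : Topology} {P : Term} (hP : Good t P) (e : Barb) :
    HasBarb t P e ↔ TBarb t P.tr e := by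
  constructor
  · rintro ⟨P', h⟩
    cases e with
    | inl a => exact ⟨_, (trans_prefix_to_tree (π := .inp a) h rfl hP).1⟩
    | inr a => exact ⟨_, (trans_prefix_to_tree (π := .out a) h rfl hP).1⟩
  · rintro ⟨T, h⟩
    cases e with
    | inl a =>
      obtain ⟨π, P', h1, h2, h3⟩ := tree_to_trans_prefix (by simp [Barb.lab]) hP h
      cases π <;> simp [Prefix.lab, Barb.lab] at h2
      subst h2; exact ⟨_, h1⟩
    | inr a =>
      obtain ⟨π, P', h1, h2, h3⟩ := tree_to_trans_prefix (by simp [Barb.lab]) hP h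
      cases π <;> simp [Prefix.lab, Barb.lab] at h2
      subst h2; exact ⟨_, h1⟩

end Evol

-- Decidability: a well-quasi-order with small predecessors.

namespace Evol

/-! ## The embedding order -/

/-- A part of a tree that may be dropped. -/
def Drop (t : Topology) (P : Tr) : Prop := t = .static → P.nloc = 0

/-- Homeomorphic embedding of trees; in a static topology all locations are preserved. -/
inductive Le (t : Topology) : Tr → Tr → Prop
  | leaf (c : ℕ) : Le t (.leaf c) (.leaf c)
  | loc (a : ℕ) {P Q : Tr} : Le t P Q → Le t (.loc a P) (.loc a Q)
  | par {P P' Q Q' : Tr} : Le t P P' → Le t Q Q' → Le t (.par P Q) (.par P' Q')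
  | dropL {P Q R : Tr} : Drop t R → Le t P Q → Le t P (.par R Q)
  | dropR {P Q R : Tr} : Drop t R → Le t P Q → Le t P (.par Q R)
  | under (a : ℕ) {P Q : Tr} : t = .dynamic → Le t P Q → Le t P (.loc a Q)

theorem Le.refl (t : Topology) : ∀ P, Le t P P
  | .leaf c => .leaf c
  | .loc a P => .loc a (Le.refl t P)
  | .par P Q => .par (Le.refl t P) (Le.refl t Q)

theorem Le.nloc_eq {P Q : Tr} (h : Le .static P Q) : P.nloc = Q.nloc := by
  induction h with
  | leaf => rfl
  | loc a _ ih => simp [Tr.nloc, ih]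
  | par _ _ ih ih' => simp [Tr.nloc, ih, ih']
  | dropL hd _ ih => simp [Tr.nloc, ih, hd rfl]
  | dropR hd _ ih => simp [Tr.nloc, ih, hd rfl]
  | under _ h => cases h

theorem Le.nloc_le {t : Topology} {P Q : Tr} (h : Le t P Q) : P.nloc ≤ Q.nloc := by
  induction h with
  | leaf => rfl
  | loc a _ ih => simp [Tr.nloc, ih]
  | par _ _ ih ih' => simp only [Tr.nloc]; omega
  | dropL hd _ ih => simp only [Tr.nloc]; omega
  | dropR hd _ ih => simp only [Tr.nloc]; omega
  | under _ h _ ih => simp only [Tr.nloc]; omega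

theorem Le.drop {t : Topology} {P Q : Tr} (h : Le t P Q) (hd : Drop t Q) : Drop t P := by
  intro ht; subst ht; rw [h.nloc_eq, hd rfl]

theorem Le.drop' {t : Topology} {P Q : Tr} (h : Le t P Q) (hd : Drop t P) : Drop t Q := by
  intro ht; subst ht; rw [← h.nloc_eq, hd rfl]

theorem Le.trans {t : Topology} {P Q R : Tr} (h : Le t P Q) (h' : Le t Q R) : Le t P R := by
  induction h' generalizing P with
  | leaf => exact h
  | loc a h' ih =>
    cases h with
    | loc _ h => exact .loc _ (ih h)
    | under _ ht h => exact .under _ ht (ih h)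
  | par h1 h2 ih1 ih2 =>
    cases h with
    | par k1 k2 => exact .par (ih1 k1) (ih2 k2)
    | dropL hd h => exact .dropL (h1.drop' hd) (ih2 h)
    | dropR hd h => exact .dropR (h2.drop' hd) (ih1 h)
  | dropL hd _ ih => exact .dropL hd (ih h)
  | dropR hd _ ih => exact .dropR hd (ih h)
  | under _ ht _ ih => exact .under _ ht (ih h)

instance (t : Topology) : IsPreorder Tr (Le t) where
  refl := Le.refl t
  trans _ _ _ := Le.trans

/-- The number of locations is monotone under embedding, so equal totals leave no room for `under`
or for dropping a component with locations. This reduces the static order to Kruskal's theorem. -/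
theorem Le.static_of_nloc {P Q : Tr} (h : Le .dynamic P Q) (hn : P.nloc = Q.nloc) :
    Le .static P Q := by
  induction h with
  | leaf => exact .leaf _
  | loc a _ ih => exact .loc _ (ih (by simpa [Tr.nloc] using hn))
  | par h h' ih ih' =>
    have := h.nloc_le
    have := h'.nloc_le
    simp only [Tr.nloc] at hn
    exact .par (ih (by omega)) (ih' (by omega))
  | dropL _ h ih =>
    have := h.nloc_le
    simp only [Tr.nloc] at hn
    exact .dropL (fun _ => by omega) (ih (by omega))
  | dropR _ h ih =>
    have := h.nloc_le
    simp only [Tr.nloc] at hn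
    exact .dropR (fun _ => by omega) (ih (by omega))
  | under _ _ h ih =>
    have := h.nloc_le
    simp only [Tr.nloc] at hn
    omega

/-- The trees whose leaves and names are at most `N`. -/
def Tr.InCls (N : ℕ) : Tr → Prop
  | .leaf c => c ≤ N
  | .loc a P => a ≤ N ∧ P.InCls N
  | .par P Q => P.InCls N ∧ Q.InCls N

/-- The number of nodes. -/
def Tr.size : Tr → ℕ
  | .leaf _ => 1
  | .loc _ P => P.size + 1
  | .par P Q => P.size + Q.size + 1

theorem Le.inCls {t : Topology} {N : ℕ} {P Q : Tr} (h : Le t P Q) (hQ : Q.InCls N) :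
    P.InCls N := by
  induction h with
  | leaf => exact hQ
  | loc a _ ih => exact ⟨hQ.1, ih hQ.2⟩
  | par _ _ ih ih' => exact ⟨ih hQ.1, ih' hQ.2⟩
  | dropL _ _ ih => exact ih hQ.2
  | dropR _ _ ih => exact ih hQ.1
  | under _ _ _ ih => exact ih hQ.2

/-! ## Kruskal's theorem -/

/-- Immediate subtrees. -/
def Tr.Child : Tr → Tr → Prop
  | _, .leaf _ => False
  | x, .loc _ P => x = P
  | x, .par P Q => x = P ∨ x = Q

theorem Tr.Child.size_lt : ∀ {x P : Tr}, x.Child P → x.size < P.size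
  | x, .loc _ P, h => by simp only [Tr.Child] at h; subst h; simp [Tr.size]
  | x, .par P Q, h => by
      simp only [Tr.Child] at h
      rcases h with rfl | rfl <;> simp only [Tr.size] <;> omega

theorem Tr.Child.inCls {N : ℕ} : ∀ {x P : Tr}, x.Child P → P.InCls N → x.InCls N
  | x, .loc _ P, h, hP => by simp only [Tr.Child] at h; subst h; exact hP.2
  | x, .par P Q, h, hP => by
      simp only [Tr.Child] at h
      rcases h with rfl | rfl
      · exact hP.1
      · exact hP.2

theorem Tr.Child.le : ∀ {x P : Tr}, x.Child P → Le .dynamic x P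
  | x, .loc _ P, h => by
      simp only [Tr.Child] at h; subst h; exact .under _ rfl (.refl _ _)
  | x, .par P Q, h => by
      simp only [Tr.Child] at h
      rcases h with rfl | rfl
      · exact .dropR nofun (.refl _ _)
      · exact .dropL nofun (.refl _ _)

/-- The minimal bad sequence argument of Nash-Williams. The bound `N` makes leaves and names a
finite alphabet, and since trees are binary, the product of well-quasi-orders replaces Higman's
lemma. -/
theorem kruskal_dynamic (N : ℕ) :
    {P : Tr | P.InCls N}.PartiallyWellOrderedOn (Le .dynamic) := by
  rw [Set.PartiallyWellOrderedOn.iff_not_exists_isMinBadSeq Tr.size]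
  rintro ⟨f, ⟨hfs, hfb⟩, hmin⟩
  have hsub : {x | ∃ n, x.Child (f n)}.PartiallyWellOrderedOn (Le .dynamic) := by
    rw [Set.PartiallyWellOrderedOn.iff_forall_not_isBadSeq]
    rintro g ⟨hg, hgb⟩
    choose φ hφ using hg
    -- Splicing at the earliest parent ensures that all children used come from positions of `f`
    -- that are not before the splice.
    obtain ⟨k₀, hk₀⟩ : ∃ k₀, ∀ k, φ k₀ ≤ φ k := by
      have hne : (Set.range φ).Nonempty := ⟨_, 0, rfl⟩
      obtain ⟨k₀, h⟩ := Nat.sInf_mem hne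
      exact ⟨k₀, fun k => h ▸ Nat.sInf_le ⟨k, rfl⟩⟩
    refine hmin (φ k₀) (fun n => if n < φ k₀ then f n else g (k₀ + (n - φ k₀)))
      (fun m hm => by simp [hm]) (by simpa using (hφ k₀).size_lt) ⟨fun n => ?_, fun m n hmn => ?_⟩
    · dsimp only
      split_ifs
      · exact hfs n
      · exact (hφ _).inCls (hfs _)
    · dsimp only
      split_ifs with h1 h2 h2
      · exact hfb m n hmn
      -- A tree below a child of a later member is below that member, so `f` itself would be good.
      · intro hle
        exact hfb m (φ (k₀ + (n - φ k₀))) (lt_of_lt_of_le h1 (hk₀ _)) (hle.trans (hφ _).le)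
      · omega
      · exact hgb _ _ (by omega)
  have hleaf : (Tr.leaf '' {c | c ≤ N}).PartiallyWellOrderedOn (Le .dynamic) :=
    haveI : Std.Refl (Le .dynamic) := ⟨Le.refl _⟩
    ((Set.finite_le_nat N).image _).partiallyWellOrderedOn
  have hloc : ((fun p : ℕ × Tr => Tr.loc p.1 p.2) ''
      ({c | c ≤ N} ×ˢ {x | ∃ n, x.Child (f n)})).PartiallyWellOrderedOn (Le .dynamic) := by
    have h1 : {c | c ≤ N}.PartiallyWellOrderedOn (fun a b : ℕ => a = b) :=
      (Set.finite_le_nat N).partiallyWellOrderedOn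
    refine (h1.prod hsub).image_of_monotone_on ?_
    rintro ⟨a, x⟩ - ⟨b, y⟩ - ⟨h, h'⟩
    simp only at h h'
    subst h
    exact .loc _ h'
  have hpar : ((fun p : Tr × Tr => Tr.par p.1 p.2) ''
      ({x | ∃ n, x.Child (f n)} ×ˢ {x | ∃ n, x.Child (f n)})).PartiallyWellOrderedOn
        (Le .dynamic) := by
    refine (hsub.prod hsub).image_of_monotone_on ?_
    rintro ⟨a, x⟩ - ⟨b, y⟩ - ⟨h, h'⟩
    exact .par h h'
  obtain ⟨m, n, hmn, hle⟩ := ((hleaf.union hloc).union hpar).exists_lt (f := f) (fun n => by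
    have h := hfs n
    rcases hn : f n with c | ⟨a, P⟩ | ⟨P, Q⟩ <;> rw [hn] at h
    · exact .inl (.inl ⟨c, h, rfl⟩)
    · exact .inl (.inr ⟨(a, P), ⟨h.1, n, by rw [hn]; rfl⟩, rfl⟩)
    · exact .inr ⟨(P, Q), ⟨⟨n, by rw [hn]; exact .inl rfl⟩, ⟨n, by rw [hn]; exact .inr rfl⟩⟩, rfl⟩)
  exact hfb m n hmn hle

/-- The trees of the class `N`; in a static topology they have exactly `K` locations. -/
def State (t : Topology) (N K : ℕ) (P : Tr) : Prop := P.InCls N ∧ (t = .static → P.nloc = K)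

theorem kruskal (t : Topology) (N K : ℕ) :
    {P : Tr | State t N K P}.PartiallyWellOrderedOn (Le t) := by
  rw [Set.partiallyWellOrderedOn_iff_exists_lt]
  intro f hf
  obtain ⟨m, n, hmn, h⟩ := (kruskal_dynamic N).exists_lt (f := f) (fun n => (hf n).1)
  refine ⟨m, n, hmn, ?_⟩
  cases t with
  | dynamic => exact h
  | static => exact h.static_of_nloc (((hf m).2 rfl).trans ((hf n).2 rfl).symm)

/-! ## Monotonicity -/

theorem Le.fill {t : Topology} {R R' : Tr} (h : Le t R R') : ∀ U : Tr, Le t (U.fill R) (U.fill R')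
  | .leaf c => by
      by_cases hc : c = holeCode
      · simpa [Tr.fill, hc]
      · simpa [Tr.fill, hc] using Le.leaf c
  | .loc a U => .loc a (h.fill U)
  | .par U V => .par (h.fill U) (h.fill V)

theorem Perm.congr {t : Topology} {R R' U : Tr} (h : t = .static → R.nloc = R'.nloc)
    (hp : Perm t R U) : Perm t R' U := by
  intro ht; rw [← h ht]; exact hp ht

/-- One transition is answered by one transition. An absorption survives enlargement because the
permission depends on the contents only through the number of locations, which static embeddings
preserve, and because filling is monotone. -/
theorem TT.mono {t : Topology} {P P' Q : Tr} {α : Lab} (h : TT t P α P') (hle : Le t P Q) :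
    ∃ Q', TT t Q α Q' ∧ Le t P' Q' := by
  induction hle generalizing P' with
  | leaf => exact ⟨_, h, .refl _ _⟩
  | loc a hle ih =>
    cases h with
    | abs _ hp =>
      exact ⟨_, .abs _ (hp.congr fun ht => by subst ht; exact hle.nloc_eq), hle.fill _⟩
    | loc _ h =>
      obtain ⟨Q', h1, h2⟩ := ih h
      exact ⟨_, .loc _ h1, .loc _ h2⟩
  | par h1 h2 ih1 ih2 =>
    cases h with
    | parL _ h =>
      obtain ⟨Q', k1, k2⟩ := ih1 h
      exact ⟨_, .parL _ k1, .par k2 h2⟩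
    | parR _ h =>
      obtain ⟨Q', k1, k2⟩ := ih2 h
      exact ⟨_, .parR _ k1, .par h1 k2⟩
  | dropL hd _ ih =>
    obtain ⟨Q', k1, k2⟩ := ih h
    exact ⟨_, .parR _ k1, .dropL hd k2⟩
  | dropR hd _ ih =>
    obtain ⟨Q', k1, k2⟩ := ih h
    exact ⟨_, .parL _ k1, .dropR hd k2⟩
  | under a ht _ ih =>
    obtain ⟨Q', k1, k2⟩ := ih h
    exact ⟨_, .loc _ k1, .under _ ht k2⟩

theorem TStep.mono {t : Topology} {P P' Q : Tr} (h : TStep t P P') (hle : Le t P Q) :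
    ∃ Q', TStep t Q Q' ∧ Le t P' Q' := by
  induction hle generalizing P' with
  | leaf => exact ⟨_, h, .refl _ _⟩
  | loc a hle ih =>
    cases h with
    | loc _ h =>
      obtain ⟨Q', h1, h2⟩ := ih h
      exact ⟨_, .loc _ h1, .loc _ h2⟩
  | par h1 h2 ih1 ih2 =>
    cases h with
    | sync h h' =>
      obtain ⟨Q', k1, k2⟩ := h.mono h1
      obtain ⟨Q'', k3, k4⟩ := h'.mono h2
      exact ⟨_, .sync k1 k3, .par k2 k4⟩
    | parL _ h =>
      obtain ⟨Q', k1, k2⟩ := ih1 h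
      exact ⟨_, .parL _ k1, .par k2 h2⟩
    | parR _ h =>
      obtain ⟨Q', k1, k2⟩ := ih2 h
      exact ⟨_, .parR _ k1, .par h1 k2⟩
  | dropL hd _ ih =>
    obtain ⟨Q', k1, k2⟩ := ih h
    exact ⟨_, .parR _ k1, .dropL hd k2⟩
  | dropR hd _ ih =>
    obtain ⟨Q', k1, k2⟩ := ih h
    exact ⟨_, .parL _ k1, .dropR hd k2⟩
  | under a ht _ ih =>
    obtain ⟨Q', k1, k2⟩ := ih h
    exact ⟨_, .loc _ k1, .under _ ht k2⟩

/-- Makes the error states upward closed, which is what turns bounded adaptation into a coverability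
problem. -/
theorem TBarb.mono {t : Topology} {P Q : Tr} {e : Barb} (h : TBarb t P e) (hle : Le t P Q) :
    TBarb t Q e := by
  obtain ⟨P', h⟩ := h
  obtain ⟨Q', h, -⟩ := h.mono hle
  exact ⟨Q', h⟩

/-! ## Small predecessors -/

/-- The number of locations that cannot be dropped. -/
def Tr.weight (P : Tr) : Topology → ℕ
  | .dynamic => 0
  | .static => P.nloc

/-- In a dynamic topology a single leaf remains. In a static one, `w > 0` locations have to stay,
with at most `w` leaves and `w - 1` parallel nodes, hence `3 * w - 1` nodes. -/
theorem exists_skeleton (t : Topology) : ∀ R : Tr,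
    ∃ R₀, Le t R₀ R ∧ R₀.size + 1 ≤ max 2 (3 * R.weight t)
  | .leaf c => ⟨_, .leaf c, by simp [Tr.size]⟩
  | .loc a P => by
      obtain ⟨P₀, h, hs⟩ := exists_skeleton t P
      cases t with
      | dynamic => exact ⟨P₀, .under _ rfl h, by simpa [Tr.weight] using hs⟩
      | static =>
        refine ⟨.loc a P₀, .loc a h, ?_⟩
        simp only [Tr.weight, Tr.size, Tr.nloc] at hs ⊢
        omega
  | .par P Q => by
      obtain ⟨P₀, h, hs⟩ := exists_skeleton t P
      obtain ⟨Q₀, k, ks⟩ := exists_skeleton t Q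
      cases t with
      | dynamic => exact ⟨P₀, .dropR nofun h, by simpa [Tr.weight] using hs⟩
      | static =>
        simp only [Tr.weight, Tr.nloc] at hs ks ⊢
        by_cases hP : P.nloc = 0
        · exact ⟨Q₀, .dropL (fun _ => hP) k, by omega⟩
        · by_cases hQ : Q.nloc = 0
          · exact ⟨P₀, .dropR (fun _ => hQ) h, by omega⟩
          · exact ⟨.par P₀ Q₀, .par h k, by simp only [Tr.size]; omega⟩

/-- Trees embedded in `R` behave like sets of nodes of `R`, and `z` like their union. The additional
node is the parallel composition needed when `x` and `y` lie on different sides. This combines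
several demands on one tree. -/
theorem exists_join {t : Topology} {x y R : Tr} (hx : Le t x R) (hy : Le t y R) :
    ∃ z, Le t z R ∧ Le t x z ∧ Le t y z ∧ z.size ≤ x.size + y.size + 1 := by
  induction R generalizing x y with
  | leaf c => exact ⟨_, .leaf c, hx, hy, by simp [Tr.size]⟩
  | loc a R ih =>
    cases hx with
    | loc _ hx =>
      cases hy with
      | loc _ hy =>
        obtain ⟨z, h1, h2, h3, h4⟩ := ih hx hy
        exact ⟨_, .loc _ h1, .loc _ h2, .loc _ h3, by simp only [Tr.size]; omega⟩
      | under _ ht hy =>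
        obtain ⟨z, h1, h2, h3, h4⟩ := ih hx hy
        exact ⟨_, .loc _ h1, .loc _ h2, .under _ ht h3, by simp only [Tr.size]; omega⟩
    | under _ ht hx =>
      cases hy with
      | loc _ hy =>
        obtain ⟨z, h1, h2, h3, h4⟩ := ih hx hy
        exact ⟨_, .loc _ h1, .under _ ht h2, .loc _ h3, by simp only [Tr.size]; omega⟩
      | under _ _ hy =>
        obtain ⟨z, h1, h2, h3, h4⟩ := ih hx hy
        exact ⟨_, .under _ ht h1, h2, h3, h4⟩
  | par R S ihR ihS =>
    cases hx with
    | par hx hx' =>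
      cases hy with
      | par hy hy' =>
        obtain ⟨z, h1, h2, h3, h4⟩ := ihR hx hy
        obtain ⟨w, k1, k2, k3, k4⟩ := ihS hx' hy'
        exact ⟨_, .par h1 k1, .par h2 k2, .par h3 k3, by simp only [Tr.size]; omega⟩
      | dropL hd hy =>
        obtain ⟨w, k1, k2, k3, k4⟩ := ihS hx' hy
        exact ⟨_, .par hx k1, .par (.refl _ _) k2, .dropL (hx.drop hd) k3, by
          simp only [Tr.size]; omega⟩
      | dropR hd hy =>
        obtain ⟨w, k1, k2, k3, k4⟩ := ihR hx hy
        exact ⟨_, .par k1 hx', .par k2 (.refl _ _), .dropR (hx'.drop hd) k3, by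
          simp only [Tr.size]; omega⟩
    | dropL hd hx =>
      cases hy with
      | par hy hy' =>
        obtain ⟨w, k1, k2, k3, k4⟩ := ihS hx hy'
        exact ⟨_, .par hy k1, .dropL (hy.drop hd) k2, .par (.refl _ _) k3, by
          simp only [Tr.size]; omega⟩
      | dropL _ hy =>
        obtain ⟨w, k1, k2, k3, k4⟩ := ihS hx hy
        exact ⟨_, .dropL hd k1, k2, k3, k4⟩
      | dropR hd' hy =>
        exact ⟨_, .par hy hx, .dropL (hy.drop hd) (.refl _ _), .dropR (hx.drop hd') (.refl _ _), by
          simp only [Tr.size]; omega⟩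
    | dropR hd hx =>
      cases hy with
      | par hy hy' =>
        obtain ⟨w, k1, k2, k3, k4⟩ := ihR hx hy
        exact ⟨_, .par k1 hy', .dropR (hy'.drop hd) k2, .par k3 (.refl _ _), by
          simp only [Tr.size]; omega⟩
      | dropL hd' hy =>
        exact ⟨_, .par hx hy, .dropR (hy.drop hd) (.refl _ _), .dropL (hx.drop hd') (.refl _ _), by
          simp only [Tr.size]; omega⟩
      | dropR _ hy =>
        obtain ⟨w, k1, k2, k3, k4⟩ := ihR hx hy
        exact ⟨_, .dropR hd k1, k2, k3, k4⟩

/-- One leaf or one location performs the action; the rest is dropped or shrunk to a skeleton. That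
the result stays below `P'` is needed to see that it may be dropped whenever `P'` may. -/
theorem TT.exists_enabler {t : Topology} {P P' : Tr} {α : Lab} (h : TT t P α P') :
    ∃ P₀ P₀', Le t P₀ P ∧ TT t P₀ α P₀' ∧ Le t P₀' P' ∧ P₀.size ≤ 3 * P.weight t + 4 := by
  induction h with
  | leaf h => exact ⟨_, _, .leaf _, .leaf h, .refl _ _, by simp [Tr.size]⟩
  | @abs a R U hp =>
    obtain ⟨R₀, h1, h2⟩ := exists_skeleton t R
    refine ⟨.loc a R₀, _, .loc a h1, .abs a (hp.congr ?_), h1.fill U, ?_⟩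
    · rintro rfl; exact h1.nloc_eq.symm
    · cases t <;> simp only [Tr.weight, Tr.size, Tr.nloc] at h2 ⊢ <;> omega
  | loc a h ih =>
    obtain ⟨P₀, P₀', h1, h2, h3, h4⟩ := ih
    cases t with
    | dynamic => exact ⟨P₀, P₀', .under _ rfl h1, h2, .under _ rfl h3, h4⟩
    | static =>
      refine ⟨_, _, .loc _ h1, .loc _ h2, .loc _ h3, ?_⟩
      simp only [Tr.weight, Tr.size, Tr.nloc] at h4 ⊢; omega
  | parL Q h ih =>
    obtain ⟨P₀, P₀', h1, h2, h3, h4⟩ := ih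
    by_cases hd : Drop t Q
    · refine ⟨P₀, P₀', .dropR hd h1, h2, .dropR hd h3, h4.trans ?_⟩
      cases t <;> simp [Tr.weight, Tr.nloc]
    · simp only [Drop, Classical.not_imp] at hd
      obtain ⟨rfl, hd⟩ := hd
      obtain ⟨Q₀, k1, k2⟩ := exists_skeleton .static Q
      refine ⟨_, _, .par h1 k1, .parL _ h2, .par h3 k1, ?_⟩
      simp only [Tr.weight, Tr.size, Tr.nloc] at h4 k2 ⊢; omega
  | parR Q h ih =>
    obtain ⟨P₀, P₀', h1, h2, h3, h4⟩ := ih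
    by_cases hd : Drop t Q
    · refine ⟨P₀, P₀', .dropL hd h1, h2, .dropL hd h3, h4.trans ?_⟩
      cases t <;> simp [Tr.weight, Tr.nloc]
    · simp only [Drop, Classical.not_imp] at hd
      obtain ⟨rfl, hd⟩ := hd
      obtain ⟨Q₀, k1, k2⟩ := exists_skeleton .static Q
      refine ⟨_, _, .par k1 h1, .parR _ h2, .par k1 h3, ?_⟩
      simp only [Tr.weight, Tr.size, Tr.nloc] at h4 k2 ⊢; omega

theorem TStep.exists_enabler {t : Topology} {P P' : Tr} (h : TStep t P P') :
    ∃ P₀ P₀', Le t P₀ P ∧ TStep t P₀ P₀' ∧ Le t P₀' P' ∧ P₀.size ≤ 3 * P.weight t + 9 := by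
  induction h with
  | sync h h' =>
    obtain ⟨P₀, P₀', h1, h2, h3, h4⟩ := h.exists_enabler
    obtain ⟨Q₀, Q₀', k1, k2, k3, k4⟩ := h'.exists_enabler
    refine ⟨_, _, .par h1 k1, .sync h2 k2, .par h3 k3, ?_⟩
    cases t <;> simp only [Tr.weight, Tr.size, Tr.nloc] at h4 k4 ⊢ <;> omega
  | loc a h ih =>
    obtain ⟨P₀, P₀', h1, h2, h3, h4⟩ := ih
    cases t with
    | dynamic => exact ⟨P₀, P₀', .under _ rfl h1, h2, .under _ rfl h3, h4⟩
    | static =>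
      refine ⟨_, _, .loc _ h1, .loc _ h2, .loc _ h3, ?_⟩
      simp only [Tr.weight, Tr.size, Tr.nloc] at h4 ⊢; omega
  | parL Q h ih =>
    obtain ⟨P₀, P₀', h1, h2, h3, h4⟩ := ih
    by_cases hd : Drop t Q
    · refine ⟨P₀, P₀', .dropR hd h1, h2, .dropR hd h3, h4.trans ?_⟩
      cases t <;> simp [Tr.weight, Tr.nloc]
    · simp only [Drop, Classical.not_imp] at hd
      obtain ⟨rfl, hd⟩ := hd
      obtain ⟨Q₀, k1, k2⟩ := exists_skeleton .static Q
      refine ⟨_, _, .par h1 k1, .parL _ h2, .par h3 k1, ?_⟩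
      simp only [Tr.weight, Tr.size, Tr.nloc] at h4 k2 ⊢; omega
  | parR Q h ih =>
    obtain ⟨P₀, P₀', h1, h2, h3, h4⟩ := ih
    by_cases hd : Drop t Q
    · refine ⟨P₀, P₀', .dropL hd h1, h2, .dropL hd h3, h4.trans ?_⟩
      cases t <;> simp [Tr.weight, Tr.nloc]
    · simp only [Drop, Classical.not_imp] at hd
      obtain ⟨rfl, hd⟩ := hd
      obtain ⟨Q₀, k1, k2⟩ := exists_skeleton .static Q
      refine ⟨_, _, .par k1 h1, .parR _ h2, .par k1 h3, ?_⟩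
      simp only [Tr.weight, Tr.size, Tr.nloc] at h4 k2 ⊢; omega

/-- Each hole that `b` uses asks for its own part of `R`. As the same process fills all holes, these
parts are joined, and this costs the factor `U.size`. -/
theorem Le.exists_small_fill {t : Topology} {K : ℕ} {R : Tr} (hK : R.weight t ≤ K) :
    ∀ {U b : Tr}, Le t b (U.fill R) →
    ∃ R₀, Le t R₀ R ∧ Le t b (U.fill R₀) ∧ R₀.size ≤ U.size * (b.size + 3 * K + 3)
  | .leaf c, b, h => by
      by_cases hc : c = holeCode
      · rw [Tr.fill, if_pos hc] at h
        exact ⟨b, h, by rw [Tr.fill, if_pos hc]; exact .refl _ _, by simp [Tr.size]; omega⟩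
      · obtain ⟨R₀, h1, h2⟩ := exists_skeleton t R
        simp only [Tr.fill, if_neg hc] at h ⊢
        exact ⟨R₀, h1, h, by simp [Tr.size]; omega⟩
  | .loc a U, b, h => by
      rw [Tr.fill] at h
      cases h with
      | @loc _ b _ h =>
        obtain ⟨R₀, h1, h2, h3⟩ := h.exists_small_fill hK
        refine ⟨R₀, h1, .loc _ h2, h3.trans ?_⟩
        simp only [Tr.size]; gcongr <;> omega
      | under _ ht h =>
        obtain ⟨R₀, h1, h2, h3⟩ := h.exists_small_fill hK
        refine ⟨R₀, h1, .under _ ht h2, h3.trans ?_⟩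
        simp only [Tr.size]; gcongr; omega
  | .par U V, b, h => by
      rw [Tr.fill] at h
      cases h with
      | @par b _ b' _ h h' =>
        obtain ⟨R₀, h1, h2, h3⟩ := h.exists_small_fill hK
        obtain ⟨R₁, k1, k2, k3⟩ := h'.exists_small_fill hK
        obtain ⟨z, z1, z2, z3, z4⟩ := exists_join h1 k1
        refine ⟨z, z1, .par (h2.trans (z2.fill U)) (k2.trans (z3.fill V)), ?_⟩
        simp only [Tr.size]
        nlinarith [Nat.zero_le (U.size * b'.size), Nat.zero_le (V.size * b.size),
          Nat.zero_le (U.size), Nat.zero_le V.size]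
      | dropL hd h =>
        obtain ⟨R₀, h1, h2, h3⟩ := h.exists_small_fill hK
        refine ⟨R₀, h1, .dropL ((h1.fill U).drop hd) h2, h3.trans ?_⟩
        simp only [Tr.size]; gcongr; omega
      | dropR hd h =>
        obtain ⟨R₀, h1, h2, h3⟩ := h.exists_small_fill hK
        refine ⟨R₀, h1, .dropR ((h1.fill V).drop hd) h2, h3.trans ?_⟩
        simp only [Tr.size]; gcongr; omega

theorem Tr.weight_loc (a : ℕ) (P : Tr) (t : Topology) : P.weight t ≤ (Tr.loc a P).weight t := by
  cases t <;> simp [Tr.weight, Tr.nloc]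

theorem Tr.weight_par (P Q : Tr) (t : Topology) :
    (Tr.par P Q).weight t = P.weight t + Q.weight t := by
  cases t <;> simp [Tr.weight, Tr.nloc]

/-- If the embedding of `b` uses the component that moves, the search continues there, and otherwise
an enabler of the action suffices. Only an absorption involves the size of the pattern. -/
theorem TT.exists_small {t : Topology} {K : ℕ} {P P' b : Tr} {α : Lab} (h : TT t P α P')
    (hK : P.weight t ≤ K) (hb : Le t b P') :
    ∃ P₀ P₀', Le t P₀ P ∧ TT t P₀ α P₀' ∧ Le t b P₀' ∧
      P₀.size ≤ α.2.2.size * (b.size + 3 * K + 3) + b.size + 3 * K + 6 := by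
  induction h generalizing b with
  | leaf h => exact ⟨_, _, .leaf _, .leaf h, hb, by simp [Tr.size]⟩
  | @abs a R U hp =>
    obtain ⟨R₀, h1, h2, h3⟩ := hb.exists_small_fill ((Tr.weight_loc a R t).trans hK)
    refine ⟨.loc a R₀, _, .loc a h1, .abs a (hp.congr ?_), h2, ?_⟩
    · rintro rfl; exact h1.nloc_eq.symm
    · simp only [Tr.size]; omega
  | @loc a P P' α h ih =>
    have ih := fun b => @ih b ((Tr.weight_loc a _ t).trans hK)
    cases hb with
    | @loc _ b _ hb =>
      obtain ⟨P₀, P₀', h1, h2, h3, h4⟩ := ih _ hb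
      refine ⟨_, _, .loc a h1, .loc a h2, .loc a h3, ?_⟩
      rw [Tr.size]
      refine (Nat.add_le_add_right h4 1).trans ?_
      have : ∀ s, s * (b.size + 3 * K + 3) ≤ s * (b.size + 1 + 3 * K + 3) := fun s => by
        gcongr; omega
      have := this α.2.2.size
      simp only [Tr.size] at this ⊢
      omega
    | under _ ht hb =>
      obtain ⟨P₀, P₀', h1, h2, h3, h4⟩ := ih _ hb
      exact ⟨_, _, .under a ht h1, h2, h3, h4⟩
  | @parL P P' Q α h ih =>
    rw [Tr.weight_par] at hK
    have ih := fun b => @ih b (by omega)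
    cases hb with
    | @par b _ b' _ hb hb' =>
      obtain ⟨P₀, P₀', h1, h2, h3, h4⟩ := ih _ hb
      refine ⟨_, _, .par h1 hb', .parL _ h2, .par h3 (.refl _ _), ?_⟩
      have : ∀ s, s * (b.size + 3 * K + 3) ≤ s * (b.size + b'.size + 1 + 3 * K + 3) := fun s => by
        gcongr; omega
      have := this α.2.2.size
      simp only [Tr.size] at this h4 ⊢
      omega
    -- The embedding of `b` ignores the component that moves.
    | dropL hd hb =>
      obtain ⟨P₀, P₀', h1, h2, h3, h4⟩ := h.exists_enabler
      refine ⟨_, _, .par h1 hb, .parL _ h2, .dropL (h3.drop hd) (.refl _ _), ?_⟩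
      simp only [Tr.size] at h4 ⊢
      omega
    | dropR hd hb =>
      obtain ⟨P₀, P₀', h1, h2, h3, h4⟩ := ih _ hb
      exact ⟨_, _, .dropR hd h1, h2, h3, h4⟩
  | @parR Q P P' α h ih =>
    rw [Tr.weight_par] at hK
    have ih := fun b => @ih b (by omega)
    cases hb with
    | @par b' _ b _ hb' hb =>
      obtain ⟨P₀, P₀', h1, h2, h3, h4⟩ := ih _ hb
      refine ⟨_, _, .par hb' h1, .parR _ h2, .par (.refl _ _) h3, ?_⟩
      have : ∀ s, s * (b.size + 3 * K + 3) ≤ s * (b'.size + b.size + 1 + 3 * K + 3) := fun s => by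
        gcongr; omega
      have := this α.2.2.size
      simp only [Tr.size] at this h4 ⊢
      omega
    | dropL hd hb =>
      obtain ⟨P₀, P₀', h1, h2, h3, h4⟩ := ih _ hb
      exact ⟨_, _, .dropL hd h1, h2, h3, h4⟩
    | dropR hd hb =>
      obtain ⟨P₀, P₀', h1, h2, h3, h4⟩ := h.exists_enabler
      refine ⟨_, _, .par hb h1, .parR _ h2, .dropR (h3.drop hd) (.refl _ _), ?_⟩
      simp only [Tr.size] at h4 ⊢
      omega

/-! ## Classes of trees are closed under reduction -/

/-- Codes of parts are bounded by the code of the whole. Thus the code of the initial process bounds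
its leaves, its names and the sizes of the patterns in them. -/
theorem ofCode_inCls_size (n : ℕ) : (ofCode n).InCls n ∧ (ofCode n).size ≤ 2 * n + 1 := by
  suffices H : ∀ n, (∀ N, n ≤ N → (ofCode n).InCls N) ∧ (ofCode n).size ≤ 2 * n + 1 from
    ⟨(H n).1 n le_rfl, (H n).2⟩
  intro n
  induction n using ofCode.induct with
  | case1 n h ih =>
    have h1 := unpair_lt_of_two_le h
    have h2 : n.unpair.2.unpair.1 ≤ n :=
      (Nat.unpair_left_le _).trans (Nat.unpair_right_le _)
    rw [ofCode, dif_pos h]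
    exact ⟨fun N hN => ⟨h2.trans hN, ih.1 N (by omega)⟩, by simp only [Tr.size]; omega⟩
  | case2 n h h' ih1 ih2 =>
    have h1 := Nat.add_le_pair n.unpair.1 n.unpair.2
    have h2 := Nat.add_le_pair n.unpair.2.unpair.1 n.unpair.2.unpair.2
    rw [Nat.pair_unpair] at h1 h2
    rw [ofCode, dif_neg h, dif_pos h']
    exact ⟨fun N hN => ⟨ih1.1 N (by omega), ih2.1 N (by omega)⟩, by simp only [Tr.size]; omega⟩
  | case3 n h h' =>
    rw [ofCode, dif_neg h, dif_neg h']
    exact ⟨fun N hN => hN, by simp [Tr.size]⟩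

theorem Tr.InCls.mono {N M : ℕ} (h : N ≤ M) : ∀ {P : Tr}, P.InCls N → P.InCls M
  | .leaf _, hP => le_trans hP h
  | .loc _ _, hP => ⟨hP.1.trans h, hP.2.mono h⟩
  | .par _ _, hP => ⟨hP.1.mono h, hP.2.mono h⟩

/-- Trees of the class `N` that are not larger than a pattern in the class. -/
def PatCls (N : ℕ) (U : Tr) : Prop := U.InCls N ∧ U.size ≤ 2 * N + 1

theorem patCls_ofCode {n N : ℕ} (h : n ≤ N) : PatCls N (ofCode n) :=
  ⟨(ofCode_inCls_size n).1.mono h, (ofCode_inCls_size n).2.trans (by omega)⟩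

theorem patCls_labOf {p N : ℕ} (h : p ≤ N) : PatCls N (labOf p).2.2 := by
  unfold labOf
  split_ifs
  · exact ⟨Nat.zero_le _, by simp [Tr.size]⟩
  · exact ⟨Nat.zero_le _, by simp [Tr.size]⟩
  · exact patCls_ofCode
      ((Nat.unpair_right_le _).trans ((Nat.unpair_right_le _).trans h))

theorem branchActs_cls {N : ℕ} : ∀ n ≤ N, ∀ x ∈ branchActs n, PatCls N x.1.2.2 ∧ x.2.InCls N := by
  intro n
  induction n using branchActs.induct with
  | case1 => simp [branchActs]
  | case2 n ih =>
    intro hn x hx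
    have h1 : n.unpair.2 ≤ n := Nat.unpair_right_le _
    have h2 : n.unpair.2.unpair.2 ≤ n.unpair.2 := Nat.unpair_right_le _
    have h3 : n.unpair.2.unpair.1 ≤ n.unpair.2 := Nat.unpair_left_le _
    have h4 : n.unpair.1 ≤ n := Nat.unpair_left_le _
    rw [branchActs, List.mem_cons] at hx
    rcases hx with rfl | hx
    · exact ⟨patCls_labOf (by omega), (patCls_ofCode (by omega)).1⟩
    · exact ih (by omega) x hx

theorem acts_cls {N c : ℕ} (h : c ≤ N) {x : Lab × Tr} (hx : x ∈ acts c) :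
    PatCls N x.1.2.2 ∧ x.2.InCls N := by
  have h1 : c.unpair.2 ≤ c := Nat.unpair_right_le _
  have h2 : c.unpair.2.unpair.2 ≤ c.unpair.2 := Nat.unpair_right_le _
  have h3 : c.unpair.2.unpair.1 ≤ c.unpair.2 := Nat.unpair_left_le _
  unfold acts at hx
  split_ifs at hx
  · simp only [List.mem_singleton] at hx
    subst hx
    exact ⟨patCls_labOf (by omega), (patCls_ofCode (by omega)).1, h⟩
  · exact branchActs_cls _ (by omega) x hx
  · simp at hx

theorem TT.patCls {t : Topology} {N : ℕ} {P P' : Tr} {α : Lab} (h : TT t P α P')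
    (hP : P.InCls N) (hα : α.1 ≠ 3) : PatCls N α.2.2 := by
  induction h with
  | leaf h => exact (acts_cls hP h).1
  | abs => exact (hα rfl).elim
  | loc _ _ ih => exact ih hP.2 hα
  | parL _ _ ih => exact ih hP.1 hα
  | parR _ _ ih => exact ih hP.2 hα

theorem Tr.InCls.fill {N : ℕ} {R : Tr} (hR : R.InCls N) : ∀ {U : Tr}, U.InCls N →
    (U.fill R).InCls N
  | .leaf c, h => by
      rw [Tr.fill]; split_ifs
      · exact hR
      · exact h
  | .loc _ _, h => ⟨h.1, hR.fill h.2⟩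
  | .par _ _, h => ⟨hR.fill h.1, hR.fill h.2⟩

theorem TT.inCls {t : Topology} {N : ℕ} {P P' : Tr} {α : Lab} (h : TT t P α P')
    (hP : P.InCls N) (hα : α.2.2.InCls N) : P'.InCls N := by
  induction h with
  | leaf h => exact (acts_cls hP h).2
  | abs _ _ => exact hP.2.fill hα
  | loc _ _ ih => exact ⟨hP.1, ih hP.2 hα⟩
  | parL _ _ ih => exact ⟨ih hP.1 hα, hP.2⟩
  | parR _ _ ih => exact ⟨hP.1, ih hP.2 hα⟩

theorem TT.sync_patCls {t : Topology} {N : ℕ} {P P' Q Q' : Tr} {α : Lab} (h : TT t P α P')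
    (h' : TT t Q α.dual Q') (hP : P.InCls N) (hQ : Q.InCls N) : PatCls N α.2.2 := by
  by_cases hα : α.1 = 3
  · exact h'.patCls hQ (by simp [Lab.dual, hα])
  · exact h.patCls hP hα

/-- Reductions only unfold leaves into trees decoded from smaller numbers, keep replicated leaves,
and fill patterns found in leaves. The alphabet never grows, so Kruskal's theorem applies to all
reachable trees. -/
theorem TStep.inCls {t : Topology} {N : ℕ} {P P' : Tr} (h : TStep t P P') (hP : P.InCls N) :
    P'.InCls N := by
  induction h with
  | sync h h' =>
    have := (h.sync_patCls h' hP.1 hP.2).1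
    exact ⟨h.inCls hP.1 this, h'.inCls hP.2 this⟩
  | loc _ _ ih => exact ⟨hP.1, ih hP.2⟩
  | parL _ _ ih => exact ⟨ih hP.1, hP.2⟩
  | parR _ _ ih => exact ⟨hP.1, ih hP.2⟩

/-- A bound for the sizes of minimal predecessors of a tree of size `s`. -/
def predBound (N K s : ℕ) : ℕ :=
  (2 * N + 1) * (2 * s + 6 * K + 6) + 2 * s + 6 * K + 13

/-- The effective predecessor basis: the minimal trees with a reduct above `b` are found among
finitely many candidates. In a synchronization both sides are shrunk separately, which is possible
since patterns of the class have at most `2 * N + 1` nodes. -/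
theorem TStep.exists_small {t : Topology} {N K : ℕ} {P P' b : Tr} (h : TStep t P P')
    (hN : P.InCls N) (hK : P.weight t ≤ K) (hb : Le t b P') :
    ∃ P₀ P₀', Le t P₀ P ∧ TStep t P₀ P₀' ∧ Le t b P₀' ∧ P₀.size ≤ predBound N K b.size := by
  have hmul : ∀ s x y, s ≤ 2 * N + 1 → x ≤ y → s * x ≤ (2 * N + 1) * y := fun s x y h h' =>
    Nat.mul_le_mul h h'
  unfold predBound
  induction h generalizing b with
  | @sync P P' Q Q' α h h' =>
    have hs := (h.sync_patCls h' hN.1 hN.2).2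
    rw [Tr.weight_par] at hK
    have hα : α.dual.2.2 = α.2.2 := rfl
    cases hb with
    | @par b _ b' _ hb hb' =>
      obtain ⟨P₀, P₀', h1, h2, h3, h4⟩ := h.exists_small (K := K) (by omega) hb
      obtain ⟨Q₀, Q₀', k1, k2, k3, k4⟩ := h'.exists_small (K := K) (by omega) hb'
      refine ⟨_, _, .par h1 k1, .sync h2 k2, .par h3 k3, ?_⟩
      rw [hα] at k4
      -- The bound counts the pattern for both sides; the doubled constants of `predBound` absorb
      -- the sum.
      have e := hmul α.2.2.size (b.size + 3 * K + 3 + (b'.size + 3 * K + 3))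
        (2 * (b.size + b'.size + 1) + 6 * K + 6) hs (by omega)
      rw [Nat.mul_add] at e
      simp only [Tr.size] at h4 k4 ⊢
      omega
    | dropL hd hb =>
      obtain ⟨P₀, P₀', h1, h2, h3, h4⟩ := h.exists_enabler
      obtain ⟨Q₀, Q₀', k1, k2, k3, k4⟩ := h'.exists_small (K := K) (by omega) hb
      refine ⟨_, _, .par h1 k1, .sync h2 k2, .dropL (h3.drop hd) k3, ?_⟩
      rw [hα] at k4
      have e := hmul α.2.2.size (b.size + 3 * K + 3) (2 * b.size + 6 * K + 6) hs (by omega)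
      simp only [Tr.size] at h4 k4 ⊢
      omega
    | dropR hd hb =>
      obtain ⟨P₀, P₀', h1, h2, h3, h4⟩ := h.exists_small (K := K) (by omega) hb
      obtain ⟨Q₀, Q₀', k1, k2, k3, k4⟩ := h'.exists_enabler
      refine ⟨_, _, .par h1 k1, .sync h2 k2, .dropR (k3.drop hd) h3, ?_⟩
      have e := hmul α.2.2.size (b.size + 3 * K + 3) (2 * b.size + 6 * K + 6) hs (by omega)
      simp only [Tr.size] at h4 k4 ⊢
      omega
  | loc a h ih =>
    have ih := fun b => @ih b hN.2 ((Tr.weight_loc a _ t).trans hK)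
    cases hb with
    | @loc _ b _ hb =>
      obtain ⟨P₀, P₀', h1, h2, h3, h4⟩ := ih _ hb
      refine ⟨_, _, .loc a h1, .loc a h2, .loc a h3, ?_⟩
      have e := hmul (2 * N + 1) (2 * b.size + 6 * K + 6) (2 * (b.size + 1) + 6 * K + 6) le_rfl
        (by omega)
      simp only [Tr.size]
      omega
    | under _ ht hb =>
      obtain ⟨P₀, P₀', h1, h2, h3, h4⟩ := ih _ hb
      exact ⟨_, _, .under a ht h1, h2, h3, h4⟩
  | parL Q h ih =>
    rw [Tr.weight_par] at hK
    have ih := fun b => @ih b hN.1 (by omega)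
    cases hb with
    | @par b _ b' _ hb hb' =>
      obtain ⟨P₀, P₀', h1, h2, h3, h4⟩ := ih _ hb
      refine ⟨_, _, .par h1 hb', .parL _ h2, .par h3 (.refl _ _), ?_⟩
      have e := hmul (2 * N + 1) (2 * b.size + 6 * K + 6) (2 * (b.size + b'.size + 1) + 6 * K + 6)
        le_rfl (by omega)
      simp only [Tr.size]
      omega
    | dropL hd hb =>
      obtain ⟨P₀, P₀', h1, h2, h3, h4⟩ := h.exists_enabler
      refine ⟨_, _, .par h1 hb, .parL _ h2, .dropL (h3.drop hd) (.refl _ _), ?_⟩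
      simp only [Tr.size] at h4 ⊢
      omega
    | dropR hd hb =>
      obtain ⟨P₀, P₀', h1, h2, h3, h4⟩ := ih _ hb
      exact ⟨_, _, .dropR hd h1, h2, h3, h4⟩
  | parR Q h ih =>
    rw [Tr.weight_par] at hK
    have ih := fun b => @ih b hN.2 (by omega)
    cases hb with
    | @par b' _ b _ hb' hb =>
      obtain ⟨P₀, P₀', h1, h2, h3, h4⟩ := ih _ hb
      refine ⟨_, _, .par hb' h1, .parR _ h2, .par (.refl _ _) h3, ?_⟩
      have e := hmul (2 * N + 1) (2 * b.size + 6 * K + 6) (2 * (b'.size + b.size + 1) + 6 * K + 6)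
        le_rfl (by omega)
      simp only [Tr.size]
      omega
    | dropL hd hb =>
      obtain ⟨P₀, P₀', h1, h2, h3, h4⟩ := ih _ hb
      exact ⟨_, _, .dropL hd h1, h2, h3, h4⟩
    | dropR hd hb =>
      obtain ⟨P₀, P₀', h1, h2, h3, h4⟩ := h.exists_enabler
      refine ⟨_, _, .par hb h1, .parR _ h2, .dropR (h3.drop hd) (.refl _ _), ?_⟩
      simp only [Tr.size] at h4 ⊢
      omega

end Evol

/-! ## Primitive recursive functions, in a form suitable for `fun_prop` -/

attribute [fun_prop] Primrec
attribute [fun_prop] Primrec.id Primrec.const Primrec.comp Primrec.pair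

namespace Primrec

variable {α β γ σ : Type} [Primcodable α] [Primcodable β] [Primcodable γ] [Primcodable σ]

@[fun_prop] theorem fst_of {f : α → β × γ} (hf : Primrec f) : Primrec fun a => (f a).1 :=
  Primrec.fst.comp hf

@[fun_prop] theorem snd_of {f : α → β × γ} (hf : Primrec f) : Primrec fun a => (f a).2 :=
  Primrec.snd.comp hf

@[fun_prop] theorem add_of {f g : α → ℕ} (hf : Primrec f) (hg : Primrec g) :
    Primrec fun a => f a + g a := Primrec.nat_add.comp hf hg

@[fun_prop] theorem mul_of {f g : α → ℕ} (hf : Primrec f) (hg : Primrec g) :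
    Primrec fun a => f a * g a := Primrec.nat_mul.comp hf hg

@[fun_prop] theorem div_of {f g : α → ℕ} (hf : Primrec f) (hg : Primrec g) :
    Primrec fun a => f a / g a := Primrec.nat_div.comp hf hg

@[fun_prop] theorem mod_of {f g : α → ℕ} (hf : Primrec f) (hg : Primrec g) :
    Primrec fun a => f a % g a := Primrec.nat_mod.comp hf hg

@[fun_prop] theorem natPair_of {f g : α → ℕ} (hf : Primrec f) (hg : Primrec g) :
    Primrec fun a => Nat.pair (f a) (g a) := Primrec₂.natPair.comp hf hg

@[fun_prop] theorem unpair_of {f : α → ℕ} (hf : Primrec f) : Primrec fun a => (f a).unpair :=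
  Primrec.unpair.comp hf

@[fun_prop] theorem ble_of {f g : α → ℕ} (hf : Primrec f) (hg : Primrec g) :
    Primrec fun a => Nat.ble (f a) (g a) :=
  (Primrec.nat_le.decide.comp hf hg).of_eq fun a => by
    rw [Bool.eq_iff_iff]; simp

@[fun_prop] theorem beq_of [DecidableEq β] {f g : α → β} (hf : Primrec f) (hg : Primrec g) :
    Primrec fun a => decide (f a = g a) := Primrec.eq.decide.comp hf hg

@[fun_prop] theorem and_of {f g : α → Bool} (hf : Primrec f) (hg : Primrec g) :
    Primrec fun a => and (f a) (g a) := Primrec.and.comp hf hg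

@[fun_prop] theorem or_of {f g : α → Bool} (hf : Primrec f) (hg : Primrec g) :
    Primrec fun a => or (f a) (g a) := Primrec.or.comp hf hg

@[fun_prop] theorem not_of {f : α → Bool} (hf : Primrec f) :
    Primrec fun a => not (f a) := Primrec.not.comp hf

@[fun_prop] theorem cond_of {c : α → Bool} {f g : α → β} (hc : Primrec c) (hf : Primrec f)
    (hg : Primrec g) : Primrec fun a => bif c a then f a else g a := Primrec.cond hc hf hg

@[fun_prop] theorem cons_of {f : α → β} {g : α → List β} (hf : Primrec f) (hg : Primrec g) :
    Primrec fun a => f a :: g a := Primrec.list_cons.comp hf hg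

@[fun_prop] theorem append_of {f g : α → List β} (hf : Primrec f) (hg : Primrec g) :
    Primrec fun a => f a ++ g a := Primrec.list_append.comp hf hg

@[fun_prop] theorem range_of {f : α → ℕ} (hf : Primrec f) : Primrec fun a => List.range (f a) :=
  Primrec.list_range.comp hf

@[fun_prop] theorem map_of {f : α → List β} {g : α → β → γ} (hf : Primrec f)
    (hg : Primrec fun p : α × β => g p.1 p.2) : Primrec fun a => (f a).map (g a) :=
  Primrec.list_map hf hg

@[fun_prop] theorem flatMap_of {f : α → List β} {g : α → β → List γ} (hf : Primrec f)
    (hg : Primrec fun p : α × β => g p.1 p.2) : Primrec fun a => (f a).flatMap (g a) :=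
  Primrec.list_flatMap hf hg

@[fun_prop] theorem any_of {f : α → List β} {g : α → β → Bool} (hf : Primrec f)
    (hg : Primrec fun p : α × β => g p.1 p.2) : Primrec fun a => (f a).any (g a) := by
  refine (Primrec.list_foldr (h := fun a p => or (g a p.1) p.2) hf (Primrec.const false)
    (by unfold Primrec₂; fun_prop (disch := assumption))).of_eq fun a => ?_
  induction f a with
  | nil => rfl
  | cons x l ih => simp [← ih]

@[fun_prop] theorem all_of {f : α → List β} {g : α → β → Bool} (hf : Primrec f)
    (hg : Primrec fun p : α × β => g p.1 p.2) : Primrec fun a => (f a).all (g a) := by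
  refine (show Primrec fun a => not ((f a).any fun b => not (g a b)) by fun_prop).of_eq fun a => ?_
  rw [List.not_any_eq_all_not]; simp

end Primrec

-- Decidability: computability of the operations on trees.

namespace Evol

/-! ## Trees as numbers -/

namespace Tr

/-- A numbering of trees. -/
def enc : Tr → ℕ
  | leaf c => 3 * c
  | loc a P => 3 * Nat.pair a P.enc + 1
  | par P Q => 3 * Nat.pair P.enc Q.enc + 2

/-- The tree with a given number. -/
def dec (n : ℕ) : Tr :=
  if _h : n % 3 = 0 then leaf (n / 3)
  else if _h' : n % 3 = 1 then loc (n / 3).unpair.1 (dec (n / 3).unpair.2)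
  else par (dec (n / 3).unpair.1) (dec (n / 3).unpair.2)
termination_by n
decreasing_by
  · have := Nat.unpair_right_le (n / 3); omega
  · have := Nat.unpair_left_le (n / 3); omega
  · have := Nat.unpair_right_le (n / 3); omega

theorem dec_enc (P : Tr) : dec P.enc = P := by
  induction P with
  | leaf c => rw [enc, dec]; simp
  | loc a P ih =>
    rw [enc, dec]
    have h1 : (3 * Nat.pair a P.enc + 1) % 3 = 1 := by omega
    have h2 : (3 * Nat.pair a P.enc + 1) / 3 = Nat.pair a P.enc := by omega
    simp [h1, h2, ih]
  | par P Q ihP ihQ =>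
    rw [enc, dec]
    have h1 : (3 * Nat.pair P.enc Q.enc + 2) % 3 = 2 := by omega
    have h2 : (3 * Nat.pair P.enc Q.enc + 2) / 3 = Nat.pair P.enc Q.enc := by omega
    simp [h1, h2, ihP, ihQ]

theorem enc_dec (n : ℕ) : (dec n).enc = n := by
  induction n using dec.induct with
  | case1 n h => rw [dec, dif_pos h, enc]; omega
  | case2 n h h' ih => rw [dec, dif_neg h, dif_pos h', enc, ih, Nat.pair_unpair]; omega
  | case3 n h h' ih1 ih2 =>
    rw [dec, dif_neg h, dif_neg h', enc, ih1, ih2, Nat.pair_unpair]; omega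

/-- Trees are numbers. -/
def equivNat : Tr ≃ ℕ := ⟨enc, dec, dec_enc, enc_dec⟩

instance : Primcodable Tr := Primcodable.ofEquiv ℕ equivNat

instance : DecidableEq Tr := equivNat.decidableEq

theorem primrec_enc : Primrec enc := Primrec.of_equiv (e := equivNat)

theorem primrec_dec : Primrec dec := Primrec.of_equiv_symm (e := equivNat)

end Tr

section

variable {α σ : Type} [Primcodable α] [Primcodable σ]

@[fun_prop] theorem primrec_enc_of {f : α → Tr} (hf : Primrec f) : Primrec fun a => (f a).enc :=
  Tr.primrec_enc.comp hf

@[fun_prop] theorem primrec_dec_of {f : α → ℕ} (hf : Primrec f) : Primrec fun a => Tr.dec (f a) :=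
  Tr.primrec_dec.comp hf

@[fun_prop] theorem primrec_leaf_of {f : α → ℕ} (hf : Primrec f) :
    Primrec fun a => Tr.leaf (f a) :=
  (show Primrec fun a => Tr.dec (3 * f a) by fun_prop).of_eq fun a => Tr.dec_enc (.leaf (f a))

@[fun_prop] theorem primrec_loc_of {f : α → ℕ} {g : α → Tr} (hf : Primrec f) (hg : Primrec g) :
    Primrec fun a => Tr.loc (f a) (g a) :=
  (show Primrec fun a => Tr.dec (3 * Nat.pair (f a) (g a).enc + 1) by fun_prop).of_eq fun a =>
    Tr.dec_enc (.loc (f a) (g a))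

@[fun_prop] theorem primrec_par_of {f g : α → Tr} (hf : Primrec f) (hg : Primrec g) :
    Primrec fun a => Tr.par (f a) (g a) :=
  (show Primrec fun a => Tr.dec (3 * Nat.pair (f a).enc (g a).enc + 2) by fun_prop).of_eq
    fun a => Tr.dec_enc (.par (f a) (g a))

/-- Functions defined by structural recursion on trees are primitive recursive. -/
theorem primrec_tr_rec (f : α → Tr → σ) {fl : α → ℕ → σ} {fo : α → ℕ → Tr → σ → σ}
    {fp : α → Tr → Tr → σ → σ → σ} (hl : Primrec fun p : α × ℕ => fl p.1 p.2)
    (ho : Primrec fun p : α × ℕ × Tr × σ => fo p.1 p.2.1 p.2.2.1 p.2.2.2)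
    (hp : Primrec fun p : α × Tr × Tr × σ × σ => fp p.1 p.2.1 p.2.2.1 p.2.2.2.1 p.2.2.2.2)
    (H1 : ∀ a c, f a (.leaf c) = fl a c)
    (H2 : ∀ a x P, f a (.loc x P) = fo a x P (f a P))
    (H3 : ∀ a P Q, f a (.par P Q) = fp a P Q (f a P) (f a Q)) :
    Primrec fun p : α × Tr => f p.1 p.2 := by
  have key : Primrec₂ fun (a : α) (n : ℕ) => f a (Tr.dec n) := by
    -- Course-of-values recursion: the list holds the results for all smaller numbers, and its
    -- length is the number of the current tree. Components of a tree have smaller numbers, so the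
    -- lookups succeed.
    let g : α → List σ → Option σ := fun a l =>
      cond (decide (l.length % 3 = 0)) (some (fl a (l.length / 3)))
        (cond (decide (l.length % 3 = 1))
          ((l[(l.length / 3).unpair.2]?).map
            (fo a (l.length / 3).unpair.1 (Tr.dec (l.length / 3).unpair.2)))
          ((l[(l.length / 3).unpair.1]?).bind fun s =>
            (l[(l.length / 3).unpair.2]?).map
              (fp a (Tr.dec (l.length / 3).unpair.1) (Tr.dec (l.length / 3).unpair.2) s)))
    have hlen : Primrec fun p : α × List σ => p.2.length := Primrec.list_length.comp Primrec.snd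
    have hg : Primrec₂ g := by
      refine Primrec.cond (by fun_prop) ?_ (Primrec.cond (by fun_prop) ?_ ?_)
      · exact Primrec.option_some.comp (hl.comp
          (g := fun p : α × List σ => (p.1, p.2.length / 3)) (by fun_prop))
      · refine Primrec.option_map (Primrec.list_getElem?.comp Primrec.snd (by fun_prop)) ?_
        have : Primrec fun p : (α × List σ) × σ => p.1.2.length := hlen.comp Primrec.fst
        exact ho.comp (g := fun p : (α × List σ) × σ => (p.1.1, (p.1.2.length / 3).unpair.1,
          Tr.dec (p.1.2.length / 3).unpair.2, p.2)) (by fun_prop)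
      · refine Primrec.option_bind (Primrec.list_getElem?.comp Primrec.snd (by fun_prop)) ?_
        have h1 : Primrec fun p : (α × List σ) × σ => p.1.2.length := hlen.comp Primrec.fst
        refine Primrec.option_map (Primrec.list_getElem?.comp (by fun_prop) (by fun_prop)) ?_
        have : Primrec fun p : ((α × List σ) × σ) × σ => p.1.1.2.length := h1.comp Primrec.fst
        exact hp.comp (g := fun p : ((α × List σ) × σ) × σ => (p.1.1.1,
          Tr.dec (p.1.1.2.length / 3).unpair.1, Tr.dec (p.1.1.2.length / 3).unpair.2,
          p.1.2, p.2)) (by fun_prop)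
    refine Primrec.nat_strong_rec _ hg fun a n => ?_
    have hr := Nat.unpair_right_le (n / 3)
    have hl := Nat.unpair_left_le (n / 3)
    simp only [g, List.length_map, List.length_range]
    by_cases h0 : n % 3 = 0
    · have e : Tr.dec n = .leaf (n / 3) := by rw [Tr.dec, dif_pos h0]
      rw [e, H1]; simp [h0]
    · by_cases h1 : n % 3 = 1
      · have : (n / 3).unpair.2 < n := by omega
        have e : Tr.dec n = .loc (n / 3).unpair.1 (Tr.dec (n / 3).unpair.2) := by
          rw [Tr.dec, dif_neg h0, dif_pos h1]
        rw [e, H2]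
        simp [h1, this]
      · have i1 : (n / 3).unpair.1 < n := by omega
        have i2 : (n / 3).unpair.2 < n := by omega
        have e : Tr.dec n = .par (Tr.dec (n / 3).unpair.1) (Tr.dec (n / 3).unpair.2) := by
          rw [Tr.dec, dif_neg h0, dif_neg h1]
        rw [e, H3]
        simp [h0, h1, i1, i2]
  refine (key.comp Primrec.fst (Tr.primrec_enc.comp Primrec.snd)).of_eq fun p => ?_
  rw [Tr.dec_enc]

/-! ### Recursive functions on trees -/

@[fun_prop] theorem primrec_size_of {f : α → Tr} (hf : Primrec f) :
    Primrec fun a => (f a).size :=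
  (primrec_tr_rec (fun (_ : Unit) P => P.size) (fl := fun _ _ => 1)
    (fo := fun _ _ _ s => s + 1) (fp := fun _ _ _ s s' => s + s' + 1) (by fun_prop) (by fun_prop)
    (by fun_prop) (fun _ _ => rfl) (fun _ _ _ => rfl) (fun _ _ _ => rfl)).comp
    (g := fun a => ((), f a)) (by fun_prop)

@[fun_prop] theorem primrec_nloc_of {f : α → Tr} (hf : Primrec f) :
    Primrec fun a => (f a).nloc :=
  (primrec_tr_rec (fun (_ : Unit) P => P.nloc) (fl := fun _ _ => 0)
    (fo := fun _ _ _ s => s + 1) (fp := fun _ _ _ s s' => s + s') (by fun_prop) (by fun_prop)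
    (by fun_prop) (fun _ _ => rfl) (fun _ _ _ => rfl) (fun _ _ _ => rfl)).comp
    (g := fun a => ((), f a)) (by fun_prop)

@[fun_prop] theorem primrec_holes_of {f : α → Tr} (hf : Primrec f) :
    Primrec fun a => (f a).holes :=
  (primrec_tr_rec (fun (_ : Unit) P => P.holes)
    (fl := fun _ c => cond (decide (c = holeCode)) 1 0)
    (fo := fun _ _ _ s => s) (fp := fun _ _ _ s s' => s + s') (by fun_prop) (by fun_prop)
    (by fun_prop) (fun _ c => by by_cases h : c = holeCode <;> simp [Tr.holes, h])
    (fun _ _ _ => rfl) (fun _ _ _ => rfl)).comp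
    (g := fun a => ((), f a)) (by fun_prop)

@[fun_prop] theorem primrec_outerHoles_of {f : α → Tr} (hf : Primrec f) :
    Primrec fun a => (f a).outerHoles :=
  (primrec_tr_rec (fun (_ : Unit) P => P.outerHoles)
    (fl := fun _ c => cond (decide (c = holeCode)) 1 0)
    (fo := fun _ _ _ _ => 0) (fp := fun _ _ _ s s' => s + s') (by fun_prop) (by fun_prop)
    (by fun_prop) (fun _ c => by by_cases h : c = holeCode <;> simp [Tr.outerHoles, h])
    (fun _ _ _ => rfl) (fun _ _ _ => rfl)).comp
    (g := fun a => ((), f a)) (by fun_prop)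

@[fun_prop] theorem primrec_fill_of {f g : α → Tr} (hf : Primrec f) (hg : Primrec g) :
    Primrec fun a => (f a).fill (g a) :=
  (primrec_tr_rec (fun R P => P.fill R)
    (fl := fun R c => cond (decide (c = holeCode)) R (.leaf c))
    (fo := fun _ a _ s => .loc a s) (fp := fun _ _ _ s s' => .par s s') (by fun_prop)
    (by fun_prop) (by fun_prop) (fun _ c => by by_cases h : c = holeCode <;> simp [Tr.fill, h])
    (fun _ _ _ => rfl) (fun _ _ _ => rfl)).comp
    (g := fun a => (g a, f a)) (by fun_prop)

/-- Whether all leaves and names of the tree are at most `N`. -/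
def Tr.inClsB (N : ℕ) : Tr → Bool
  | .leaf c => Nat.ble c N
  | .loc a P => and (Nat.ble a N) (P.inClsB N)
  | .par P Q => and (P.inClsB N) (Q.inClsB N)

theorem Tr.inClsB_iff {N : ℕ} {P : Tr} : P.inClsB N = true ↔ P.InCls N := by
  induction P with
  | leaf c => simp [inClsB, InCls]
  | loc a P ih => simp [inClsB, InCls, ih]
  | par P Q ihP ihQ => simp [inClsB, InCls, ihP, ihQ]

@[fun_prop] theorem primrec_inClsB_of {f : α → ℕ} {g : α → Tr} (hf : Primrec f)
    (hg : Primrec g) : Primrec fun a => (g a).inClsB (f a) :=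
  (primrec_tr_rec (fun N P => P.inClsB N) (fl := fun N c => Nat.ble c N)
    (fo := fun N a _ s => and (Nat.ble a N) s) (fp := fun _ _ _ s s' => and s s') (by fun_prop)
    (by fun_prop) (by fun_prop) (fun _ _ => rfl) (fun _ _ _ => rfl) (fun _ _ _ => rfl)).comp
    (g := fun a => (f a, g a)) (by fun_prop)

/-- Whether the topology is dynamic. -/
def Topology.dyn : Topology → Bool
  | .dynamic => true
  | .static => false

/-- Whether the tree may be dropped. -/
def dropB (t : Topology) (P : Tr) : Bool := or t.dyn (decide (P.nloc = 0))

theorem dropB_iff {t : Topology} {P : Tr} : dropB t P = true ↔ Drop t P := by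
  cases t <;> simp [dropB, Topology.dyn, Drop]

@[fun_prop] theorem primrec_dropB_of {t : Topology} {f : α → Tr} (hf : Primrec f) :
    Primrec fun a => dropB t (f a) := by unfold dropB; fun_prop

/-- The list of all trees embedded in a tree. -/
def downs (t : Topology) : Tr → List Tr
  | .leaf c => [.leaf c]
  | .loc a P => (downs t P).map (fun b => .loc a b) ++ cond t.dyn (downs t P) []
  | .par P Q => ((downs t P).flatMap fun b => (downs t Q).map fun b' => .par b b') ++
      (cond (dropB t Q) (downs t P) [] ++ cond (dropB t P) (downs t Q) [])

/-- Only finitely many trees embed in a given one, and listing them makes the order decidable. -/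
theorem mem_downs {t : Topology} {b P : Tr} : b ∈ downs t P ↔ Le t b P := by
  induction P generalizing b with
  | leaf c =>
    simp only [downs, List.mem_singleton]
    exact ⟨fun h => by rw [h]; exact .leaf c, fun h => by cases h; rfl⟩
  | loc a P ih =>
    simp only [downs, List.mem_append, List.mem_map, ih]
    constructor
    · rintro (⟨x, h, rfl⟩ | h)
      · exact .loc _ h
      · cases t
        · exact .under _ rfl (ih.1 (by simpa [Topology.dyn] using h))
        · simp [Topology.dyn] at h
    · intro h
      cases h with
      | loc _ h => exact .inl ⟨_, h, rfl⟩
      | under _ ht h => subst ht; exact .inr (by simpa [Topology.dyn] using ih.2 h)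
  | par P Q ihP ihQ =>
    simp only [downs, List.mem_append, List.mem_flatMap, List.mem_map, ihP, ihQ]
    have hc : ∀ (b : Tr) (c : Bool) (l : List Tr), b ∈ cond c l [] ↔ c = true ∧ b ∈ l := by
      intro b c l; cases c <;> simp
    rw [hc, hc, dropB_iff, dropB_iff, ihP, ihQ]
    constructor
    · rintro (⟨x, h, y, h', rfl⟩ | ⟨hd, h⟩ | ⟨hd, h⟩)
      · exact .par h h'
      · exact .dropR hd h
      · exact .dropL hd h
    · intro h
      cases h with
      | par h h' => exact .inl ⟨_, h, _, h', rfl⟩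
      | dropR hd h => exact .inr (.inl ⟨hd, h⟩)
      | dropL hd h => exact .inr (.inr ⟨hd, h⟩)

@[fun_prop] theorem primrec_downs_of {t : Topology} {f : α → Tr} (hf : Primrec f) :
    Primrec fun a => downs t (f a) :=
  (primrec_tr_rec (fun (_ : Unit) P => downs t P) (fl := fun _ c => [.leaf c])
    (fo := fun _ a _ s => s.map (fun b => .loc a b) ++ cond t.dyn s [])
    (fp := fun _ P Q s s' => (s.flatMap fun b => s'.map fun b' => .par b b') ++
      (cond (dropB t Q) s [] ++ cond (dropB t P) s' [])) (by fun_prop)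
    (by fun_prop) (by fun_prop) (fun _ _ => rfl) (fun _ _ _ => rfl) (fun _ _ _ => rfl)).comp
    (g := fun a => ((), f a)) (by fun_prop)

/-! ### Transitions -/

theorem primrec_ofCode : Primrec ofCode := by
  let g : Unit → List Tr → Option Tr := fun _ l =>
    cond (and (decide (l.length.unpair.1 = 0)) (Nat.ble 2 l.length))
      ((l[l.length.unpair.2.unpair.2]?).map (Tr.loc l.length.unpair.2.unpair.1))
      (cond (decide (l.length.unpair.1 = 1))
        ((l[l.length.unpair.2.unpair.1]?).bind fun s =>
          (l[l.length.unpair.2.unpair.2]?).map (Tr.par s))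
        (some (.leaf l.length)))
  have hlen : Primrec fun p : Unit × List Tr => p.2.length := Primrec.list_length.comp Primrec.snd
  have hg : Primrec₂ g := by
    refine Primrec.cond (by fun_prop) ?_ (Primrec.cond (by fun_prop) ?_ ?_)
    · refine Primrec.option_map (Primrec.list_getElem?.comp Primrec.snd (by fun_prop)) ?_
      have : Primrec fun p : (Unit × List Tr) × Tr => p.1.2.length := hlen.comp Primrec.fst
      unfold Primrec₂; fun_prop
    · refine Primrec.option_bind (Primrec.list_getElem?.comp Primrec.snd (by fun_prop)) ?_
      have h1 : Primrec fun p : (Unit × List Tr) × Tr => p.1.2.length := hlen.comp Primrec.fst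
      refine Primrec.option_map (Primrec.list_getElem?.comp (by fun_prop) (by fun_prop)) ?_
      unfold Primrec₂; fun_prop
    · exact Primrec.option_some.comp (by fun_prop)
  refine (Primrec.nat_strong_rec (fun (_ : Unit) n => ofCode n) hg fun _ n => ?_).comp
    (Primrec.const ()) Primrec.id
  simp only [g, List.length_map, List.length_range]
  by_cases h : n.unpair.1 = 0 ∧ 2 ≤ n
  · have := unpair_lt_of_two_le h
    rw [ofCode, dif_pos h]
    have hb : Nat.ble 2 n = true := by simpa using h.2
    simp [h.1, hb, this]
  · by_cases h' : n.unpair.1 = 1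
    · have i1 := (Nat.unpair_left_le _).trans_lt (unpair_two_lt_of_pos (n := n) (by omega))
      have i2 := (Nat.unpair_right_le _).trans_lt (unpair_two_lt_of_pos (n := n) (by omega))
      rw [ofCode, dif_neg h, dif_pos h']
      simp [h', i1, i2]
    · rw [ofCode, dif_neg h, dif_neg h']
      have : (and (decide (n.unpair.1 = 0)) (Nat.ble 2 n)) = false := by
        rw [Bool.eq_false_iff]; simpa using h
      simp [this, h']

@[fun_prop] theorem primrec_ofCode_of {f : α → ℕ} (hf : Primrec f) :
    Primrec fun a => ofCode (f a) := primrec_ofCode.comp hf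

@[fun_prop] theorem primrec_labOf_of {f : α → ℕ} (hf : Primrec f) :
    Primrec fun a => labOf (f a) := by
  refine (show Primrec fun a => cond (decide ((f a).unpair.1 = 0))
    ((0, (f a).unpair.2, .leaf 0) : Lab) (cond (decide ((f a).unpair.1 = 1))
      (1, (f a).unpair.2, .leaf 0)
      (2, (f a).unpair.2.unpair.1, ofCode (f a).unpair.2.unpair.2)) by
      fun_prop).of_eq fun a => ?_
  unfold labOf
  by_cases h : (f a).unpair.1 = 0
  · simp [h]
  · by_cases h' : (f a).unpair.1 = 1 <;> simp [h, h']

@[fun_prop] theorem primrec_dual_of {f : α → Lab} (hf : Primrec f) :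
    Primrec fun a => (f a).dual := by
  unfold Lab at *
  refine (show Primrec fun a => (cond (decide ((f a).1 = 0)) 1 (cond (decide ((f a).1 = 1)) 0
    (cond (decide ((f a).1 = 2)) 3 2)), (f a).2) by fun_prop).of_eq fun a => ?_
  unfold Lab.dual
  by_cases h : (f a).1 = 0
  · simp [h]
  · by_cases h' : (f a).1 = 1
    · simp [h']
    · by_cases h'' : (f a).1 = 2 <;> simp [h, h', h'']

theorem primrec_branchActs : Primrec branchActs := by
  let g : Unit → List (List (Lab × Tr)) → Option (List (Lab × Tr)) := fun _ l =>
    Nat.casesOn l.length (some []) fun n =>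
      (l[n.unpair.2.unpair.2]?).map fun s =>
        (labOf n.unpair.1, ofCode n.unpair.2.unpair.1) :: s
  have hlen : Primrec fun p : Unit × List (List (Lab × Tr)) => p.2.length :=
    Primrec.list_length.comp Primrec.snd
  have hg : Primrec₂ g := by
    refine Primrec.nat_casesOn hlen (Primrec.const _) ?_
    refine Primrec.option_map (Primrec.list_getElem?.comp
      (by fun_prop) (by fun_prop)) ?_
    unfold Primrec₂; fun_prop
  refine (Primrec.nat_strong_rec (fun (_ : Unit) n => branchActs n) hg fun _ n => ?_).comp
    (Primrec.const ()) Primrec.id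
  simp only [g, List.length_map, List.length_range]
  cases n with
  | zero => simp [branchActs]
  | succ n =>
    have : n.unpair.2.unpair.2 < n + 1 :=
      Nat.lt_succ_of_le ((Nat.unpair_right_le _).trans (Nat.unpair_right_le _))
    simp [branchActs, this]

@[fun_prop] theorem primrec_acts_of {f : α → ℕ} (hf : Primrec f) :
    Primrec fun a => acts (f a) := by
  have h := fun {g : α → ℕ} (hg : Primrec g) => primrec_branchActs.comp hg
  refine (Primrec.cond (c := fun a => decide ((f a).unpair.1 = 2))
    (f := fun a => [(labOf (f a).unpair.2.unpair.1,
      Tr.par (ofCode (f a).unpair.2.unpair.2) (.leaf (f a)))])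
    (g := fun a => cond (decide ((f a).unpair.1 = 3)) (branchActs (f a).unpair.2) [])
    (by fun_prop) (by fun_prop) (Primrec.cond (by fun_prop) (h (by fun_prop)) (by fun_prop))).of_eq
    fun a => ?_
  unfold acts
  by_cases h : (f a).unpair.1 = 2
  · simp [h]
  · by_cases h' : (f a).unpair.1 = 3 <;> simp [h, h']

/-- Whether `a[R]` may be updated by `U`. -/
def permB (t : Topology) (R U : Tr) : Bool :=
  or t.dyn (or (decide (R.nloc = 0)) (and (decide (U.holes = 1)) (decide (U.outerHoles = 0))))

theorem permB_iff {t : Topology} {R U : Tr} : permB t R U = true ↔ Perm t R U := by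
  cases t <;> simp [permB, Topology.dyn, Perm]

/-- The list of the targets of the transitions with label `α`. -/
def post (t : Topology) (α : Lab) : Tr → List Tr
  | .leaf c => (acts c).flatMap fun x => cond (decide (x.1 = α)) [x.2] []
  | .loc a P => cond (and (decide (α.1 = 3)) (and (decide (α.2.1 = a)) (permB t P α.2.2)))
      [α.2.2.fill P] [] ++ (post t α P).map fun P' => .loc a P'
  | .par P Q => ((post t α P).map fun P' => .par P' Q) ++ (post t α Q).map fun Q' => .par P Q'

theorem mem_post {t : Topology} {α : Lab} {P P' : Tr} : P' ∈ post t α P ↔ TT t P α P' := by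
  have hc : ∀ (b : Tr) (c : Bool) (l : List Tr), b ∈ cond c l [] ↔ c = true ∧ b ∈ l := by
    intro b c l; cases c <;> simp
  induction P generalizing P' with
  | leaf c =>
    simp only [post, List.mem_flatMap, hc, decide_eq_true_eq, List.mem_singleton]
    constructor
    · rintro ⟨⟨β, T⟩, h, rfl, rfl⟩; exact .leaf h
    · intro h; cases h with | leaf h => exact ⟨_, h, rfl, rfl⟩
  | loc a P ih =>
    simp only [post, List.mem_append, hc, Bool.and_eq_true, decide_eq_true_eq, permB_iff,
      List.mem_singleton, List.mem_map, ih]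
    constructor
    · rintro (⟨⟨h, h', hp⟩, rfl⟩ | ⟨x, h, rfl⟩)
      · obtain ⟨k, b, U⟩ := α
        simp only at h h' hp
        subst h h'; exact .abs _ hp
      · exact .loc _ h
    · intro h
      cases h with
      | abs _ hp => exact .inl ⟨⟨rfl, rfl, hp⟩, rfl⟩
      | loc _ h => exact .inr ⟨_, h, rfl⟩
  | par P Q ihP ihQ =>
    simp only [post, List.mem_append, List.mem_map, ihP, ihQ]
    constructor
    · rintro (⟨x, h, rfl⟩ | ⟨x, h, rfl⟩)
      · exact .parL _ h
      · exact .parR _ h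
    · intro h
      cases h with
      | parL _ h => exact .inl ⟨_, h, rfl⟩
      | parR _ h => exact .inr ⟨_, h, rfl⟩

@[fun_prop] theorem primrec_post_of {t : Topology} {f : α → Lab} {g : α → Tr} (hf : Primrec f)
    (hg : Primrec g) : Primrec fun a => post t (f a) (g a) := by
  unfold Lab at *
  refine (primrec_tr_rec (fun (α : ℕ × ℕ × Tr) P => post t α P)
    (fl := fun α c => (acts c).flatMap fun x => cond (decide (x.1 = α)) [x.2] [])
    (fo := fun α a P s =>
      cond (and (decide (α.1 = 3)) (and (decide (α.2.1 = a)) (permB t P α.2.2)))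
      [α.2.2.fill P] [] ++ s.map fun P' => .loc a P')
    (fp := fun _ P Q s s' => (s.map fun P' => .par P' Q) ++ s'.map fun Q' => .par P Q')
    (by fun_prop) (by unfold permB; fun_prop) (by fun_prop)
    (fun _ _ => rfl) (fun _ _ _ => rfl) (fun _ _ _ => rfl)).comp
    (g := fun a => (f a, g a)) (by fun_prop)

/-- The list of the labels of the leaves. -/
def labels : Tr → List Lab
  | .leaf c => (acts c).map fun x => x.1
  | .loc _ P => labels P
  | .par P Q => labels P ++ labels Q

/-- Absorptions are excluded because a location accepts patterns without bound. Of two synchronizing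
labels at most one is an absorption, so it suffices to try the leaf labels of one side and the duals
of those of the other; hence the list of reducts is finite. -/
theorem TT.mem_labels {t : Topology} {P P' : Tr} {α : Lab} (h : TT t P α P') (hα : α.1 ≠ 3) :
    α ∈ labels P := by
  induction h with
  | leaf h => exact List.mem_map.2 ⟨_, h, rfl⟩
  | abs => exact (hα rfl).elim
  | loc _ _ ih => exact ih hα
  | parL _ _ ih => exact List.mem_append.2 (.inl (ih hα))
  | parR _ _ ih => exact List.mem_append.2 (.inr (ih hα))

@[fun_prop] theorem primrec_labels_of {f : α → Tr} (hf : Primrec f) :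
    Primrec fun a => labels (f a) := by
  unfold Lab at *
  exact (primrec_tr_rec (fun (_ : Unit) P => labels P) (fl := fun _ c => (acts c).map fun x => x.1)
    (fo := fun _ _ _ s => s) (fp := fun _ _ _ s s' => s ++ s') (by fun_prop)
    (by fun_prop) (by fun_prop) (fun _ _ => rfl) (fun _ _ _ => rfl) (fun _ _ _ => rfl)).comp
    (g := fun a => ((), f a)) (by fun_prop)

/-- The list of the reducts. -/
def steps (t : Topology) : Tr → List Tr
  | .leaf _ => []
  | .loc a P => (steps t P).map fun P' => .loc a P'
  | .par P Q => (((labels P ++ (labels Q).map Lab.dual).flatMap fun α =>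
      (post t α P).flatMap fun P' => (post t α.dual Q).map fun Q' => .par P' Q') ++
      ((steps t P).map fun P' => .par P' Q)) ++ (steps t Q).map fun Q' => .par P Q'

theorem Lab.dual_dual {α : Lab} (h : α.1 ≤ 3) : α.dual.dual = α := by
  obtain ⟨k, a, U⟩ := α
  simp only at h
  interval_cases k <;> rfl

theorem mem_steps {t : Topology} {P P' : Tr} : P' ∈ steps t P ↔ TStep t P P' := by
  induction P generalizing P' with
  | leaf c => simp only [steps, List.not_mem_nil, false_iff]; rintro ⟨⟩
  | loc a P ih =>
    simp only [steps, List.mem_map, ih]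
    constructor
    · rintro ⟨x, h, rfl⟩; exact .loc _ h
    · intro h; cases h with | loc _ h => exact ⟨_, h, rfl⟩
  | par P Q ihP ihQ =>
    simp only [steps, List.mem_append, List.mem_flatMap, List.mem_map, ihP, ihQ, mem_post]
    constructor
    · rintro ((⟨α, -, x, h, y, h', rfl⟩ | ⟨x, h, rfl⟩) | ⟨x, h, rfl⟩)
      · exact .sync h h'
      · exact .parL _ h
      · exact .parR _ h
    · intro h
      cases h with
      | @sync _ _ _ _ α h h' =>
        refine .inl (.inl ⟨α, ?_, _, h, _, h', rfl⟩)
        by_cases hα : α.1 = 3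
        · exact .inr ⟨_, h'.mem_labels (by simp [Lab.dual, hα]), Lab.dual_dual h.kind_le⟩
        · exact .inl (h.mem_labels hα)
      | parL _ h => exact .inl (.inr ⟨_, h, rfl⟩)
      | parR _ h => exact .inr ⟨_, h, rfl⟩

@[fun_prop] theorem primrec_steps_of {t : Topology} {f : α → Tr} (hf : Primrec f) :
    Primrec fun a => steps t (f a) := by
  refine (primrec_tr_rec (fun (_ : Unit) P => steps t P) (fl := fun _ _ => [])
    (fo := fun _ a _ s => s.map fun P' => .loc a P')
    (fp := fun _ P Q s s' => (((labels P ++ (labels Q).map fun β => β.dual).flatMap fun α =>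
      (post t α P).flatMap fun P' => (post t α.dual Q).map fun Q' => .par P' Q') ++
      (s.map fun P' => .par P' Q)) ++ s'.map fun Q' => .par P Q') (by fun_prop)
    (by fun_prop) (by fun_prop) (fun _ _ => rfl) (fun _ _ _ => rfl) (fun _ _ _ => rfl)).comp
    (g := fun a => ((), f a)) (by fun_prop)

@[fun_prop] theorem primrec_barbLab_of {f : α → Barb} (hf : Primrec f) :
    Primrec fun a => (f a).lab := by
  unfold Lab
  refine (Primrec.sumCasesOn (g := fun _ n => ((0, n, .leaf 0) : ℕ × ℕ × Tr))
    (h := fun _ n => (1, n, .leaf 0)) hf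
    (by unfold Primrec₂; fun_prop) (by unfold Primrec₂; fun_prop)).of_eq fun a => ?_
  cases f a <;> rfl

/-- Whether the tree exhibits the barb. -/
def barbB (t : Topology) (P : Tr) (e : Barb) : Bool := (post t e.lab P).any fun _ => true

theorem barbB_iff {t : Topology} {P : Tr} {e : Barb} : barbB t P e = true ↔ TBarb t P e := by
  simp [barbB, TBarb, ← mem_post, List.any_eq_true]

@[fun_prop] theorem primrec_barbB_of {t : Topology} {f : α → Tr} {g : α → Barb} (hf : Primrec f)
    (hg : Primrec g) : Primrec fun a => barbB t (f a) (g a) := by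
  unfold barbB; fun_prop

end

end Evol

-- Decidability: coverability by certificates.

namespace Evol

/-! ## Bounded adaptation as a coverability problem -/

/-- The transitions of the system whose states are pairs of a phase and a tree.  In phase `k + 1`
the tree is free to evolve; from phase `k` on, all trees have to be error states. -/
def SysStep (t : Topology) (e : Barb) (k : ℕ) (x y : ℕ × Tr) : Prop :=
  (x.1 = k + 1 ∧ y.1 = k + 1 ∧ TStep t x.2 y.2) ∨ (x.1 = k + 1 ∧ y = (k, x.2)) ∨
    (x.1 = y.1 + 1 ∧ y.1 < k ∧ TBarb t x.2 e ∧ TStep t x.2 y.2)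

/-- The target states. -/
def Target (t : Topology) (e : Barb) (x : ℕ × Tr) : Prop := x.1 = 0 ∧ TBarb t x.2 e

/-- Some element of `D` lies below `x`. -/
def Above (t : Topology) (D : List (ℕ × Tr)) (x : ℕ × Tr) : Prop :=
  ∃ d ∈ D, d.1 = x.1 ∧ Le t d.2 x.2

/-- A transition that stays within the class of states. -/
def CStep (t : Topology) (e : Barb) (k N K : ℕ) (x y : ℕ × Tr) : Prop :=
  SysStep t e k x y ∧ State t N K y.2

/-- A target state is reachable. -/
def Cover (t : Topology) (e : Barb) (k N K : ℕ) (x : ℕ × Tr) : Prop :=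
  ∃ y, Relation.ReflTransGen (CStep t e k N K) x y ∧ Target t e y

theorem State.of_le {t : Topology} {N K : ℕ} {P Q : Tr} (h : Le t P Q) (hQ : State t N K Q) :
    State t N K P :=
  ⟨h.inCls hQ.1, fun ht => by subst ht; rw [h.nloc_eq]; exact hQ.2 rfl⟩

theorem State.weight_le {t : Topology} {N K : ℕ} {P : Tr} (h : State t N K P) :
    P.weight t ≤ K := by
  cases t with
  | dynamic => exact Nat.zero_le _
  | static => exact (h.2 rfl).le

theorem SysStep.mono {t : Topology} {e : Barb} {k : ℕ} {x y : ℕ × Tr} {P : Tr}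
    (h : SysStep t e k x y) (hP : Le t x.2 P) :
    ∃ P', SysStep t e k (x.1, P) (y.1, P') ∧ Le t y.2 P' := by
  rcases h with ⟨h1, h2, h⟩ | ⟨h1, rfl⟩ | ⟨h1, h2, h3, h⟩
  · obtain ⟨P', k1, k2⟩ := h.mono hP
    exact ⟨P', .inl ⟨h1, h2, k1⟩, k2⟩
  · exact ⟨P, .inr (.inl ⟨h1, rfl⟩), hP⟩
  · obtain ⟨P', k1, k2⟩ := h.mono hP
    exact ⟨P', .inr (.inr ⟨h1, h2, h3.mono hP, k1⟩), k2⟩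

/-- The larger run stays within the class: reductions do not enlarge the alphabet, and in a static
topology each of its trees has as many locations as the corresponding tree of the smaller run. -/
theorem Cover.mono {t : Topology} {e : Barb} {k N K : ℕ} {x : ℕ × Tr} {P : Tr}
    (h : Cover t e k N K x) (hP : Le t x.2 P) (hS : State t N K P) :
    Cover t e k N K (x.1, P) := by
  obtain ⟨y, h, hy⟩ := h
  induction h using Relation.ReflTransGen.head_induction_on generalizing P with
  | refl => exact ⟨_, .refl, hy.1, hy.2.mono hP⟩
  | head h _ ih =>
    obtain ⟨P', h1, h2⟩ := h.1.mono hP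
    have hS' : State t N K P' := by
      refine ⟨?_, fun ht => ?_⟩
      · rcases h1 with ⟨-, -, h1⟩ | ⟨-, h1⟩ | ⟨-, -, -, h1⟩
        · exact h1.inCls hS.1
        · cases h1; exact hS.1
        · exact h1.inCls hS.1
      · subst ht; rw [← h2.nloc_eq]; exact h.2.2 rfl
    obtain ⟨z, h3, h4⟩ := ih h2 hS'
    exact ⟨z, .head ⟨h1, hS'⟩ h3, h4⟩

/-- A list of states certifies that no target is reachable if the set of the states above it
contains the targets and the predecessors of its elements.  It suffices to check small trees. -/
def Certificate (t : Topology) (e : Barb) (k N K : ℕ) (D : List (ℕ × Tr)) (b : ℕ) : Prop :=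
  ∀ P : Tr, P.size ≤ b → State t N K P → ∀ j ≤ k + 1,
    (Target t e (j, P) ∨ ∃ y, CStep t e k N K (j, P) y ∧ Above t D y) → Above t D (j, P)

/-- Without a finite basis one could choose elements of `V` successively, each above none of the
earlier ones. This would be a bad sequence in the product of finitely many phases, ordered by
equality, and the trees of the class. -/
theorem exists_basis {t : Topology} {N K M : ℕ} (V : Set (ℕ × Tr))
    (hV : ∀ x ∈ V, x.1 ≤ M ∧ State t N K x.2) :
    ∃ D : List (ℕ × Tr), (∀ d ∈ D, d ∈ V) ∧ ∀ x ∈ V, Above t D x := by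
  classical
  by_contra hc
  push Not at hc
  obtain ⟨f, hf, hbad⟩ := exists_seq_of_forall_finset_exists (fun x => x ∈ V)
    (fun x y : ℕ × Tr => ¬ (x.1 = y.1 ∧ Le t x.2 y.2)) (fun s hs => by
      obtain ⟨x, hx, h⟩ := hc s.toList (fun d hd => hs d (Finset.mem_toList.1 hd))
      exact ⟨x, hx, fun y hy h' => h ⟨y, Finset.mem_toList.2 hy, h'⟩⟩)
  have h1 : {c | c ≤ M}.PartiallyWellOrderedOn (fun a b : ℕ => a = b) :=
    (Set.finite_le_nat M).partiallyWellOrderedOn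
  obtain ⟨m, n, hmn, h, h'⟩ := (h1.prod (kruskal t N K)).exists_lt (f := f)
    (fun n => hV _ (hf n))
  exact hbad m n hmn ⟨h, h'⟩

/-- The certificate is a finite basis of the states from which a target is reachable. It passes the
test for trees of every size. -/
theorem exists_certificate {t : Topology} {e : Barb} {k N K : ℕ} {x : ℕ × Tr}
    (h : ¬ Cover t e k N K x) : ∃ D, (∀ b, Certificate t e k N K D b) ∧ ¬ Above t D x ∨
      ¬ State t N K x.2 := by
  by_cases hx : State t N K x.2
  swap
  · exact ⟨[], .inr hx⟩
  obtain ⟨D, hD, hD'⟩ := exists_basis (t := t) (N := N) (K := K) (M := k + 1)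
    {y | y.1 ≤ k + 1 ∧ State t N K y.2 ∧ Cover t e k N K y} (fun y hy => ⟨hy.1, hy.2.1⟩)
  have hcov : ∀ y : ℕ × Tr, State t N K y.2 → Above t D y → Cover t e k N K y := by
    rintro ⟨j, P⟩ hy ⟨d, hd, h1, h2⟩
    have := (hD d hd).2.2.mono h2 hy
    rwa [h1] at this
  refine ⟨D, .inl ⟨fun b P _ hP j hj h => ?_, fun ha => h (hcov x hx ha)⟩⟩
  rcases h with h | ⟨y, h1, h2⟩
  · exact hD' _ ⟨hj, hP, _, .refl, h⟩
  · obtain ⟨z, h3, h4⟩ := hcov y h1.2 h2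
    exact hD' _ ⟨hj, hP, z, .head h1 h3, h4⟩

/-- The size of the trees that have to be checked for a certificate. -/
def certBound (N K : ℕ) (D : List (ℕ × Tr)) : ℕ :=
  predBound N K (D.flatMap fun d => List.range d.2.size).length + 3 * K + 5

theorem size_le_of_mem {D : List (ℕ × Tr)} {d : ℕ × Tr} (h : d ∈ D) :
    d.2.size ≤ (D.flatMap fun d => List.range d.2.size).length := by
  induction D with
  | nil => simp at h
  | cons x D ih =>
    rw [List.flatMap_cons, List.length_append, List.length_range]
    rcases List.mem_cons.1 h with rfl | h
    · omega
    · have := ih h; omega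

theorem predBound_mono {N K s s' : ℕ} (h : s ≤ s') : predBound N K s ≤ predBound N K s' := by
  unfold predBound; gcongr

/-- Backward induction along the run to the target. If the successor lies above some `d ∈ D`, the
state can be shrunk to a small one with a successor above `d`; this one has been checked, so it lies
above `D`, and so does the state itself. -/
theorem Certificate.sound {t : Topology} {e : Barb} {k N K : ℕ} {D : List (ℕ × Tr)}
    (hD : Certificate t e k N K D (certBound N K D)) {x : ℕ × Tr} (hx : State t N K x.2)
    (hj : x.1 ≤ k + 1) (h : Cover t e k N K x) : Above t D x := by
  have hup : ∀ (j : ℕ) (P Q : Tr), Le t P Q → Above t D (j, P) → Above t D (j, Q) := by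
    rintro j P Q h ⟨d, hd, h1, h2⟩
    exact ⟨d, hd, h1, h2.trans h⟩
  have hbig : ∀ s, s ≤ predBound N K s := fun s => by unfold predBound; nlinarith
  obtain ⟨y, h, hy⟩ := h
  induction h using Relation.ReflTransGen.head_induction_on with
  | refl =>
    obtain ⟨hy0, P', hP⟩ := hy
    obtain ⟨P₀, P₀', h1, h2, -, h4⟩ := hP.exists_enabler
    have := hx.weight_le
    refine hup _ P₀ _ h1 (hD P₀ (by unfold certBound; omega) (.of_le h1 hx) _ hj (.inl ?_))
    exact ⟨hy0, _, h2⟩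
  | @head x y h _ ih =>
    have hS := h.2
    have hj' : y.1 ≤ k + 1 := by
      rcases h.1 with ⟨-, h, -⟩ | ⟨-, rfl⟩ | ⟨-, h, -⟩
      · omega
      · simp
      · omega
    obtain ⟨d, hd, hd1, hd2⟩ := ih hS hj'
    have hds := size_le_of_mem hd
    have hpb := predBound_mono (N := N) (K := K) hds
    have hw := hx.weight_le
    obtain ⟨j, P⟩ := x
    obtain ⟨j', P'⟩ := y
    simp only at hd1 hd2 hS hj hj' hx
    replace hw : P.weight t ≤ K := hw
    have key : ∀ P₀ P₀', Le t P₀ P → P₀.size ≤ certBound N K D → SysStep t e k (j, P₀) (j', P₀') →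
        Le t d.2 P₀' → Above t D (j, P) := by
      intro P₀ P₀' h1 h2 h3 h4
      refine hup _ P₀ _ h1 (hD P₀ h2 (.of_le h1 hx) _ hj (.inr ⟨(j', P₀'), ⟨h3, ?_⟩, ?_⟩))
      · refine ⟨?_, fun ht => ?_⟩
        · rcases h3 with ⟨-, -, h3⟩ | ⟨-, h3⟩ | ⟨-, -, -, h3⟩
          · exact h3.inCls (h1.inCls hx.1)
          · cases h3; exact h1.inCls hx.1
          · exact h3.inCls (h1.inCls hx.1)
        · subst ht; rw [← h4.nloc_eq, hd2.nloc_eq]; exact hS.2 rfl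
      · exact ⟨d, hd, hd1, h4⟩
    rcases h.1 with ⟨h1, h2, h3⟩ | ⟨h1, h2⟩ | ⟨h1, h2, h3, h4⟩
    · obtain ⟨P₀, P₀', k1, k2, k3, k4⟩ := h3.exists_small hx.1 hw hd2
      exact key P₀ P₀' k1 (by unfold certBound; omega) (.inl ⟨h1, h2, k2⟩) k3
    · cases h2
      exact key d.2 d.2 hd2 (by have := hbig d.2.size; unfold certBound; omega)
        (.inr (.inl ⟨h1, rfl⟩)) (.refl _ _)
    · obtain ⟨P₀, P₀', k1, k2, k3, k4⟩ := h4.exists_small hx.1 hw hd2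
      obtain ⟨Q, hQ⟩ := h3
      obtain ⟨P₁, P₁', l1, l2, -, l4⟩ := hQ.exists_enabler
      -- One tree has to exhibit the barb and to have a reduct above `d`. Joining the two witnesses
      -- costs `3 * K + 4` for the barb and one more node, which explains `certBound`.
      obtain ⟨z, z1, z2, z3, z4⟩ := exists_join k1 l1
      obtain ⟨z', k5, k6⟩ := k2.mono z2
      simp only at l4 k4
      exact key z z' z1 (by unfold certBound; omega)
        (.inr (.inr ⟨h1, h2, TBarb.mono ⟨_, l2⟩ z3, k5⟩)) (k3.trans k6)

/-! ## Deciding coverability -/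

section

variable {α : Type} [Primcodable α]

@[fun_prop] theorem primrec_length_of {β : Type} [Primcodable β] {f : α → List β}
    (hf : Primrec f) : Primrec fun a => (f a).length := Primrec.list_length.comp hf

@[fun_prop] theorem primrec_sub_of {f g : α → ℕ} (hf : Primrec f) (hg : Primrec g) :
    Primrec fun a => f a - g a := Primrec.nat_sub.comp hf hg

/-- A bound for the numbers of the trees of a given size in the class `N`. -/
def encBound (N : ℕ) : ℕ → ℕ
  | 0 => 3 * N
  | s + 1 => 3 * Nat.pair (encBound N s) (encBound N s) + 2

theorem le_pair_self (x : ℕ) : x ≤ Nat.pair x x := Nat.left_le_pair x x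

theorem encBound_ge (N s : ℕ) : 3 * N ≤ encBound N s := by
  induction s with
  | zero => rfl
  | succ s ih => have := le_pair_self (encBound N s); rw [encBound]; omega

theorem encBound_mono {N s s' : ℕ} (h : s ≤ s') : encBound N s ≤ encBound N s' := by
  induction h with
  | refl => rfl
  | step _ ih => rename_i m _; have := le_pair_self (encBound N m); rw [encBound]; omega

theorem pair_mono {a b c d : ℕ} (h : a ≤ b) (h' : c ≤ d) : Nat.pair a c ≤ Nat.pair b d := by
  have h1 : Nat.pair a c ≤ Nat.pair b c := by
    rcases h.eq_or_lt with rfl | h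
    · rfl
    · exact (Nat.pair_lt_pair_left _ h).le
  refine h1.trans ?_
  rcases h'.eq_or_lt with rfl | h'
  · rfl
  · exact (Nat.pair_lt_pair_right _ h').le

/-- Turns quantification over the trees of bounded size in the class into bounded search over
numbers. -/
theorem Tr.enc_le {N : ℕ} : ∀ {P : Tr}, P.InCls N → P.enc ≤ encBound N P.size
  | .leaf c, h => by
      have := encBound_ge N (Tr.leaf c).size
      have h : c ≤ N := h
      rw [Tr.enc]; omega
  | .loc a P, h => by
      have h1 := Tr.enc_le h.2
      have h2 := encBound_ge N P.size
      have h3 := h.1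
      have := pair_mono (a := a) (b := encBound N P.size) (by omega) h1
      rw [Tr.enc, Tr.size, encBound]; omega
  | .par P Q, h => by
      have h1 := (Tr.enc_le h.1).trans (encBound_mono (s' := P.size + Q.size) (by omega))
      have h2 := (Tr.enc_le h.2).trans (encBound_mono (s' := P.size + Q.size) (by omega))
      have := pair_mono h1 h2
      rw [Tr.enc, Tr.size, encBound]; omega

@[fun_prop] theorem primrec_encBound_of {f g : α → ℕ} (hf : Primrec f) (hg : Primrec g) :
    Primrec fun a => encBound (f a) (g a) := by
  refine (Primrec.nat_rec' (g := fun a => 3 * f a) (h := fun _ p => 3 * Nat.pair p.2 p.2 + 2) hg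
    (by fun_prop) (by unfold Primrec₂; fun_prop)).of_eq fun a => ?_
  induction g a with
  | zero => rfl
  | succ n ih => simp only [encBound]; rw [← ih]

/-- Membership in the class of states. -/
def stateB (t : Topology) (N K : ℕ) (P : Tr) : Bool :=
  and (P.inClsB N) (or t.dyn (decide (P.nloc = K)))

theorem stateB_iff {t : Topology} {N K : ℕ} {P : Tr} :
    stateB t N K P = true ↔ State t N K P := by
  cases t <;> simp [stateB, State, Tr.inClsB_iff, Topology.dyn]

@[fun_prop] theorem primrec_stateB_of {t : Topology} {f g : α → ℕ} {h : α → Tr} (hf : Primrec f)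
    (hg : Primrec g) (hh : Primrec h) : Primrec fun a => stateB t (f a) (g a) (h a) := by
  unfold stateB; fun_prop

/-- The list of the successors within the class of states. -/
def sysSucc (t : Topology) (e : Barb) (k N K : ℕ) (x : ℕ × Tr) : List (ℕ × Tr) :=
  (cond (decide (x.1 = k + 1))
    ((k, x.2) :: (steps t x.2).map fun P => (k + 1, P)) [] ++
  cond (and (Nat.ble 1 x.1) (and (Nat.ble x.1 k) (barbB t x.2 e)))
    ((steps t x.2).map fun P => (x.1 - 1, P)) []).flatMap fun y =>
      cond (stateB t N K y.2) [y] []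

theorem mem_cond_nil {β : Type} {b : β} {c : Bool} {l : List β} :
    b ∈ cond c l [] ↔ c = true ∧ b ∈ l := by cases c <;> simp

theorem mem_sysSucc {t : Topology} {e : Barb} {k N K : ℕ} {x y : ℕ × Tr} :
    y ∈ sysSucc t e k N K x ↔ CStep t e k N K x y := by
  obtain ⟨j, P⟩ := x
  obtain ⟨i, Q⟩ := y
  simp only [sysSucc, List.mem_flatMap, List.mem_append, mem_cond_nil, List.mem_cons, List.mem_map,
    decide_eq_true_eq, Bool.and_eq_true, mem_steps, barbB_iff, stateB_iff, List.not_mem_nil,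
    or_false, Nat.ble_eq, CStep, SysStep]
  constructor
  · rintro ⟨z, h, hs, rfl⟩
    refine ⟨?_, hs⟩
    rcases h with ⟨h, h' | ⟨R, hR, h'⟩⟩ | ⟨⟨h1, h2, h3⟩, R, hR, h'⟩
    · exact .inr (.inl ⟨h, h'⟩)
    · cases h'; exact .inl ⟨h, rfl, hR⟩
    · cases h'; exact .inr (.inr ⟨by omega, by omega, h3, hR⟩)
  · rintro ⟨h, hs⟩
    refine ⟨_, ?_, hs, rfl⟩
    rcases h with ⟨h1, h2, h3⟩ | ⟨h1, h2⟩ | ⟨h1, h2, h3, h4⟩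
    · subst h2; exact .inl ⟨h1, .inr ⟨_, h3, rfl⟩⟩
    · exact .inl ⟨h1, .inl h2⟩
    · exact .inr ⟨⟨by omega, by omega, h3⟩, _, h4, by simp [h1]⟩

@[fun_prop] theorem primrec_sysSucc_of {t : Topology} {fe : α → Barb} {fk fN fK : α → ℕ}
    {fx : α → ℕ × Tr} (h1 : Primrec fe) (h2 : Primrec fk) (h3 : Primrec fN) (h4 : Primrec fK)
    (h5 : Primrec fx) : Primrec fun a => sysSucc t (fe a) (fk a) (fN a) (fK a) (fx a) := by
  unfold sysSucc; fun_prop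

/-- Whether a state is a target. -/
def targetB (t : Topology) (e : Barb) (x : ℕ × Tr) : Bool :=
  and (decide (x.1 = 0)) (barbB t x.2 e)

theorem targetB_iff {t : Topology} {e : Barb} {x : ℕ × Tr} :
    targetB t e x = true ↔ Target t e x := by simp [targetB, Target, barbB_iff]

@[fun_prop] theorem primrec_targetB_of {t : Topology} {fe : α → Barb} {fx : α → ℕ × Tr}
    (h1 : Primrec fe) (h5 : Primrec fx) : Primrec fun a => targetB t (fe a) (fx a) := by
  unfold targetB; fun_prop

/-- Whether a state lies above an element of `D`. -/
def aboveB (t : Topology) (D : List (ℕ × Tr)) (x : ℕ × Tr) : Bool :=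
  D.any fun d => and (decide (d.1 = x.1)) ((downs t x.2).any fun b => decide (d.2 = b))

theorem aboveB_iff {t : Topology} {D : List (ℕ × Tr)} {x : ℕ × Tr} :
    aboveB t D x = true ↔ Above t D x := by
  simp [aboveB, Above, List.any_eq_true, mem_downs]

@[fun_prop] theorem primrec_aboveB_of {t : Topology} {fD : α → List (ℕ × Tr)} {fx : α → ℕ × Tr}
    (h1 : Primrec fD) (h5 : Primrec fx) : Primrec fun a => aboveB t (fD a) (fx a) := by
  unfold aboveB; fun_prop

/-- The list of the states reachable in `n` steps. -/
def reachList (t : Topology) (e : Barb) (k N K : ℕ) (x : ℕ × Tr) : ℕ → List (ℕ × Tr)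
  | 0 => [x]
  | n + 1 => (reachList t e k N K x n).flatMap fun y => sysSucc t e k N K y

theorem exists_mem_reachList {t : Topology} {e : Barb} {k N K : ℕ} {x y : ℕ × Tr} :
    (∃ n, y ∈ reachList t e k N K x n) ↔ Relation.ReflTransGen (CStep t e k N K) x y := by
  constructor
  · rintro ⟨n, h⟩
    induction n generalizing y with
    | zero => simp only [reachList, List.mem_singleton] at h; subst h; exact .refl
    | succ n ih =>
      simp only [reachList, List.mem_flatMap, mem_sysSucc] at h
      obtain ⟨z, h, h'⟩ := h
      exact (ih h).tail h'
  · intro h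
    induction h with
    | refl => exact ⟨0, by simp [reachList]⟩
    | tail _ h ih =>
      obtain ⟨n, hn⟩ := ih
      exact ⟨n + 1, by
        simp only [reachList, List.mem_flatMap, mem_sysSucc]; exact ⟨_, hn, h⟩⟩

@[fun_prop] theorem primrec_reachList_of {t : Topology} {fe : α → Barb} {fk fN fK fn : α → ℕ}
    {fx : α → ℕ × Tr} (h1 : Primrec fe) (h2 : Primrec fk) (h3 : Primrec fN) (h4 : Primrec fK)
    (h5 : Primrec fx) (h6 : Primrec fn) :
    Primrec fun a => reachList t (fe a) (fk a) (fN a) (fK a) (fx a) (fn a) := by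
  refine (Primrec.nat_rec' (g := fun a => [fx a])
    (h := fun a p => p.2.flatMap fun y => sysSucc t (fe a) (fk a) (fN a) (fK a) y) h6
    (by fun_prop) (by unfold Primrec₂; fun_prop)).of_eq fun a => ?_
  induction fn a with
  | zero => rfl
  | succ n ih => simp only [reachList]; rw [← ih]

/-- Whether `D` is a certificate. -/
def certB (t : Topology) (e : Barb) (k N K : ℕ) (D : List (ℕ × Tr)) : Bool :=
  (List.range (encBound N (certBound N K D) + 1)).all fun m =>
    or (not (stateB t N K (Tr.dec m))) ((List.range (k + 2)).all fun j =>
      or (aboveB t D (j, Tr.dec m)) (not (or (targetB t e (j, Tr.dec m))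
        ((sysSucc t e k N K (j, Tr.dec m)).any fun y => aboveB t D y))))

theorem certB_imp {t : Topology} {e : Barb} {k N K : ℕ} {D : List (ℕ × Tr)}
    (h : certB t e k N K D = true) : Certificate t e k N K D (certBound N K D) := by
  intro P hs hP j hj hx
  simp only [certB, List.all_eq_true, List.mem_range] at h
  have hle := (Tr.enc_le hP.1).trans (encBound_mono hs)
  have := h P.enc (by omega)
  rw [Tr.dec_enc, stateB_iff.2 hP] at this
  simp only [Bool.not_true, Bool.false_or, List.all_eq_true, List.mem_range] at this
  have := this j (by omega)
  rw [Bool.or_eq_true, aboveB_iff] at this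
  rcases this with h | h
  · exact h
  · simp only [Bool.not_eq_true', Bool.or_eq_false_iff, List.any_eq_false] at h
    rcases hx with hx | ⟨y, hy, hy'⟩
    · rw [targetB_iff.2 hx] at h; simp at h
    · exact absurd (aboveB_iff.2 hy') (h.2 y (mem_sysSucc.2 hy))

/-- The test runs through an initial segment of the numbers, which may include trees larger than
necessary. Therefore the hypothesis is required for all sizes. -/
theorem certB_of {t : Topology} {e : Barb} {k N K : ℕ} {D : List (ℕ × Tr)}
    (h : ∀ b, Certificate t e k N K D b) : certB t e k N K D = true := by
  simp only [certB, List.all_eq_true, List.mem_range, Bool.or_eq_true, Bool.not_eq_true']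
  intro m _
  by_cases hm : stateB t N K (Tr.dec m) = true
  · right
    intro j hj
    by_cases ha : aboveB t D (j, Tr.dec m) = true
    · exact .inl ha
    · right
      rw [Bool.eq_false_iff]
      intro hc
      refine ha (aboveB_iff.2 (h _ _ le_rfl (stateB_iff.1 hm) j (by omega) ?_))
      rw [Bool.or_eq_true, targetB_iff, List.any_eq_true] at hc
      rcases hc with hc | ⟨y, hy, hy'⟩
      · exact .inl hc
      · exact .inr ⟨y, mem_sysSucc.1 hy, aboveB_iff.1 hy'⟩
  · exact .inl (by simpa using hm)

@[fun_prop] theorem primrec_certB_of {t : Topology} {fe : α → Barb} {fk fN fK : α → ℕ}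
    {fD : α → List (ℕ × Tr)} (h1 : Primrec fe) (h2 : Primrec fk) (h3 : Primrec fN)
    (h4 : Primrec fK) (h5 : Primrec fD) :
    Primrec fun a => certB t (fe a) (fk a) (fN a) (fK a) (fD a) := by
  unfold certB certBound predBound; fun_prop

theorem rePred_exists {p : α → ℕ → Bool} (hp : Primrec fun x : α × ℕ => p x.1 x.2) :
    REPred fun a => ∃ n, p a n = true := by
  have h : Partrec fun a => Nat.rfind fun n => Part.some (p a n) :=
    Partrec.rfind (p := fun a n => Part.some (p a n)) (hp.to_comp.partrec)
  refine (h.dom_re).of_eq fun a =>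
    (Nat.rfind_dom (p := fun n => (Part.some (p a n) : Part Bool))).trans ?_
  constructor
  · rintro ⟨n, h, -⟩; exact ⟨n, (Part.mem_some_iff.1 h).symm⟩
  · rintro ⟨n, h⟩; exact ⟨n, Part.mem_some_iff.2 h.symm, fun _ => trivial⟩

/-- The initial state of the coverability problem for an instance. -/
def CoverInput (t : Topology) (x : ℕ × Barb × ℕ) : Prop :=
  Cover t x.2.1 x.2.2 x.1 (ofCode x.1).nloc (x.2.2 + 1, ofCode x.1)

/-- Post's theorem: reachable targets are found by enumeration, and unreachability is confirmed by
guessing a list of states that passes `certB` and does not lie below the initial state. No backward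
saturation has to be programmed. -/
theorem computablePred_coverInput (t : Topology) : ComputablePred (CoverInput t) := by
  classical
  refine ComputablePred.computable_iff_re_compl_re'.2 ⟨?_, ?_⟩
  · refine (rePred_exists (p := fun (x : ℕ × Barb × ℕ) n =>
      (reachList t x.2.1 x.2.2 x.1 (ofCode x.1).nloc (x.2.2 + 1, ofCode x.1) n).any
        fun y => targetB t x.2.1 y) (by fun_prop)).of_eq fun x => ?_
    simp only [List.any_eq_true, targetB_iff, CoverInput, Cover, ← exists_mem_reachList]
    constructor
    · rintro ⟨n, y, h, h'⟩; exact ⟨y, ⟨n, h⟩, h'⟩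
    · rintro ⟨y, ⟨n, h⟩, h'⟩; exact ⟨n, y, h, h'⟩
  · have hdec : Primrec fun n : ℕ => (Encodable.decode n : Option (List (ℕ × Tr))).getD [] :=
      Primrec.option_getD.comp Primrec.decode (Primrec.const [])
    have hdec' : ∀ {f : (ℕ × Barb × ℕ) × ℕ → ℕ}, Primrec f → Primrec fun a =>
      (Encodable.decode (f a) : Option (List (ℕ × Tr))).getD [] := fun hf => hdec.comp hf
    refine (rePred_exists (p := fun (x : ℕ × Barb × ℕ) n =>
      and (certB t x.2.1 x.2.2 x.1 (ofCode x.1).nloc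
        ((Encodable.decode n : Option (List (ℕ × Tr))).getD []))
        (not (aboveB t ((Encodable.decode n : Option (List (ℕ × Tr))).getD [])
          (x.2.2 + 1, ofCode x.1)))) ?_).of_eq fun x => ?_
    · have h := hdec' (f := fun p => p.2) (by fun_prop)
      fun_prop
    · have hx : State t x.1 (ofCode x.1).nloc (ofCode x.1) :=
        ⟨(ofCode_inCls_size _).1, fun _ => rfl⟩
      simp only [Bool.and_eq_true, Bool.not_eq_true', Bool.eq_false_iff, ne_eq, aboveB_iff]
      constructor
      · rintro ⟨n, h1, h2⟩ hc
        exact h2 ((certB_imp h1).sound hx le_rfl hc)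
      · intro h
        obtain ⟨D, h | h⟩ := exists_certificate h
        · refine ⟨Encodable.encode D, ?_⟩
          rw [Encodable.encodek]
          exact ⟨certB_of h.1, h.2⟩
        · exact (h hx).elim

end

/-! ## Bounded adaptation -/

/-- A phase `j ≤ k` records how many reductions between error states are still to come; the target
in phase `0` contributes the last of the `k + 1` error states. -/
theorem coverInput_iff {t : Topology} {P : Term} (hP : Good t P) (e : Barb) (k : ℕ) :
    CoverInput t (P.code, e, k) ↔ ¬ BoundedAdaptation t P e k := by
  rw [BoundedAdaptation, not_not]
  show Cover t e k P.code P.tr.nloc (k + 1, P.tr) ↔ _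
  generalize hK : P.tr.nloc = K
  have hcls : P.tr.InCls P.code := (ofCode_inCls_size _).1
  generalize P.code = N at hcls
  constructor
  · rintro ⟨y, h, hy⟩
    -- The two halves of the invariant: up to phase `k` the error states start at the current
    -- process, while in phase `k + 1` a computation may precede them.
    have key : ∀ x : ℕ × Tr, Relation.ReflTransGen (CStep t e k N K) x y → ∀ P : Term, Good t P →
        x.2 = P.tr → (x.1 ≤ k → ∃ Q : ℕ → Term, Q 0 = P ∧ (∀ i < x.1, Step t (Q i) (Q (i + 1))) ∧
            ∀ i ≤ x.1, HasBarb t (Q i) e) ∧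
          (x.1 = k + 1 → ∃ Q : ℕ → Term, Relation.ReflTransGen (Step t) P (Q 0) ∧
            (∀ i < k, Step t (Q i) (Q (i + 1))) ∧ ∀ i ≤ k, HasBarb t (Q i) e) := by
      intro x h
      induction h using Relation.ReflTransGen.head_induction_on with
      | refl =>
        intro P hP hx
        refine ⟨fun _ => ⟨fun _ => P, rfl, fun i hi => ?_, fun i hi => ?_⟩, fun h => ?_⟩
        · rw [hy.1] at hi; omega
        · rw [hasBarb_iff hP, ← hx]; exact hy.2
        · rw [hy.1] at h; omega
      | @head x z h _ ih =>
        intro P hP hx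
        rcases h.1 with ⟨h1, h2, h3⟩ | ⟨h1, h2⟩ | ⟨h1, h2, h3, h4⟩
        · refine ⟨fun h => by omega, fun _ => ?_⟩
          rw [hx] at h3
          obtain ⟨P', hs, hP'⟩ := tree_to_step hP h3
          obtain ⟨Q, q1, q2⟩ := (ih P' (step_to_tree hs hP).2.1 hP'.symm).2 h2
          exact ⟨Q, .head hs q1, q2⟩
        · refine ⟨fun h => by omega, fun _ => ?_⟩
          subst h2
          obtain ⟨Q, q1, q2, q3⟩ := (ih P hP hx).1 le_rfl
          exact ⟨Q, by rw [q1], q2, q3⟩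
        · refine ⟨fun h => ?_, fun h => by omega⟩
          rw [hx] at h3 h4
          obtain ⟨P', hs, hP'⟩ := tree_to_step hP h4
          obtain ⟨Q, q1, q2, q3⟩ := (ih P' (step_to_tree hs hP).2.1 hP'.symm).1 h2.le
          refine ⟨fun i => if i = 0 then P else Q (i - 1), rfl, fun i hi => ?_, fun i hi => ?_⟩
          · rcases Nat.eq_zero_or_pos i with rfl | hi0
            · simpa [q1] using hs
            · have := q2 (i - 1) (by omega)
              rw [Nat.sub_add_cancel hi0] at this
              simpa [hi0.ne'] using this
          · rcases Nat.eq_zero_or_pos i with rfl | hi0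
            · simpa [hasBarb_iff hP] using h3
            · simpa [hi0.ne'] using q3 (i - 1) (by omega)
    exact (key _ h P hP rfl).2 rfl
  · rintro ⟨Q, h, hs, hb⟩
    have hreach : ∀ {P R : Term}, Good t P → State t N K P.tr →
        Relation.ReflTransGen (Step t) P R → Good t R ∧ State t N K R.tr ∧
        Relation.ReflTransGen (CStep t e k N K) (k + 1, P.tr) (k + 1, R.tr) := by
      intro P R hP hst h
      induction h with
      | refl => exact ⟨hP, hst, .refl⟩
      | tail _ h ih =>
        obtain ⟨i1, i2, i3⟩ := ih
        obtain ⟨j1, j2, j3⟩ := step_to_tree h i1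
        have j4 : State t N K _ := ⟨j1.inCls i2.1, fun ht => (j3 ht).trans (i2.2 ht)⟩
        exact ⟨j2, j4, i3.tail ⟨.inl ⟨rfl, rfl, j1⟩, j4⟩⟩
    obtain ⟨h1, h2, h3⟩ := hreach hP ⟨hcls, fun _ => hK⟩ h
    have hmain : ∀ i ≤ k, Good t (Q i) ∧ State t N K (Q i).tr ∧
        Relation.ReflTransGen (CStep t e k N K) (k, (Q 0).tr) (k - i, (Q i).tr) := by
      intro i
      induction i with
      | zero => exact fun _ => ⟨h1, h2, .refl⟩
      | succ i ih =>
        intro hi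
        obtain ⟨i1, i2, i3⟩ := ih (by omega)
        obtain ⟨j1, j2, j3⟩ := step_to_tree (hs i (by omega)) i1
        have j4 : State t N K _ := ⟨j1.inCls i2.1, fun ht => (j3 ht).trans (i2.2 ht)⟩
        refine ⟨j2, j4, i3.tail ⟨.inr (.inr ⟨by simp only; omega, by simp only; omega,
          (hasBarb_iff i1 e).1 (hb i (by omega)), j1⟩), j4⟩⟩
    obtain ⟨i1, i2, i3⟩ := hmain k le_rfl
    rw [Nat.sub_self] at i3
    exact ⟨_, (h3.tail ⟨.inr (.inl ⟨rfl, rfl⟩), h2⟩).trans i3, rfl,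
      (hasBarb_iff i1 e).1 (hb k le_rfl)⟩

theorem good_of_mem_calculus {v : Variant} {t : Topology} {P : Term} (h : P ∈ calculus v t) :
    Good t P := by
  have key : ∀ {P : Term}, IsProc v P → IsProc .unguarded P := by
    intro P hP; cases v
    · exact hP
    · exact hP.toUnguarded
  cases t with
  | dynamic => exact ⟨key h, nofun⟩
  | static => exact ⟨key h.1, fun _ => h.2⟩

theorem boundedAdaptationDecidable (v : Variant) (t : Topology) :
    BoundedAdaptationDecidable v t := by
  obtain ⟨hd, hc⟩ := computablePred_coverInput t
  refine ⟨fun x => !decide (CoverInput t x), Primrec.not.to_comp.comp hc, ?_⟩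
  rintro ⟨P, e, k⟩ hP
  have := coverInput_iff (good_of_mem_calculus hP) e k
  simp only [Bool.not_eq_true', decide_eq_false_iff_not, this, not_not]

end Evol

-- Undecidability: counter programs for primitive recursive functions.

namespace Evol

/-! ## Counter programs -/

/-- Operations on counters.  The state of the counters is the multiset in which `i` occurs as often
as the value of counter `i` says. -/
inductive Op : Type
  | inc (i : ℕ)
  | dec (i : ℕ)
  | reset (i : ℕ)

/-- The counter an operation is about. -/
def Op.idx : Op → ℕ
  | inc i => i
  | dec i => i
  | reset i => i

/-- The exact semantics, in which `reset i` is a zero test. -/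
def Op.Exact : Op → Multiset ℕ → Multiset ℕ → Prop
  | inc i, s, s' => s' = i ::ₘ s
  | dec i, s, s' => s = i ::ₘ s'
  | reset i, s, s' => i ∉ s ∧ s' = s

/-- The execution of a sequence of operations. -/
def Run (R : Op → Multiset ℕ → Multiset ℕ → Prop) : List Op → Multiset ℕ → Multiset ℕ → Prop
  | [], s, s' => s' = s
  | o :: w, s, s' => ∃ t, R o s t ∧ Run R w t s'

theorem run_append {R : Op → Multiset ℕ → Multiset ℕ → Prop} {v w : List Op} {s s' : Multiset ℕ} :
    Run R (v ++ w) s s' ↔ ∃ t, Run R v s t ∧ Run R w t s' := by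
  induction v generalizing s with
  | nil => simp [Run]
  | cons o v ih =>
    simp only [List.cons_append, Run, ih]
    constructor
    · rintro ⟨t, h, t', h', h''⟩; exact ⟨t', ⟨t, h, h'⟩, h''⟩
    · rintro ⟨t', ⟨t, h, h'⟩, h''⟩; exact ⟨t, h, t', h', h''⟩

/-- Regular expressions over the operations, read as nondeterministic counter programs. -/
abbrev Prog : Type := RegularExpression Op

/-- The input/output relation of a program. -/
def Exec (P : Prog) (s s' : Multiset ℕ) : Prop := ∃ w ∈ P.matches', Run Op.Exact w s s'

theorem exec_one {s s' : Multiset ℕ} : Exec 1 s s' ↔ s' = s := by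
  simp [Exec, Language.mem_one, Run]

theorem exec_char {o : Op} {s s' : Multiset ℕ} : Exec (.char o) s s' ↔ o.Exact s s' := by
  constructor
  · rintro ⟨w, h, h'⟩
    obtain rfl : w = [o] := h
    obtain ⟨t, h, rfl⟩ := h'
    exact h
  · exact fun h => ⟨[o], rfl, s', h, rfl⟩

theorem exec_mul {P Q : Prog} {s s' : Multiset ℕ} :
    Exec (P * Q) s s' ↔ ∃ t, Exec P s t ∧ Exec Q t s' := by
  simp only [Exec, RegularExpression.matches'_mul, Language.mem_mul]
  constructor
  · rintro ⟨w, ⟨a, ha, b, hb, rfl⟩, h⟩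
    obtain ⟨t, h, h'⟩ := run_append.1 h
    exact ⟨t, ⟨a, ha, h⟩, b, hb, h'⟩
  · rintro ⟨t, ⟨a, ha, h⟩, b, hb, h'⟩
    exact ⟨_, ⟨a, ha, b, hb, rfl⟩, run_append.2 ⟨t, h, h'⟩⟩

theorem exec_star {P : Prog} {s s' : Multiset ℕ} :
    Exec P.star s s' ↔ Relation.ReflTransGen (Exec P) s s' := by
  constructor
  · rintro ⟨w, hw, h⟩
    obtain ⟨L, rfl, hL⟩ := Language.mem_kstar.1 (by simpa using hw)
    induction L generalizing s with
    | nil => obtain rfl : s' = s := h; exact .refl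
    | cons a L ih =>
      obtain ⟨t, h, h'⟩ := run_append.1 h
      have hL' : ∀ y ∈ L, y ∈ P.matches' := fun y hy => hL y (.tail _ hy)
      refine .head ⟨a, hL a (.head _), h⟩ (ih hL' ?_ h')
      rw [RegularExpression.matches'_star]
      exact Language.join_mem_kstar hL'
  · intro h
    induction h using Relation.ReflTransGen.head_induction_on with
    | refl => exact ⟨[], by simpa using Language.nil_mem_kstar _, rfl⟩
    | head h _ ih =>
      obtain ⟨a, ha, h⟩ := h
      obtain ⟨w, hw, h'⟩ := ih
      obtain ⟨L, rfl, hL⟩ := Language.mem_kstar.1 (by simpa using hw)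
      refine ⟨a ++ L.flatten, ?_, run_append.2 ⟨_, h, h'⟩⟩
      rw [RegularExpression.matches'_star]
      exact Language.mem_kstar.2 ⟨a :: L, by simp, by simpa using ⟨ha, hL⟩⟩

/-- Execute `P` as often as counter `i` can be decreased. -/
def loop (i : ℕ) (P : Prog) : Prog := (.char (.dec i) * P).star * .char (.reset i)

/-- Under the exact semantics the closing `reset i` is a zero test. So the iteration can be left
only when counter `i` is empty, and the nondeterministic star becomes a while loop. -/
theorem exec_loop {i : ℕ} {P : Prog} {s s' : Multiset ℕ} :
    Exec (loop i P) s s' ↔ (i ∉ s ∧ s' = s) ∨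
      ∃ t u, s = i ::ₘ t ∧ Exec P t u ∧ Exec (loop i P) u s' := by
  simp only [loop, exec_mul, exec_char, exec_star, Op.Exact]
  constructor
  · rintro ⟨t, h, h'⟩
    rcases h.cases_head with rfl | ⟨u, h, h''⟩
    · exact .inl h'
    · obtain ⟨v, h1, h2⟩ := exec_mul.1 h
      exact .inr ⟨v, u, exec_char.1 h1, h2, t, h'', h'⟩
  · rintro (h | ⟨t, u, h1, h2, v, h3, h4⟩)
    · exact ⟨s, .refl, h⟩
    · exact ⟨v, .head (exec_mul.2 ⟨t, exec_char.2 h1, h2⟩) h3, h4⟩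

theorem exec_loop_of_notMem {i : ℕ} {P : Prog} {s s' : Multiset ℕ} (h : i ∉ s) :
    Exec (loop i P) s s' ↔ s' = s := by
  rw [exec_loop]
  constructor
  · rintro (h | ⟨t, u, rfl, -⟩)
    · exact h.2
    · simp at h
  · exact fun h' => .inl ⟨h, h'⟩

theorem exec_loop_cons {i : ℕ} {P : Prog} {s t s' : Multiset ℕ}
    (h : ∀ u, Exec P s u ↔ u = t) : Exec (loop i P) (i ::ₘ s) s' ↔ Exec (loop i P) t s' := by
  rw [exec_loop]
  constructor
  · rintro (h' | ⟨t', u, h1, h2, h3⟩)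
    · simp at h'
    · obtain rfl := (Multiset.cons_inj_right i).1 h1
      rwa [(h u).1 h2] at h3
  · exact fun h' => .inr ⟨s, t, rfl, (h t).2 rfl, h'⟩

/-- Increase the counters in a list. -/
def incs : List ℕ → Prog
  | [] => 1
  | i :: L => .char (.inc i) * incs L

theorem exec_incs {L : List ℕ} {s s' : Multiset ℕ} : Exec (incs L) s s' ↔ s' = s + L := by
  induction L generalizing s with
  | nil => simp [incs, exec_one]
  | cons i L ih => simp [incs, exec_mul, exec_char, Op.Exact, ih, ← Multiset.cons_coe]

/-- Add counter `i` to all the counters in a list, and clear it. -/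
def move (i : ℕ) (L : List ℕ) : Prog := loop i (incs L)

theorem exec_move {i : ℕ} {L : List ℕ} (hi : i ∉ L) {s s' : Multiset ℕ} :
    Exec (move i L) s s' ↔ s' = s.filter (· ≠ i) + s.count i • (L : Multiset ℕ) := by
  obtain ⟨k, hk⟩ : ∃ k, s.count i = k := ⟨_, rfl⟩
  induction k generalizing s with
  | zero =>
    have h : i ∉ s := Multiset.count_eq_zero.1 hk
    have h' : s.filter (· ≠ i) = s :=
      Multiset.filter_eq_self.2 fun a ha => by rintro rfl; exact h ha
    rw [move, exec_loop_of_notMem h, hk, h']; simp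
  | succ k ih =>
    obtain ⟨t, rfl⟩ := Multiset.exists_cons_of_mem (Multiset.count_pos.1 (by omega : 0 < s.count i))
    have hL : (L : Multiset ℕ).count i = 0 := Multiset.count_eq_zero.2 (by simpa using hi)
    have hLf : (L : Multiset ℕ).filter (· ≠ i) = L :=
      Multiset.filter_eq_self.2 fun a ha => by rintro rfl; exact hi ha
    rw [Multiset.count_cons_self] at hk
    rw [move, exec_loop_cons (fun u => exec_incs), ← move, ih (by rw [Multiset.count_add, hL]; omega)]
    simp only [Multiset.filter_add, hLf, Multiset.count_add, hL, add_zero, Multiset.count_cons_self,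
      ne_eq, not_true_eq_false, not_false_eq_true, Multiset.filter_cons_of_neg, succ_nsmul]
    rw [add_assoc, add_comm (L : Multiset ℕ)]

/-- Add counter `i` to counter `o`, by means of the auxiliary counter `t`. -/
def copy (i o t : ℕ) : Prog := move i [t, o] * move t [i]

/-- The units of `i` are moved to both `t` and `o`, and those of `t` are moved back. This returns
the right amount because `t` is empty at the beginning. -/
theorem exec_copy {i o t : ℕ} (h1 : i ≠ o) (h2 : i ≠ t) (h3 : o ≠ t) {s s' : Multiset ℕ}
    (ht : t ∉ s) : Exec (copy i o t) s s' ↔ s' = s + .replicate (s.count i) o := by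
  have ht' : s.count t = 0 := Multiset.count_eq_zero.2 ht
  simp only [copy, exec_mul, exec_move (i := i) (L := [t, o]) (by simp [h1, h2]),
    exec_move (i := t) (L := [i]) (by simp [h2.symm]), exists_eq_left]
  refine Eq.congr rfl (Multiset.ext.2 fun a => ?_)
  simp only [Multiset.count_add, Multiset.count_filter, Multiset.count_nsmul, Multiset.coe_count,
    Multiset.count_replicate, List.count_cons, List.count_nil, beq_iff_eq]
  split_ifs <;> subst_vars <;> simp_all

open List.Vector in
/-- Every primitive recursive function is computed by a counter program: it adds the value to
counter `o`, and uses auxiliary counters from `m` on. -/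
theorem exists_program {n : ℕ} {f : List.Vector ℕ n → ℕ} (hf : Nat.Primrec' f) :
    ∀ (ρ : Fin n → ℕ) (o m : ℕ), (∀ i, ρ i < m) → o < m → (∀ i, ρ i ≠ o) →
      ∃ P : Prog, ∀ s s', (∀ j ∈ s, j < m) →
        (Exec P s s' ↔ s' = s + .replicate (f (ofFn fun i => s.count (ρ i))) o) := by
  induction hf with
  | zero => exact fun ρ o m _ _ _ => ⟨1, fun s s' _ => by simp [exec_one]⟩
  | succ =>
    intro ρ o m h1 h2 h3
    refine ⟨copy (ρ 0) o m * .char (.inc o), fun s s' hs => ?_⟩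
    have hm : m ∉ s := fun h => (hs m h).false
    simp only [exec_mul, exec_copy (h3 0) (h1 0).ne h2.ne hm, exec_char, Op.Exact, exists_eq_left]
    refine Eq.congr rfl ?_
    rw [← List.Vector.get_zero, List.Vector.get_ofFn, Nat.succ_eq_add_one, Multiset.replicate_succ,
      Multiset.add_cons]
  | get i =>
    intro ρ o m h1 h2 h3
    refine ⟨copy (ρ i) o m, fun s s' hs => ?_⟩
    have hm : m ∉ s := fun h => (hs m h).false
    rw [exec_copy (h3 i) (h1 i).ne h2.ne hm]
    exact Eq.congr rfl (by beta_reduce; rw [List.Vector.get_ofFn])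
  | @comp k n f g _ _ ihf ihg =>
    intro ρ o m h1 h2 h3
    -- The values of the inner functions are collected in counters `m`, …, `m + n - 1`.
    let g' : Multiset ℕ → ℕ → ℕ := fun s i =>
      if h : i < n then g ⟨i, h⟩ (ofFn fun i => s.count (ρ i)) else 0
    have key : ∀ j ≤ n, ∃ P : Prog, ∀ s s', (∀ j ∈ s, j < m) → (Exec P s s' ↔
        s' = s + ∑ i ∈ Finset.range j, Multiset.replicate (g' s i) (m + i)) := by
      intro j
      induction j with
      | zero => exact fun _ => ⟨1, fun s s' _ => by simp [exec_one]⟩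
      | succ j ih =>
        intro hj
        obtain ⟨P, hP⟩ := ih (by omega)
        obtain ⟨Q, hQ⟩ := ihg ⟨j, hj⟩ ρ (m + j) (m + n) (fun i => by have := h1 i; omega)
          (by omega) (fun i => by have := h1 i; omega)
        refine ⟨P * Q, fun s s' hs => ?_⟩
        simp only [exec_mul, hP _ _ hs, exists_eq_left]
        rw [hQ]
        · have : ∀ i, (s + ∑ i ∈ Finset.range j, Multiset.replicate (g' s i) (m + i)).count (ρ i)
              = s.count (ρ i) := by
            intro i
            rw [Multiset.count_add, Multiset.count_sum', Finset.sum_eq_zero, add_zero]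
            intro l hl
            have := h1 i
            rw [Multiset.count_replicate, if_neg (by omega)]
          simp only [this]
          rw [Finset.sum_range_succ, add_assoc]
          simp [g', show j < n from hj]
        · intro l hl
          rcases Multiset.mem_add.1 hl with hl | hl
          · have := hs l hl; omega
          · obtain ⟨i, hi, hl⟩ := Multiset.mem_sum.1 hl
            have := Multiset.eq_of_mem_replicate hl
            have := Finset.mem_range.1 hi
            omega
    obtain ⟨P, hP⟩ := key n le_rfl
    obtain ⟨Q, hQ⟩ := ihf (fun i => m + i) o (m + n) (fun i => by omega) (by omega)
      (fun i => by omega)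
    -- The intermediate values have to be erased, as the specification leaves all counters but `o`
    -- unchanged.
    have clear : ∀ j, ∃ R : Prog, ∀ (s s' : Multiset ℕ), (Exec R s s' ↔
        s' = s.filter (fun l => ¬ (m ≤ l ∧ l < m + j))) := by
      intro j
      induction j with
      | zero =>
        refine ⟨1, fun s s' => ?_⟩
        rw [exec_one, Multiset.filter_eq_self.2]; intro a _; omega
      | succ j ih =>
        obtain ⟨R, hR⟩ := ih
        refine ⟨R * move (m + j) [], fun s s' => ?_⟩
        simp only [exec_mul, hR, exists_eq_left, exec_move (List.not_mem_nil), Multiset.coe_nil,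
          smul_zero, add_zero, Multiset.filter_filter]
        refine Eq.congr rfl (Multiset.filter_congr fun a _ => ?_)
        omega
    obtain ⟨R, hR⟩ := clear n
    refine ⟨P * Q * R, fun s s' hs => ?_⟩
    simp only [exec_mul, hP _ _ hs, exists_eq_left, hR]
    have h4 : ∀ i : Fin n, (s + ∑ i ∈ Finset.range n, Multiset.replicate (g' s i) (m + i)).count
        (m + i) = g i (ofFn fun i => s.count (ρ i)) := by
      intro i
      have : (m + (i : ℕ)) ∉ s := fun h => by have := hs _ h; omega
      rw [Multiset.count_add, Multiset.count_eq_zero.2 this, zero_add, Multiset.count_sum',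
        Finset.sum_eq_single (i : ℕ)]
      · simp [g']
      · intro b _ hb; rw [Multiset.count_replicate, if_neg (by omega)]
      · intro hi; simp at hi
    simp only [hQ _ _ (show ∀ l ∈ s + ∑ i ∈ Finset.range n,
        Multiset.replicate (g' s i) (m + i), l < m + n by
      intro l hl
      rcases Multiset.mem_add.1 hl with hl | hl
      · have := hs l hl; omega
      · obtain ⟨i, hi, hl⟩ := Multiset.mem_sum.1 hl
        have := Multiset.eq_of_mem_replicate hl
        have := Finset.mem_range.1 hi
        omega), h4, exists_eq_left]
    refine Eq.congr rfl ?_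
    rw [Multiset.filter_add, Multiset.filter_add, Multiset.filter_eq_self.2, Multiset.filter_eq_nil.2,
      Multiset.filter_eq_self.2, add_zero]
    · intro a ha
      have := Multiset.eq_of_mem_replicate ha; omega
    · intro l hl
      obtain ⟨i, hi, hl⟩ := Multiset.mem_sum.1 hl
      have := Multiset.eq_of_mem_replicate hl
      have := Finset.mem_range.1 hi
      omega
    · intro l hl; have := hs l hl; omega
  | @prec n f g _ _ ihf ihg =>
    intro ρ o m h1 h2 h3
    -- Counter `m` holds the accumulator, `m + 1` the number of remaining rounds, `m + 2` the index
    -- of the current round, and `m + 3` the next value of the accumulator.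
    obtain ⟨F, hF⟩ := ihf (fun i => ρ i.succ) m (m + 4) (fun i => by have := h1 i.succ; omega)
      (by omega) (fun i => by have := h1 i.succ; omega)
    obtain ⟨Gp, hG⟩ := ihg (Fin.cons (m + 2) (Fin.cons m fun i => ρ i.succ)) (m + 3) (m + 4)
      (by
        refine Fin.cases (by simp) (Fin.cases (by simp) fun i => ?_)
        have := h1 i.succ; simp; omega)
      (by omega)
      (by
        refine Fin.cases (by simp) (Fin.cases (by simp) fun i => ?_)
        have := h1 i.succ; simp; omega)
    refine ⟨copy (ρ 0) (m + 1) (m + 2) * F *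
      loop (m + 1) (Gp * move m [] * move (m + 3) [m] * .char (.inc (m + 2))) *
      move m [o] * move (m + 2) [], fun s s' hs => ?_⟩
    have hms : ∀ l, m ≤ l → s.count l = 0 := fun l hl =>
      Multiset.count_eq_zero.2 fun h => by have := hs l h; omega
    have h0 := h1 0
    let V : List.Vector ℕ n := ofFn fun i => s.count (ρ i.succ)
    let A : ℕ → ℕ := fun i => Nat.rec (f V) (fun y IH => g (y ::ᵥ IH ::ᵥ V)) i
    -- The loop invariant: the state after `i` rounds with `j` rounds to go.
    let σ : ℕ → ℕ → Multiset ℕ := fun j i => s + .replicate (A i) m + .replicate j (m + 1) +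
      .replicate i (m + 2)
    have hσ : ∀ j i l, (σ j i).count l = s.count l + (if l = m then A i else 0) +
        (if l = m + 1 then j else 0) + (if l = m + 2 then i else 0) := by
      intro j i l
      simp only [σ, Multiset.count_add, Multiset.count_replicate, eq_comm]
    have hσb : ∀ j i, ∀ l ∈ σ j i, l < m + 4 := by
      intro j i l hl
      by_contra hc
      have := Multiset.count_pos.2 hl
      rw [hσ, hms l (by omega), if_neg (by omega), if_neg (by omega), if_neg (by omega)] at this
      omega
    have hbody : ∀ j i u, Exec (Gp * move m [] * move (m + 3) [m] * .char (.inc (m + 2))) (σ j i) u ↔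
        u = σ j (i + 1) := by
      intro j i u
      simp only [exec_mul, hG _ _ (hσb j i), exists_eq_left, exec_move (List.not_mem_nil),
        exec_move (i := m + 3) (L := [m]) (by simp), exec_char, Op.Exact]
      refine Eq.congr rfl ?_
      have hA : g (ofFn fun l => (σ j i).count
          ((Fin.cons (m + 2) (Fin.cons m fun i => ρ i.succ) : Fin (n + 2) → ℕ) l)) = A (i + 1) := by
        simp only [A, V]
        congr 1
        rw [List.Vector.ofFn]
        simp only [Fin.cons_zero, Fin.cons_succ]
        rw [List.Vector.ofFn]
        simp only [Fin.cons_zero, Fin.cons_succ, hσ, hms m le_rfl, hms (m + 2) (by omega)]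
        congr 1
        · simp
        · congr 1
          · simp [A, V]
          · congr 1
            funext l
            have := h1 l.succ
            rw [if_neg (by omega), if_neg (by omega), if_neg (by omega)]
            simp
      rw [hA]
      refine Multiset.ext.2 fun l => ?_
      simp only [Multiset.count_cons, Multiset.count_add, Multiset.count_filter, hσ,
        Multiset.count_nsmul, Multiset.coe_count, Multiset.count_replicate, List.count_cons,
        List.count_nil, beq_iff_eq]
      clear_value A
      rcases show l = m ∨ l = m + 1 ∨ l = m + 2 ∨ l = m + 3 ∨
        (l ≠ m ∧ l ≠ m + 1 ∧ l ≠ m + 2 ∧ l ≠ m + 3) by omega with h | h | h | h | ⟨h, h', h'', h'''⟩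
      · simp [h, hms]
      · simp [h, hms]
      · simp [h, hms]
      · simp [h, hms]
      · simp [h, h', h'', h''', h.symm, h'''.symm]
    have hloop : ∀ j i u, Exec (loop (m + 1) (Gp * move m [] * move (m + 3) [m] *
        .char (.inc (m + 2)))) (σ j i) u ↔ u = σ 0 (i + j) := by
      intro j
      induction j with
      | zero =>
        intro i u
        rw [exec_loop_of_notMem]
        · rfl
        · rw [← Multiset.count_eq_zero, hσ, hms _ (by omega)]; simp
      | succ j ih =>
        intro i u
        have : σ (j + 1) i = (m + 1) ::ₘ σ j i := by
          refine Multiset.ext.2 fun l => ?_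
          rw [Multiset.count_cons, hσ, hσ]; split_ifs <;> omega
        rw [this, exec_loop_cons (hbody j i)]
        exact (ih (i + 1) u).trans (by rw [add_assoc, add_comm 1])
    have hcopy := fun s' => @exec_copy (ρ 0) (m + 1) (m + 2) (by omega) (by omega) (by omega) s s'
      (Multiset.count_eq_zero.1 (hms _ (by omega)))
    have hstart : ∀ k, s + .replicate k (m + 1) +
        .replicate (f (ofFn fun i => (s + .replicate k (m + 1)).count (ρ i.succ))) m = σ k 0 := by
      intro k
      have : (ofFn fun i : Fin n => (s + .replicate k (m + 1)).count (ρ i.succ)) = V := by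
        simp only [V]; congr 1; funext i
        have := h1 i.succ
        rw [Multiset.count_add, Multiset.count_replicate, if_neg (by omega), add_zero]
      rw [this]
      refine Multiset.ext.2 fun l => ?_
      rw [hσ, show A 0 = f V from rfl]
      simp only [Multiset.count_add, Multiset.count_replicate]
      split_ifs <;> omega
    simp only [exec_mul, exists_eq_left, hcopy]
    rw [show (List.Vector.ofFn fun i => s.count (ρ i)) = s.count (ρ 0) ::ᵥ V from rfl]
    simp only [List.Vector.head_cons, List.Vector.tail_cons]
    have hb : ∀ l ∈ s + .replicate (s.count (ρ 0)) (m + 1), l < m + 4 := by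
      intro l hl
      rcases Multiset.mem_add.1 hl with hl | hl
      · have := hs l hl; omega
      · have := Multiset.eq_of_mem_replicate hl; omega
    simp only [hF _ _ hb, exists_eq_left, hstart, hloop, exec_move (List.not_mem_nil),
      exec_move (i := m) (L := [o]) (by simp; omega)]
    refine Eq.congr rfl (Multiset.ext.2 fun l => ?_)
    simp only [Multiset.count_add, Multiset.count_filter, hσ, Multiset.count_nsmul,
      Multiset.coe_count, Multiset.count_replicate, List.count_cons, List.count_nil, beq_iff_eq,
      zero_add]
    have hAk : A (s.count (ρ 0)) = Nat.rec (f V) (fun y IH => g (y ::ᵥ IH ::ᵥ V)) (s.count (ρ 0)) :=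
      rfl
    rw [← hAk]
    generalize A (s.count (ρ 0)) = a
    generalize s.count (ρ 0) = b
    have e1 : o ≠ m + 2 := by omega
    rcases show l = m ∨ l = m + 1 ∨ l = m + 2 ∨
      (l ≠ m ∧ l ≠ m + 1 ∧ l ≠ m + 2) by omega with h | h | h | ⟨h, h', h''⟩
    · simp [h, hms, e1, h2.ne]
    · simp [h, hms, e1, show o ≠ m + 1 by omega]
    · simp [h, hms, e1]
    · simp [h, h', h'', hms, e1]

end Evol

-- Undecidability: programs as regular languages.

namespace Evol

open scoped Computability

/-! ## Regular languages -/

theorem isRegular_of_finite {α : Type} {L : Language α} (S : Set (Language α)) (hS : S.Finite)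
    (h : ∀ x, L.leftQuotient x ∈ S) : L.IsRegular :=
  .of_finite_range_leftQuotient (hS.subset (Set.range_subset_iff.2 h))

/-- Myhill–Nerode: the quotient of `L * M` by `x` is the union of `(L / x) * M` and the quotients `M
/ v` over the factorizations `x = u ++ v` with `u ∈ L`. It is determined by one quotient of `L` and
a set of quotients of `M`. -/
theorem isRegular_mul {α : Type} {L M : Language α} (hL : L.IsRegular) (hM : M.IsRegular) :
    (L * M).IsRegular := by
  have h1 := hL.finite_range_leftQuotient
  have h2 := hM.finite_range_leftQuotient
  refine isRegular_of_finite _ ((h1.prod h2.finite_subsets).image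
    fun p : Language α × Set (Language α) => (p.1 * M ⊔ (⋃₀ p.2 : Set (List α)) : Language α)) fun x => ?_
  refine ⟨(L.leftQuotient x, {N | ∃ u v, x = u ++ v ∧ u ∈ L ∧ N = M.leftQuotient v}), ⟨⟨x, rfl⟩, ?_⟩,
    Set.ext fun y => ?_⟩
  · rintro _ ⟨u, v, -, -, rfl⟩; exact ⟨v, rfl⟩
  · change (y ∈ L.leftQuotient x * M ∨ _) ↔ x ++ y ∈ L * M
    simp only [Language.mem_mul, Language.mem_leftQuotient]
    constructor
    · rintro (⟨a, ha, b, hb, rfl⟩ | ⟨_, ⟨u, v, rfl, hu, rfl⟩, hy⟩)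
      · exact ⟨x ++ a, ha, b, hb, by simp⟩
      · exact ⟨u, hu, v ++ y, hy, by simp⟩
    · rintro ⟨a, ha, b, hb, h⟩
      rcases List.append_eq_append_iff.1 h with ⟨c, rfl, rfl⟩ | ⟨c, rfl, rfl⟩
      · exact .inr ⟨_, ⟨a, c, rfl, ha, rfl⟩, hb⟩
      · exact .inl ⟨c, ha, b, hb, rfl⟩

/-- A continuation of `x` in `L∗` completes a factor begun in `x`. So the quotient by `x` is
determined by whether `x` is empty and by the set of the quotients `L / v` with `x = u ++ v` and `u
∈ L∗`. -/
theorem isRegular_kstar {α : Type} {L : Language α} (hL : L.IsRegular) :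
    (KStar.kstar L).IsRegular := by
  have h1 := hL.finite_range_leftQuotient
  refine isRegular_of_finite _ (((Set.finite_univ (α := Prop)).prod h1.finite_subsets).image
    fun p : Prop × Set (Language α) =>
      ({y | (p.1 ∧ y = []) ∨ ∃ N ∈ p.2, y ∈ N * L∗} : Language α)) fun x => ?_
  refine ⟨(x = [], {N | ∃ u v, x = u ++ v ∧ u ∈ L∗ ∧ N = L.leftQuotient v}), ⟨trivial, ?_⟩,
    Set.ext fun y => ?_⟩
  · rintro _ ⟨u, v, -, -, rfl⟩; exact ⟨v, rfl⟩
  · change ((x = [] ∧ y = []) ∨ _) ↔ x ++ y ∈ L∗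
    constructor
    · rintro (⟨rfl, rfl⟩ | ⟨_, ⟨u, v, rfl, hu, rfl⟩, hy⟩)
      · exact Language.nil_mem_kstar _
      · obtain ⟨a, ha, b, hb, rfl⟩ := Language.mem_mul.1 hy
        obtain ⟨S, rfl, hS⟩ := Language.mem_kstar.1 hu
        obtain ⟨T, rfl, hT⟩ := Language.mem_kstar.1 hb
        refine Language.mem_kstar.2 ⟨S ++ (v ++ a) :: T, by simp, fun z hz => ?_⟩
        rcases List.mem_append.1 hz with hz | hz
        · exact hS z hz
        · rcases List.mem_cons.1 hz with rfl | hz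
          · exact ha
          · exact hT z hz
    · intro h
      obtain ⟨S, h, hS⟩ := Language.mem_kstar.1 h
      induction S generalizing x with
      | nil => exact .inl (by simpa using h)
      | cons a S ih =>
        have hS' : ∀ y ∈ S, y ∈ L := fun y hy => hS y (.tail _ hy)
        have ha : a ∈ L := hS a (.head _)
        rw [List.flatten_cons] at h
        rcases List.append_eq_append_iff.1 h with ⟨c, rfl, rfl⟩ | ⟨c, rfl, hc⟩
        · exact .inr ⟨_, ⟨[], x, rfl, Language.nil_mem_kstar _, rfl⟩,
            Language.append_mem_mul ha (Language.join_mem_kstar hS')⟩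
        · rcases ih c (hc ▸ Language.join_mem_kstar hS') hc.symm hS' with
            ⟨rfl, rfl⟩ | ⟨_, ⟨u, v, rfl, hu, rfl⟩, hy⟩
          · exact .inr ⟨_, ⟨[], a, by simp, Language.nil_mem_kstar _, rfl⟩, [],
              by change a ++ [] ∈ L; rwa [List.append_nil], [],
              Language.nil_mem_kstar _, rfl⟩
          · refine .inr ⟨_, ⟨a ++ u, v, by simp, ?_, rfl⟩, hy⟩
            obtain ⟨T, rfl, hT⟩ := Language.mem_kstar.1 hu
            exact Language.mem_kstar.2 ⟨a :: T, by simp, by simpa using ⟨ha, hT⟩⟩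

theorem isRegular_matches' {α : Type} (P : RegularExpression α) : P.matches'.IsRegular := by
  induction P with
  | zero => exact isRegular_of_finite {0} (Set.finite_singleton _) fun x => rfl
  | epsilon =>
    refine isRegular_of_finite {1, 0} (by simp) fun x => ?_
    cases x with
    | nil => exact .inl rfl
    | cons a x => exact .inr (Set.ext fun y => iff_of_false (by rintro ⟨⟩) (by rintro ⟨⟩))
  | char a =>
    refine isRegular_of_finite {{[a]}, 1, 0} (by simp) fun x => ?_
    rcases x with - | ⟨b, - | ⟨c, x⟩⟩
    · exact .inl rfl
    · by_cases h : b = a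
      · subst h
        exact .inr (.inl (Set.ext fun y => by
          change [b] ++ y = [b] ↔ y = []
          simp))
      · exact .inr (.inr (Set.ext fun y => iff_of_false
          (fun h' => h (List.cons.inj (show [b] ++ y = [a] from h')).1) (by rintro ⟨⟩)))
    · exact .inr (.inr (Set.ext fun y => iff_of_false
        (fun h' => by simpa using (show (b :: c :: x) ++ y = [a] from h')) (by rintro ⟨⟩)))
  | plus P Q hP hQ => exact hP.add hQ
  | comp P Q hP hQ => exact isRegular_mul hP hQ
  | star P hP => exact isRegular_kstar hP

theorem exists_idx_lt (P : Prog) : ∃ m, ∀ w ∈ P.matches', ∀ o ∈ w, o.idx < m := by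
  induction P with
  | zero => exact ⟨0, fun w hw => hw.elim⟩
  | epsilon => exact ⟨0, fun w hw => by rw [show w = [] from hw]; simp⟩
  | char a => exact ⟨a.idx + 1, fun w hw => by rw [show w = [a] from hw]; simp⟩
  | plus P Q hP hQ =>
    obtain ⟨m, hm⟩ := hP
    obtain ⟨n, hn⟩ := hQ
    refine ⟨m + n, ?_⟩
    rintro w (hw | hw) o ho
    · have := hm w hw o ho; omega
    · have := hn w hw o ho; omega
  | comp P Q hP hQ =>
    obtain ⟨m, hm⟩ := hP
    obtain ⟨n, hn⟩ := hQ
    refine ⟨m + n, ?_⟩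
    rintro w hw o ho
    obtain ⟨a, ha, b, hb, rfl⟩ := Language.mem_mul.1 hw
    rcases List.mem_append.1 ho with ho | ho
    · have := hm a ha o ho; omega
    · have := hn b hb o ho; omega
  | star P hP =>
    obtain ⟨m, hm⟩ := hP
    refine ⟨m, ?_⟩
    rintro w hw o ho
    obtain ⟨L, rfl, hL⟩ := Language.mem_kstar.1 hw
    obtain ⟨a, ha, ho⟩ := List.mem_flatten.1 ho
    exact hm a (hL a ha) o ho

/-! ## An undecidable problem for counters -/

/-- The second argument is a bound for the evaluation of the program with number `n` at input `0`;
zero signals that a result was found within it. -/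
theorem exists_undecidable : ∃ f : List.Vector ℕ 2 → ℕ, Nat.Primrec' f ∧
    ¬ ComputablePred fun n : ℕ => ∃ k, f (n ::ᵥ k ::ᵥ .nil) = 0 := by
  refine ⟨fun v => if (Nat.Partrec.Code.evaln v.tail.head
    (Denumerable.ofNat Nat.Partrec.Code v.head) 0).isSome then 0 else 1, ?_, fun h => ?_⟩
  · apply Nat.Primrec'.of_prim
    refine Primrec.ite (Primrec.eq.comp (Primrec.option_isSome.comp
      (Nat.Partrec.Code.primrec_evaln.comp ((Primrec.pair (Primrec.pair
        (Primrec.vector_head.comp Primrec.vector_tail)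
        ((Primrec.ofNat _).comp Primrec.vector_head)) (Primrec.const 0)))))
      (Primrec.const true)) (Primrec.const 0) (Primrec.const 1)
  · refine ComputablePred.halting_problem 0 ?_
    refine ComputablePred.of_eq (ComputablePred.computable_iff.2 ?_)
      (p := fun c : Nat.Partrec.Code => ∃ k, (Nat.Partrec.Code.evaln k c 0).isSome) fun c => ?_
    · obtain ⟨g, hg, h⟩ := ComputablePred.computable_iff.1 h
      refine ⟨fun c => g (Encodable.encode c), hg.comp Computable.encode, ?_⟩
      funext c
      rw [← congrFun h]
      simp [Option.isSome_iff_ne_none]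
    · simp only [Option.isSome_iff_exists, Part.dom_iff_mem]
      exact ⟨fun ⟨k, a, h⟩ => ⟨a, Nat.Partrec.Code.evaln_complete.2 ⟨k, h⟩⟩,
        fun ⟨a, h⟩ => (Nat.Partrec.Code.evaln_complete.1 h).imp fun k h => ⟨a, h⟩⟩

/-- The program guesses `k` in counter `1`, computes the value in counter `2`, tests it for zero and
clears the input and the guess. Ending with empty counters matters: this is what the reset machine
can recognize. -/
theorem exists_undecidable_language : ∃ (L : Language Op) (m : ℕ), L.IsRegular ∧ 0 < m ∧
    (∀ w ∈ L, ∀ o ∈ w, o.idx < m) ∧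
    ¬ ComputablePred fun n : ℕ => ∃ w ∈ L, Run Op.Exact w (.replicate n 0) 0 := by
  obtain ⟨f, hf, h⟩ := exists_undecidable
  -- The arguments are in counters `0` and `1`, the value goes to `2`, and auxiliary counters start
  -- at `3`.
  obtain ⟨P, hP⟩ := exists_program hf (fun i => i) 2 3 (fun i => by omega) (by omega)
    (fun i => by omega)
  let Q : Prog := .star (.char (.inc 1)) * P * .char (.reset 2) * move 0 [] * move 1 []
  obtain ⟨m, hm⟩ := exists_idx_lt Q
  refine ⟨Q.matches', m + 1, isRegular_matches' _, by omega,
    fun w hw o ho => (hm w hw o ho).trans (by omega), fun hc => h (hc.of_eq fun n => ?_)⟩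
  change Exec Q _ _ ↔ _
  have h1 : ∀ s t, Exec (.star (.char (.inc 1))) s t ↔ ∃ k, t = s + .replicate k 1 := by
    intro s t
    rw [exec_star]
    constructor
    · intro h
      induction h with
      | refl => exact ⟨0, by simp⟩
      | tail _ h ih =>
        obtain ⟨k, rfl⟩ := ih
        exact ⟨k + 1, by rw [exec_char.1 h, Multiset.replicate_succ, Multiset.add_cons]⟩
    · rintro ⟨k, rfl⟩
      induction k with
      | zero => simpa using Relation.ReflTransGen.refl
      | succ k ih =>
        refine ih.tail (exec_char.2 ?_)
        change _ = _
        rw [Multiset.replicate_succ, Multiset.add_cons]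
  have h2 : ∀ k s', Exec P (.replicate n 0 + .replicate k 1) s' ↔
      s' = .replicate n 0 + .replicate k 1 + .replicate (f (n ::ᵥ k ::ᵥ .nil)) 2 := by
    intro k s'
    rw [hP]
    · have : (List.Vector.ofFn fun i : Fin 2 =>
          ((.replicate n 0 + .replicate k 1 : Multiset ℕ)).count (i : ℕ)) = n ::ᵥ k ::ᵥ .nil := by
        simp [List.Vector.ofFn, Multiset.count_replicate]
      rw [this]
    · intro j hj
      rcases Multiset.mem_add.1 hj with hj | hj <;>
      · have := Multiset.eq_of_mem_replicate hj; omega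
  simp only [Q, exec_mul, h1, exec_char, Op.Exact, exec_move (List.not_mem_nil)]
  constructor
  · rintro ⟨_, ⟨_, ⟨_, ⟨_, ⟨k, rfl⟩, h⟩, h', rfl⟩, rfl⟩, -⟩
    refine ⟨k, ?_⟩
    rw [(h2 k _).1 h] at h'
    by_contra hf
    exact h' (Multiset.mem_add.2 (.inr (Multiset.mem_replicate.2 ⟨hf, rfl⟩)))
  · rintro ⟨k, hk⟩
    refine ⟨_, ⟨_, ⟨_, ⟨_, ⟨k, rfl⟩, (h2 k _).2 rfl⟩, ?_, rfl⟩, rfl⟩, ?_⟩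
    · simp [hk, Multiset.mem_replicate]
    · refine Multiset.ext.2 fun a => ?_
      simp [hk, Multiset.count_filter, Multiset.count_replicate]
      split_ifs <;> omega

end Evol

-- Undecidability: termination of machines that conserve their resources.

namespace Evol

/-! ## Reset machines -/

/-- The lossy semantics of the operations, in which `reset i` clears counter `i`. -/
def Op.Act : Op → Multiset ℕ → Multiset ℕ → Prop
  | inc i, s, s' => s' = i ::ₘ s
  | dec i, s, s' => s = i ::ₘ s'
  | reset i, s, s' => s' = s.filter (· ≠ i)

/-- The change of the total of the counters under the exact semantics. -/
def Op.wt : Op → ℤ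
  | inc _ => 1
  | dec _ => -1
  | reset _ => 0

theorem Op.Exact.act {o : Op} {s s' : Multiset ℕ} (h : o.Exact s s') : o.Act s s' := by
  cases o with
  | inc i => exact h
  | dec i => exact h
  | reset i =>
    obtain ⟨h, rfl⟩ := h
    exact (Multiset.filter_eq_self.2 fun a ha => by rintro rfl; exact h ha).symm

/-- The only deviation from the exact semantics is the reset of a nonzero counter, and it destroys
units. So every wrong zero test is visible as a loss in the total. -/
theorem Op.Act.exact_or {o : Op} {s s' : Multiset ℕ} (h : o.Act s s') :
    (s'.card : ℤ) < s.card + o.wt ∨ (o.Exact s s' ∧ (s'.card : ℤ) = s.card + o.wt) := by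
  cases o with
  | inc i => exact .inr ⟨h, by rw [show s' = i ::ₘ s from h]; simp [wt]⟩
  | dec i => exact .inr ⟨h, by rw [show s = i ::ₘ s' from h]; simp [wt]⟩
  | reset i =>
    obtain rfl : s' = _ := h
    by_cases hi : i ∈ s
    · left
      have : s.filter (· ≠ i) < s := lt_of_le_of_ne (Multiset.filter_le _ _) fun h => by
        rw [← h] at hi; simp at hi
      have := Multiset.card_lt_card this
      simp only [wt]; omega
    · have h : s.filter (· ≠ i) = s :=
        Multiset.filter_eq_self.2 fun a ha => by rintro rfl; exact hi ha
      rw [h]; exact .inr ⟨⟨hi, rfl⟩, by simp [wt]⟩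

theorem run_exact_or {w : List Op} {s s' : Multiset ℕ} (h : Run Op.Act w s s') :
    (s'.card : ℤ) < s.card + (w.map Op.wt).sum ∨
      (Run Op.Exact w s s' ∧ (s'.card : ℤ) = s.card + (w.map Op.wt).sum) := by
  induction w generalizing s with
  | nil => exact .inr ⟨h, by rw [show s' = s from h]; simp⟩
  | cons o w ih =>
    obtain ⟨t, h, h'⟩ := h
    rw [List.map_cons, List.sum_cons]
    rcases h.exact_or with h1 | ⟨h1, h2⟩ <;> rcases ih h' with h3 | ⟨h3, h4⟩
    · left; omega
    · left; omega
    · left; omega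
    · exact .inr ⟨⟨t, h1, h3⟩, by omega⟩

/-- The rule `(q, w, q')` leads from the control state `q` to `q'` by execution of `w`. -/
abbrev Rule : Type := ℕ × List Op × ℕ

/-- The steps of a machine with a given list of rules. -/
def MStep (R : List Rule) (x y : ℕ × Multiset ℕ) : Prop :=
  ∃ w, (x.1, w, y.1) ∈ R ∧ Run Op.Act w x.2 y.2

/-- The implementation of an operation of a program: counter `0` is a pool of resources, counter `1`
collects the waste. -/
def Op.instr : Op → List Op
  | inc i => [dec 0, inc 1, dec 0, inc (i + 2)]
  | dec i => [dec 0, inc 1, dec (i + 2), inc 0]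
  | reset i => [dec 0, inc 1, reset (i + 2)]

/-- Move `n` units from the pool to the input register. -/
def load : ℕ → List Op
  | 0 => []
  | n + 1 => .dec 0 :: .inc 2 :: load n

/-- Clear the registers. -/
def resets (m : ℕ) : List Op := (List.range m).map fun i => .reset (i + 2)

/-- The operations on the first `m` counters. -/
def opsBelow (m : ℕ) : List Op :=
  (List.range m).flatMap fun i => [.inc i, .dec i, .reset i]

theorem mem_opsBelow {m : ℕ} {o : Op} : o ∈ opsBelow m ↔ o.idx < m := by
  cases o <;> simp [opsBelow, Op.idx]

section

variable {σ : Type} [Fintype σ] (M : DFA Op σ) (m : ℕ)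

/-- The control state for a state of the automaton. -/
noncomputable def ctlState (j : σ) : ℕ := Fintype.equivFin σ j + 3

theorem ctlState_inj {j j' : σ} (h : ctlState j = ctlState j') : j = j' := by
  unfold ctlState at h
  exact (Fintype.equivFin σ).injective (Fin.ext (by omega))

open Classical in
/-- The rules which do not depend on the input. -/
noncomputable def machineRules : List Rule :=
  [(2, [.dec 1, .inc 0], 2), (2, [], 1)] ++
    (Finset.univ : Finset σ).toList.flatMap (fun j =>
      (opsBelow m).map fun o => (ctlState j, o.instr, ctlState (M.step j o))) ++
    ((Finset.univ : Finset σ).toList.filter (· ∈ M.accept)).map fun j => (ctlState j, [], 2)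

/-- The rules for the input `n`. -/
noncomputable def machine (n : ℕ) : List Rule :=
  (1, resets m ++ load n, ctlState M.start) :: machineRules M m

theorem mem_machine {n : ℕ} {r : Rule} : r ∈ machine M m n ↔
    r = (1, resets m ++ load n, ctlState M.start) ∨ r = (2, [.dec 1, .inc 0], 2) ∨
    r = (2, [], 1) ∨ (∃ j o, o.idx < m ∧ r = (ctlState j, o.instr, ctlState (M.step j o))) ∨
    ∃ j ∈ M.accept, r = (ctlState j, [], 2) := by
  simp only [machine, machineRules, List.mem_cons, List.mem_append, List.mem_flatMap,
    Finset.mem_toList, Finset.mem_univ, true_and, List.mem_map, mem_opsBelow, List.mem_filter,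
    decide_eq_true_eq, List.not_mem_nil, or_false, eq_comm (b := r), or_assoc]

/-- The contents of the registers. -/
def regs (s : Multiset ℕ) : Multiset ℕ := (s.filter fun i => 2 ≤ i ∧ i < m + 2).map (· - 2)

variable {m}

theorem regs_cons_low {i : ℕ} (hi : i < 2) (s : Multiset ℕ) : regs m (i ::ₘ s) = regs m s := by
  rw [regs, Multiset.filter_cons_of_neg _ (by omega), regs]

theorem regs_cons {i : ℕ} (hi : i < m) (s : Multiset ℕ) :
    regs m ((i + 2) ::ₘ s) = i ::ₘ regs m s := by
  rw [regs, Multiset.filter_cons_of_pos _ (by omega), Multiset.map_cons, regs]; rfl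

theorem mem_regs {i : ℕ} (hi : i < m) {s : Multiset ℕ} : i ∈ regs m s ↔ i + 2 ∈ s := by
  simp only [regs, Multiset.mem_map, Multiset.mem_filter]
  constructor
  · rintro ⟨j, ⟨h1, h2, h3⟩, h4⟩
    rwa [show i + 2 = j by omega]
  · exact fun h => ⟨i + 2, ⟨h, by omega, by omega⟩, rfl⟩

/-- The implementation is exact on the registers and moves one unit from the pool to the waste. As
the waste cannot exceed the total, this clock bounds the number of operations between two
recyclings. -/
theorem exact_instr {o : Op} (ho : o.idx < m) {s s' : Multiset ℕ} (h : Run Op.Exact o.instr s s') :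
    o.Exact (regs m s) (regs m s') ∧ s'.count 1 = s.count 1 + 1 := by
  cases o with
  | inc i =>
    change i < m at ho
    obtain ⟨_, rfl, _, rfl, s2, h, _, rfl, rfl⟩ := h
    change 1 ::ₘ _ = 0 ::ₘ _ at h
    rename_i t
    have h1 : regs m t = regs m s2 := by
      have := congrArg (regs m) h
      rwa [regs_cons_low (by omega), regs_cons_low (by omega)] at this
    have h2 : t.count 1 + 1 = s2.count 1 := by
      have := congrArg (Multiset.count 1) h
      simpa using this
    refine ⟨?_, ?_⟩
    · change regs m _ = _ ::ₘ regs m _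
      rw [regs_cons ho, regs_cons_low (by omega), h1]
    · rw [Multiset.count_cons_of_ne (by omega), Multiset.count_cons_of_ne (by omega), h2]
  | dec i =>
    change i < m at ho
    obtain ⟨t, rfl, _, rfl, s2, h, _, rfl, rfl⟩ := h
    change 1 ::ₘ _ = (i + 2) ::ₘ _ at h
    have h1 : regs m t = i ::ₘ regs m s2 := by
      have := congrArg (regs m) h
      rwa [regs_cons_low (by omega), regs_cons ho] at this
    have h2 : t.count 1 + 1 = s2.count 1 := by
      have := congrArg (Multiset.count 1) h
      rwa [Multiset.count_cons_self, Multiset.count_cons_of_ne (by omega)] at this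
    refine ⟨?_, ?_⟩
    · change regs m _ = _ ::ₘ regs m _
      rw [regs_cons_low (by omega), regs_cons_low (by omega), h1]
    · rw [Multiset.count_cons_of_ne (by omega), Multiset.count_cons_of_ne (by omega), h2]
  | reset i =>
    change i < m at ho
    obtain ⟨t, rfl, _, rfl, s2, ⟨h, rfl⟩, rfl⟩ := h
    refine ⟨⟨?_, ?_⟩, ?_⟩
    · rw [mem_regs ho]
      simpa using h
    · rw [regs_cons_low (by omega), regs_cons_low (by omega)]
    · simp

/-- In a round without loss the initial resets meet registers that are empty already, so the
preceding round must have ended with all registers at zero. -/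
theorem exact_resets {s s' : Multiset ℕ} (h : Run Op.Exact (resets m) s s') :
    regs m s = 0 ∧ s' = s := by
  have key : ∀ L : List ℕ, Run Op.Exact (L.map fun i => .reset (i + 2)) s s' →
      (∀ i ∈ L, i + 2 ∉ s) ∧ s' = s := by
    intro L
    induction L with
    | nil => exact fun h => ⟨by simp, h⟩
    | cons i L ih =>
      rintro ⟨_, ⟨h1, rfl⟩, h2⟩
      obtain ⟨h3, h4⟩ := ih h2
      exact ⟨by simpa using ⟨h1, h3⟩, h4⟩
  obtain ⟨h1, h2⟩ := key _ h
  refine ⟨Multiset.eq_zero_of_forall_notMem fun i hi => ?_, h2⟩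
  have him : i < m := by
    simp only [regs, Multiset.mem_map, Multiset.mem_filter] at hi
    omega
  exact h1 i (List.mem_range.2 him) ((mem_regs him).1 hi)

theorem regs_load (hm : 0 < m) {n : ℕ} {s s' : Multiset ℕ} (h : Run Op.Exact (load n) s s') :
    regs m s' = regs m s + .replicate n 0 := by
  induction n generalizing s with
  | zero => rw [show s' = s from h]; simp
  | succ n ih =>
    obtain ⟨t, rfl, _, rfl, h⟩ := h
    rw [ih h, show regs m (2 ::ₘ t) = 0 ::ₘ regs m t from regs_cons hm t,
      regs_cons_low (i := 0) (by omega), Multiset.replicate_succ]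
    simp

/-- Apart from losses, the rules conserve the total of all counters. Hence an infinite run has only
finitely many losses. -/
theorem sum_wt_of_mem_machine {n : ℕ} {r : Rule} (h : r ∈ machine M m n) :
    (r.2.1.map Op.wt).sum = 0 := by
  have h1 : ∀ L : List ℕ, ((L.map fun i => Op.reset (i + 2)).map Op.wt).sum = 0 := by
    intro L; induction L with
    | nil => rfl
    | cons i L ih => simpa [Op.wt] using ih
  have h2 : ∀ n, ((load n).map Op.wt).sum = 0 := by
    intro n; induction n with
    | zero => rfl
    | succ n ih => simpa [load, Op.wt] using ih
  rcases (mem_machine M m).1 h with rfl | rfl | rfl | ⟨j, o, -, rfl⟩ | ⟨j, -, rfl⟩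
  · rw [List.map_append, List.sum_append, h2, add_zero]; exact h1 _
  · rfl
  · rfl
  · cases o <;> rfl
  · rfl

/-- The steps of the machine which do not lose resources. -/
inductive LStep (n : ℕ) : ℕ × Multiset ℕ → ℕ × Multiset ℕ → Prop
  | start {s s' : Multiset ℕ} : regs m s = 0 → regs m s' = .replicate n 0 →
      LStep n (1, s) (ctlState M.start, s')
  | recycle {s s' : Multiset ℕ} : regs m s' = regs m s → s'.count 1 < s.count 1 →
      LStep n (2, s) (2, s')
  | restart (s : Multiset ℕ) : LStep n (2, s) (1, s)
  | op {s s' : Multiset ℕ} {o : Op} (j : σ) : o.Exact (regs m s) (regs m s') →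
      s'.count 1 = s.count 1 + 1 → LStep n (ctlState j, s) (ctlState (M.step j o), s')
  | halt {j : σ} (s : Multiset ℕ) : j ∈ M.accept → LStep n (ctlState j, s) (2, s)

theorem MStep.cases_lossless (hm : 0 < m) {n : ℕ} {x y : ℕ × Multiset ℕ}
    (h : MStep (machine M m n) x y) :
    y.2.card < x.2.card ∨ (y.2.card = x.2.card ∧ LStep (m := m) M n x y) := by
  obtain ⟨q, s⟩ := x
  obtain ⟨q', s'⟩ := y
  obtain ⟨w, hw, h⟩ := h
  have h0 := sum_wt_of_mem_machine M hw
  simp only at h0 h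
  rcases run_exact_or h with h | ⟨h, h'⟩
  · left; simp only; omega
  · refine .inr ⟨by simp only; omega, ?_⟩
    rcases (mem_machine M m).1 hw with hr | hr | hr | ⟨j, o, ho, hr⟩ | ⟨j, hj, hr⟩ <;>
      (simp only [Prod.mk.injEq] at hr; obtain ⟨rfl, rfl, rfl⟩ := hr)
    · obtain ⟨t, h1, h2⟩ := run_append.1 h
      obtain ⟨h3, rfl⟩ := exact_resets h1
      exact .start h3 (by rw [regs_load hm h2, h3, zero_add])
    · obtain ⟨t, rfl, _, rfl, rfl⟩ := h
      exact .recycle (by rw [regs_cons_low (by omega), regs_cons_low (by omega)]) (by simp)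
    · obtain rfl : s' = s := h
      exact .restart _
    · exact .op _ (exact_instr ho h).1 (exact_instr ho h).2
    · obtain rfl : s' = s := h
      exact .halt _ hj

theorem three_le_ctlState (j : σ) : 3 ≤ ctlState j := by unfold ctlState; omega

/-- If no accepted program run clears the input, the machine terminates. -/
theorem machine_acc (hm : 0 < m) {n : ℕ}
    (hK : ¬ ∃ w ∈ M.accepts, Run Op.Exact w (.replicate n 0) 0) (x : ℕ × Multiset ℕ) :
    Acc (fun y x => MStep (machine M m n) x y) x := by
  -- The main induction is on the total of the counters, so that from here on only steps without
  -- loss have to be considered.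
  obtain ⟨T, hT⟩ : ∃ T, x.2.card = T := ⟨_, rfl⟩
  induction T using Nat.strong_induction_on generalizing x with
  | _ T ih =>
  have intro' : ∀ x : ℕ × Multiset ℕ, x.2.card = T → (∀ y, y.2.card = T → LStep (m := m) M n x y →
      Acc (fun y x => MStep (machine M m n) x y) y) →
      Acc (fun y x => MStep (machine M m n) x y) x := by
    refine fun x hx H => ⟨_, fun y hy => ?_⟩
    rcases hy.cases_lossless M hm with h | ⟨h, h'⟩
    · exact ih _ (hx ▸ h) _ rfl
    · exact H y (h.trans hx) h'
  -- With a nonempty register, restarting necessarily loses units.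
  have start_pos : ∀ s, s.card = T → regs m s ≠ 0 →
      Acc (fun y x => MStep (machine M m n) x y) (1, s) := by
    refine fun s hs hr => intro' _ hs fun y hy h => ?_
    generalize hx : (1, s) = x at h
    cases h with
    | start h => cases hx; exact absurd h hr
    | recycle => cases hx
    | restart => cases hx
    | op j => have := three_le_ctlState j; simp only [Prod.mk.injEq] at hx; omega
    | @halt j => have := three_le_ctlState j; simp only [Prod.mk.injEq] at hx; omega
  -- While recycling, the waste decreases and the registers do not change, so any property `p` of
  -- the registers is carried to the restart.
  have halt : ∀ p : Multiset ℕ → Prop, (∀ s, s.card = T → p (regs m s) →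
      Acc (fun y x => MStep (machine M m n) x y) (1, s)) → ∀ s, s.card = T → p (regs m s) →
      Acc (fun y x => MStep (machine M m n) x y) (2, s) := by
    intro p hp s
    obtain ⟨k, hk⟩ : ∃ k, s.count 1 = k := ⟨_, rfl⟩
    induction k using Nat.strong_induction_on generalizing s with
    | _ k ihk =>
    refine fun hs hr => intro' _ hs fun y hy h => ?_
    generalize hx : (2, s) = x at h
    cases h with
    | start h => cases hx
    | recycle h h' => cases hx; exact ihk _ (hk ▸ h') _ rfl hy (h ▸ hr)
    | restart => cases hx; exact hp _ hs hr
    | op j => have := three_le_ctlState j; simp only [Prod.mk.injEq] at hx; omega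
    | @halt j => have := three_le_ctlState j; simp only [Prod.mk.injEq] at hx; omega
  -- While the program runs, the waste increases and is bounded by `T`. The invariant `p` links the
  -- state of the automaton with the registers.
  have prog : ∀ p : σ → Multiset ℕ → Prop, (∀ j r o r', p j r → o.Exact r r' → p (M.step j o) r') →
      (∀ s j, s.card = T → p j (regs m s) → j ∈ M.accept →
        Acc (fun y x => MStep (machine M m n) x y) (2, s)) →
      ∀ s j, s.card = T → p j (regs m s) →
        Acc (fun y x => MStep (machine M m n) x y) (ctlState j, s) := by
    intro p hp hp' s
    obtain ⟨k, hk⟩ : ∃ k, T - s.count 1 = k := ⟨_, rfl⟩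
    induction k using Nat.strong_induction_on generalizing s with
    | _ k ihk =>
    refine fun j hs hr => intro' _ hs fun y hy h => ?_
    have h3 := three_le_ctlState j
    generalize hx : (ctlState j, s) = x at h
    cases h with
    | start h => simp only [Prod.mk.injEq] at hx; omega
    | recycle h h' => simp only [Prod.mk.injEq] at hx; omega
    | restart => simp only [Prod.mk.injEq] at hx; omega
    | @op s s' o j' h h' =>
      simp only [Prod.mk.injEq] at hx
      obtain ⟨hj, rfl⟩ := hx
      obtain rfl := ctlState_inj hj
      have := Multiset.count_le_card 1 s'
      simp only at hy
      exact ihk _ (by omega) _ rfl _ hy (hp _ _ _ _ hr h)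
    | @halt j' s h =>
      simp only [Prod.mk.injEq] at hx
      obtain ⟨hj, rfl⟩ := hx
      obtain rfl := ctlState_inj hj
      exact hp' _ _ hs hr h
  -- After a lossless start the registers hold what some word makes of the input. By `hK` they are
  -- not empty at acceptance, so the next restart loses units.
  have main : ∀ s, s.card = T → Acc (fun y x => MStep (machine M m n) x y) (1, s) := by
    refine fun s hs => intro' _ hs fun y hy h => ?_
    generalize hx : (1, s) = x at h
    cases h with
    | @start s s' h h' =>
      refine prog (fun j r => ∃ w, M.eval w = j ∧ Run Op.Exact w (.replicate n 0) r) ?_ ?_ _ _ hy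
        ⟨[], rfl, h'⟩
      · rintro j r o r' ⟨w, rfl, hw⟩ ho
        exact ⟨w ++ [o], M.eval_append_singleton _ _, run_append.2 ⟨_, hw, _, ho, rfl⟩⟩
      · rintro s j hs ⟨w, rfl, hw⟩ hj
        refine halt (· ≠ 0) start_pos s hs fun h0 => hK ⟨w, hj, h0 ▸ hw⟩
    | recycle => cases hx
    | restart => cases hx
    | op j => have := three_le_ctlState j; simp only [Prod.mk.injEq] at hx; omega
    | @halt j => have := three_le_ctlState j; simp only [Prod.mk.injEq] at hx; omega
  -- For arbitrary states nothing is known about the registers, but the computation ends or comes to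
  -- a restart, where `main` applies.
  have mainH := halt (fun _ => True) fun s hs _ => main s hs
  have mainP := prog (fun _ _ => True) (by simp) fun s _ h _ _ => mainH s h trivial
  refine intro' x hT fun y hy h => ?_
  obtain ⟨q, s⟩ := y
  cases h with
  | start _ _ => exact mainP _ _ hy trivial
  | recycle _ _ => exact mainH _ hy trivial
  | restart => exact main _ hy
  | op j _ _ => exact mainP _ _ hy trivial
  | halt => exact mainH _ hy trivial

/-- The state with given contents of the pool, the waste, and the registers. -/
def pack (a b : ℕ) (r : Multiset ℕ) : Multiset ℕ :=
  .replicate a 0 + .replicate b 1 + r.map (· + 2)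

theorem pack_succ_left (a b : ℕ) (r : Multiset ℕ) : pack (a + 1) b r = 0 ::ₘ pack a b r := by
  simp [pack, Multiset.replicate_succ]

theorem pack_succ_right (a b : ℕ) (r : Multiset ℕ) : pack a (b + 1) r = 1 ::ₘ pack a b r := by
  simp [pack, Multiset.replicate_succ]

theorem pack_cons (a b i : ℕ) (r : Multiset ℕ) : pack a b (i ::ₘ r) = (i + 2) ::ₘ pack a b r := by
  simp [pack]

theorem mem_pack {a b i : ℕ} {r : Multiset ℕ} : i + 2 ∈ pack a b r ↔ i ∈ r := by
  simp [pack, Multiset.mem_replicate]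

/-- An operation takes at most two units from the pool, and the total is conserved once the
additional unit of waste is counted. The first bound is what makes a pool of twice the length of the
word sufficient. -/
theorem run_instr {o : Op} {r r' : Multiset ℕ} (h : o.Exact r r') {a : ℕ} (ha : 2 ≤ a) (b : ℕ) :
    ∃ a', a ≤ a' + 2 ∧ a' + r'.card + 1 = a + r.card ∧
      Run Op.Act o.instr (pack a b r) (pack a' (b + 1) r') := by
  obtain ⟨a, rfl⟩ : ∃ a', a = a' + 2 := ⟨a - 2, by omega⟩
  cases o with
  | inc i =>
    obtain rfl : r' = i ::ₘ r := h
    refine ⟨a, by omega, by rw [Multiset.card_cons]; omega, pack (a + 1) b r,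
      pack_succ_left _ _ _, pack (a + 1) (b + 1) r, pack_succ_right _ _ _, pack a (b + 1) r,
      pack_succ_left _ _ _, _, pack_cons _ _ _ _, rfl⟩
  | dec i =>
    obtain rfl : r = i ::ₘ r' := h
    refine ⟨a + 2, by omega, by rw [Multiset.card_cons]; omega, pack (a + 1) b _,
      pack_succ_left _ _ _, pack (a + 1) (b + 1) _, pack_succ_right _ _ _, pack (a + 1) (b + 1) r',
      pack_cons _ _ _ _, _, pack_succ_left _ _ _, rfl⟩
  | reset i =>
    obtain ⟨h, rfl⟩ := h
    refine ⟨a + 1, by omega, by omega, pack (a + 1) b r', pack_succ_left _ _ _,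
      pack (a + 1) (b + 1) r', pack_succ_right _ _ _, _, ?_, rfl⟩
    exact (show Op.Exact (.reset (i + 2)) _ _ from ⟨fun h' => h (mem_pack.1 h'), rfl⟩).act

theorem machine_run_word {n : ℕ} {w : List Op} (hw : ∀ o ∈ w, o.idx < m) :
    ∀ {j : σ} {r r' : Multiset ℕ} {a b : ℕ}, Run Op.Exact w r r' → 2 * w.length ≤ a →
      ∃ a', a' + r'.card + w.length = a + r.card ∧ Relation.ReflTransGen (MStep (machine M m n))
        (ctlState j, pack a b r) (ctlState (M.evalFrom j w), pack a' (b + w.length) r') := by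
  induction w with
  | nil =>
    rintro j r r' a b h -
    obtain rfl : r' = r := h
    exact ⟨a, by simp, .refl⟩
  | cons o w ih =>
    rintro j r r' a b ⟨t, h, h'⟩ ha
    rw [List.length_cons] at ha
    obtain ⟨a1, h1, h2, h3⟩ := run_instr h (by omega : 2 ≤ a) b
    obtain ⟨a2, h4, h5⟩ := ih (fun o ho => hw o (.tail _ ho)) (j := M.step j o) (a := a1)
      (b := b + 1) h' (by omega)
    refine ⟨a2, by rw [List.length_cons]; omega, .head (b := (ctlState (M.step j o), _))
      ⟨_, (mem_machine M m).2 (.inr (.inr (.inr (.inl ⟨j, o, hw o (.head _), rfl⟩)))), h3⟩ ?_⟩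
    rwa [List.length_cons, add_comm w.length, ← add_assoc]

theorem not_acc_of_transGen {α : Type} {r : α → α → Prop} {x : α}
    (h : Relation.TransGen (fun x y => r y x) x x) : ¬ Acc r x := by
  intro hx
  induction hx with
  | intro x _ ih =>
    rcases Relation.TransGen.head'_iff.1 h with ⟨y, h1, h2⟩
    exact ih y h1 (.tail' h2 h1)

/-- With `n + 2 * w.length` units there are `n` for the input and two for each operation of `w`. The
run of `w` empties the registers, so recycling the waste restores the initial pool, and the machine
has come full circle. -/
theorem machine_not_acc {n : ℕ} (hM : ∀ w ∈ M.accepts, ∀ o ∈ w, o.idx < m)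
    (hK : ∃ w ∈ M.accepts, Run Op.Exact w (.replicate n 0) 0) :
    ∃ N, ¬ Acc (fun y x => MStep (machine M m n) x y) (1, .replicate N 0) := by
  obtain ⟨w, hw, h⟩ := hK
  have hload : ∀ n a, Run Op.Act (load n) (pack (n + a) 0 0) (pack a 0 (.replicate n 0)) := by
    intro n a
    suffices H : ∀ r, Run Op.Act (load n) (pack (n + a) 0 r) (pack a 0 (r + .replicate n 0)) by
      simpa using H 0
    induction n with
    | zero => intro r; simp [load, Run]
    | succ n ih =>
      intro r
      refine ⟨pack (n + a) 0 r, ?_, pack (n + a) 0 (0 ::ₘ r), pack_cons _ _ _ _, ?_⟩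
      · rw [add_right_comm]; exact pack_succ_left _ _ _
      · have := ih (0 ::ₘ r)
        rwa [Multiset.cons_add, ← Multiset.add_cons, ← Multiset.replicate_succ] at this
  have hresets : ∀ s, (∀ i, i + 2 ∉ s) → Run Op.Act (resets m) s s := by
    intro s hs
    unfold resets
    generalize List.range m = L
    induction L with
    | nil => rfl
    | cons i L ih => exact ⟨s, (show Op.Exact (.reset (i + 2)) _ _ from ⟨hs i, rfl⟩).act, ih⟩
  have hloop : ∀ b a, Relation.ReflTransGen (MStep (machine M m n)) (2, pack a b 0)
      (2, pack (a + b) 0 0) := by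
    intro b
    induction b with
    | zero => exact fun a => .refl
    | succ b ih =>
      intro a
      refine .head (b := (2, pack (a + 1) b 0)) ⟨_, (mem_machine M m).2 (.inr (.inl rfl)),
        pack a b 0, pack_succ_right _ _ _, _, pack_succ_left _ _ _, rfl⟩ ?_
      rw [add_comm b, ← add_assoc]; exact ih _
  refine ⟨n + 2 * w.length, not_acc_of_transGen ?_⟩
  have h0 : ∀ N, Multiset.replicate N 0 = pack N 0 0 := fun N => by simp [pack]
  obtain ⟨a', h1, h2⟩ := machine_run_word M (n := n) (hM w hw) (j := M.start) (b := 0) h le_rfl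
  rw [h0]
  refine .head' (b := (ctlState M.start, _)) ⟨_, (mem_machine M m).2 (.inl rfl),
    run_append.2 ⟨_, hresets _ fun i hi => ?_, hload _ _⟩⟩ (h2.trans
    (.head (b := (2, _)) ⟨_, (mem_machine M m).2 (.inr (.inr (.inr (.inr ⟨_, hw, rfl⟩)))), rfl⟩
    ((hloop _ _).trans (.single ⟨_, (mem_machine M m).2 (.inr (.inr (.inl rfl))), ?_⟩))))
  · simpa using mem_pack.1 hi
  · change _ = _
    rw [show a' + (0 + w.length) = n + 2 * w.length by simp at h1; omega]

end

/-- There are machines for which termination is undecidable. -/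
theorem exists_undecidable_machine : ∃ (K : ℕ → Prop) (R : List Rule) (w : List Op) (q m : ℕ),
    ¬ ComputablePred K ∧ 2 < m ∧ q ≠ 0 ∧ (∀ o ∈ w, o.idx < m) ∧
    (∀ r ∈ R, r.1 ≠ 0 ∧ r.2.2 ≠ 0 ∧ ∀ o ∈ r.2.1, o.idx < m) ∧
    ∀ n, (K n → ∃ N, ¬ Acc (fun y x => MStep ((1, w ++ load n, q) :: R) x y) (1, .replicate N 0)) ∧
      (¬ K n → ∀ x, Acc (fun y x => MStep ((1, w ++ load n, q) :: R) x y) x) := by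
  obtain ⟨L, m, ⟨σ, _, M, rfl⟩, hm, hL, hK⟩ := exists_undecidable_language
  refine ⟨_, machineRules M m, resets m, ctlState M.start, m + 2, hK, by omega, ?_, ?_, ?_, fun n =>
    ⟨machine_not_acc M hL, machine_acc M hm⟩⟩
  · have := three_le_ctlState M.start; omega
  · simp [resets, Op.idx]
  · intro r hr
    have h3 : ∀ j : σ, ctlState j ≠ 0 := fun j => by have := three_le_ctlState j; omega
    rcases (mem_machine M m (n := 0)).1 (.tail _ hr) with rfl | rfl | rfl | ⟨j, o, ho, rfl⟩ |
      ⟨j, -, rfl⟩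
    · refine ⟨by simp, h3 _, ?_⟩
      simp [resets, load, Op.idx]
    · simp [Op.idx]
    · simp
    · refine ⟨h3 _, h3 _, ?_⟩
      cases o <;> simp [Op.instr, Op.idx] at ho ⊢ <;> omega
    · exact ⟨h3 _, by simp, by simp⟩

end Evol

-- Undecidability: systems of parallel components.

namespace Evol

/-! ## Trees as soups of parallel components -/

/-- The code of the inactive process. -/
def zeroCode : ℕ := Term.zero.code

theorem acts_zeroCode : acts zeroCode = [] := by
  simp [acts, zeroCode, Term.zero, Term.code, Branches.code, branchActs]

/-- The parallel components of a tree, the inactive process being ignored. -/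
def Tr.items : Tr → Multiset Tr
  | leaf c => if c = zeroCode then 0 else {leaf c}
  | loc a P => {loc a P}
  | par P Q => P.items + Q.items

section

variable {t : Topology}

/-- A labelled transition concerns a single component. Together with `TT.of_items` this allows
computing with multisets, where the arrangement of parallel compositions and inactive components do
not matter. -/
theorem TT.items {P P' : Tr} {α : Lab} (h : TT t P α P') :
    ∃ x Q R, P.items = x ::ₘ R ∧ TT t x α Q ∧ P'.items = Q.items + R := by
  induction h with
  | @leaf c α T h =>
    have : c ≠ zeroCode := by rintro rfl; simp [acts_zeroCode] at h
    exact ⟨_, _, 0, by simp [Tr.items, this], .leaf h, by simp⟩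
  | abs a h => exact ⟨_, _, 0, rfl, .abs a h, by simp⟩
  | loc a h => exact ⟨_, _, 0, rfl, .loc a h, by simp⟩
  | parL Q _ ih =>
    obtain ⟨x, S, R, h1, h2, h3⟩ := ih
    exact ⟨x, S, R + Q.items, by simp [Tr.items, h1], h2, by simp [Tr.items, h3, add_assoc]⟩
  | parR P _ ih =>
    obtain ⟨x, S, R, h1, h2, h3⟩ := ih
    exact ⟨x, S, P.items + R, by simp [Tr.items, h1], h2, by simp [Tr.items, h3, add_left_comm]⟩

theorem add_eq_cons {α : Type*} {A B R : Multiset α} {x : α} (h : A + B = x ::ₘ R) :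
    (∃ A', A = x ::ₘ A' ∧ R = A' + B) ∨ ∃ B', B = x ::ₘ B' ∧ R = A + B' := by
  have hx : x ∈ A + B := h ▸ Multiset.mem_cons_self x R
  rcases Multiset.mem_add.1 hx with hx | hx
  · obtain ⟨A', rfl⟩ := Multiset.exists_cons_of_mem hx
    rw [Multiset.cons_add, Multiset.cons_inj_right] at h
    exact .inl ⟨A', rfl, h.symm⟩
  · obtain ⟨B', rfl⟩ := Multiset.exists_cons_of_mem hx
    rw [Multiset.add_cons, Multiset.cons_inj_right] at h
    exact .inr ⟨B', rfl, h.symm⟩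

theorem Tr.items_leaf_eq_cons {c : ℕ} {x : Tr} {R : Multiset Tr} (h : (leaf c).items = x ::ₘ R) :
    x = leaf c ∧ R = 0 := by
  by_cases hc : c = zeroCode
  · simp [items, hc] at h
  · rw [items, if_neg hc, Multiset.singleton_eq_cons_iff] at h
    exact ⟨h.1.symm, h.2⟩

theorem Tr.items_loc_eq_cons {a : ℕ} {P x : Tr} {R : Multiset Tr} (h : (loc a P).items = x ::ₘ R) :
    x = loc a P ∧ R = 0 := by
  rw [items, Multiset.singleton_eq_cons_iff] at h
  exact ⟨h.1.symm, h.2⟩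

theorem TT.of_items {P x Q : Tr} {R : Multiset Tr} {α : Lab} (h : P.items = x ::ₘ R)
    (hx : TT t x α Q) : ∃ P', TT t P α P' ∧ P'.items = Q.items + R := by
  induction P generalizing R with
  | leaf c => obtain ⟨rfl, rfl⟩ := Tr.items_leaf_eq_cons h; exact ⟨Q, hx, by simp⟩
  | loc a P => obtain ⟨rfl, rfl⟩ := Tr.items_loc_eq_cons h; exact ⟨Q, hx, by simp⟩
  | par A B ihA ihB =>
    rcases add_eq_cons h with ⟨A', hA, rfl⟩ | ⟨B', hB, rfl⟩
    · obtain ⟨P', h1, h2⟩ := ihA hA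
      exact ⟨_, .parL _ h1, by simp [Tr.items, h2, add_assoc]⟩
    · obtain ⟨P', h1, h2⟩ := ihB hB
      exact ⟨_, .parR _ h1, by simp [Tr.items, h2, add_left_comm]⟩

theorem TStep.items {P P' : Tr} (h : TStep t P P') :
    (∃ x Q R, P.items = x ::ₘ R ∧ TStep t x Q ∧ P'.items = Q.items + R) ∨
    ∃ α x y x' y' R, P.items = x ::ₘ y ::ₘ R ∧ TT t x α x' ∧ TT t y α.dual y' ∧
      P'.items = x'.items + y'.items + R := by
  induction h with
  | sync h h' =>
    obtain ⟨x, x', R, h1, h2, h3⟩ := h.items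
    obtain ⟨y, y', S, h4, h5, h6⟩ := h'.items
    refine .inr ⟨_, x, y, x', y', R + S, by simp [Tr.items, h1, h4, Multiset.cons_swap y], h2, h5, ?_⟩
    simp only [Tr.items, h3, h6]; abel
  | loc a h => exact .inl ⟨_, _, 0, rfl, .loc a h, by simp⟩
  | parL Q _ ih =>
    rcases ih with ⟨x, S, R, h1, h2, h3⟩ | ⟨α, x, y, x', y', R, h1, h2, h3, h4⟩
    · exact .inl ⟨x, S, R + Q.items, by simp [Tr.items, h1], h2, by simp [Tr.items, h3, add_assoc]⟩
    · exact .inr ⟨α, x, y, x', y', R + Q.items, by simp [Tr.items, h1], h2, h3,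
        by simp [Tr.items, h4, add_assoc]⟩
  | parR P _ ih =>
    rcases ih with ⟨x, S, R, h1, h2, h3⟩ | ⟨α, x, y, x', y', R, h1, h2, h3, h4⟩
    · exact .inl ⟨x, S, P.items + R, by simp [Tr.items, h1], h2,
        by simp [Tr.items, h3, add_left_comm]⟩
    · exact .inr ⟨α, x, y, x', y', P.items + R, by simp [Tr.items, h1], h2, h3,
        by simp only [Tr.items, h4]; abel⟩

theorem TStep.of_items {P x Q : Tr} {R : Multiset Tr} (h : P.items = x ::ₘ R)
    (hx : TStep t x Q) : ∃ P', TStep t P P' ∧ P'.items = Q.items + R := by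
  induction P generalizing R with
  | leaf c => obtain ⟨rfl, rfl⟩ := Tr.items_leaf_eq_cons h; exact ⟨Q, hx, by simp⟩
  | loc a P => obtain ⟨rfl, rfl⟩ := Tr.items_loc_eq_cons h; exact ⟨Q, hx, by simp⟩
  | par A B ihA ihB =>
    rcases add_eq_cons h with ⟨A', hA, rfl⟩ | ⟨B', hB, rfl⟩
    · obtain ⟨P', h1, h2⟩ := ihA hA
      exact ⟨_, .parL _ h1, by simp [Tr.items, h2, add_assoc]⟩
    · obtain ⟨P', h1, h2⟩ := ihB hB
      exact ⟨_, .parR _ h1, by simp [Tr.items, h2, add_left_comm]⟩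

theorem TStep.of_items_sync {P x y x' y' : Tr} {R : Multiset Tr} {α : Lab}
    (h : P.items = x ::ₘ y ::ₘ R) (hx : TT t x α x') (hy : TT t y α.dual y') :
    ∃ P', TStep t P P' ∧ P'.items = x'.items + y'.items + R := by
  induction P generalizing R with
  | leaf c => have := (Tr.items_leaf_eq_cons h).2; simp at this
  | loc a P => have := (Tr.items_loc_eq_cons h).2; simp at this
  | par A B ihA ihB =>
    rcases add_eq_cons h with ⟨A', h1, h2⟩ | ⟨B', h1, h2⟩ <;>
      rcases add_eq_cons h2.symm with ⟨A'', h3, rfl⟩ | ⟨B'', h3, rfl⟩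
    · obtain ⟨P', h4, h5⟩ := ihA (by rw [h1, h3])
      exact ⟨_, .parL _ h4, by simp [Tr.items, h5, add_assoc]⟩
    · obtain ⟨P', h4, h5⟩ := TT.of_items h1 hx
      obtain ⟨Q', h6, h7⟩ := TT.of_items h3 hy
      exact ⟨_, .sync h4 h6, by simp only [Tr.items, h5, h7]; abel⟩
    · obtain ⟨P', h4, h5⟩ := TT.of_items h1 hx
      obtain ⟨Q', h6, h7⟩ := TT.of_items h3 hy
      exact ⟨_, .sync h6 (by rwa [Lab.dual_dual hx.kind_le]), by simp only [Tr.items, h5, h7]; abel⟩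
    · obtain ⟨P', h4, h5⟩ := ihB (by rw [h1, h3])
      exact ⟨_, .parR _ h4, by simp only [Tr.items, h5]; abel⟩

theorem TStep.not_leaf {c : ℕ} {Q : Tr} : ¬ TStep t (.leaf c) Q := nofun

/-! ## Worlds -/

/-- Names: `nm a k i`, for `k < 8`, are pairwise different and different from `a`. -/
def nm (a k i : ℕ) : ℕ := a + 1 + k + 8 * i

theorem nm_inj {a k k' i i' : ℕ} (hk : k < 8) (hk' : k' < 8) (h : nm a k i = nm a k' i') :
    k = k' ∧ i = i' := by
  unfold nm at h; omega

theorem nm_ne {a k i : ℕ} : nm a k i ≠ a := by unfold nm; omega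

/-- All actions of the tree are at names that belong to counter `i`. -/
def Owned (t : Topology) (a i : ℕ) (P : Tr) : Prop :=
  ∀ α Q, TT t P α Q → ∃ k, 2 ≤ k ∧ k < 8 ∧ α.2.1 = nm a k i

/-- The components of the first `m` counters. -/
def regItems (a m : ℕ) (ρ : ℕ → Tr) : Multiset Tr :=
  (Multiset.range m).map fun i => .loc (nm a 1 i) (ρ i)

/-- The tree consists of a control component, rules, and `m` counters. -/
def IsWorld (a m : ℕ) (rules : Multiset Tr) (κ : Tr) (ρ : ℕ → Tr) (P : Tr) : Prop :=
  P.items = κ ::ₘ (rules + regItems a m ρ)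

theorem regItems_eq (a : ℕ) {m i : ℕ} (hi : i < m) (ρ : ℕ → Tr) : regItems a m ρ =
    .loc (nm a 1 i) (ρ i) ::ₘ
      ((Multiset.range m).erase i).map fun i => .loc (nm a 1 i) (ρ i) := by
  rw [regItems, ← Multiset.cons_erase (Multiset.mem_range.2 hi), Multiset.map_cons,
    Multiset.erase_cons_head]

theorem map_erase_update (a : ℕ) {m i : ℕ} (ρ : ℕ → Tr) (ρ' : Tr) :
    (((Multiset.range m).erase i).map fun j => Tr.loc (nm a 1 j) (Function.update ρ i ρ' j)) =
      ((Multiset.range m).erase i).map fun i => .loc (nm a 1 i) (ρ i) := by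
  refine Multiset.map_congr rfl fun j hj => ?_
  rw [Function.update_of_ne ((Multiset.nodup_range m).mem_erase_iff.1 hj).1]

theorem regItems_update (a : ℕ) {m i : ℕ} (hi : i < m) (ρ : ℕ → Tr) (ρ' : Tr) :
    regItems a m (Function.update ρ i ρ') = .loc (nm a 1 i) ρ' ::ₘ
      ((Multiset.range m).erase i).map fun i => .loc (nm a 1 i) (ρ i) := by
  rw [regItems_eq a hi, map_erase_update, Function.update_self]

/-- The components of rules: leaves which offer nothing but inputs. -/
def IsRule (t : Topology) (a : ℕ) (r : Tr) : Prop :=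
  (∃ c, r = .leaf c) ∧ ∀ α Q, TT t r α Q → α.1 = 0 ∧ ∃ q, α.2.1 = nm a 0 q

theorem Owned.loc_name {a i : ℕ} {P : Tr} (h : Owned t a i P) {α : Lab} {Q : Tr}
    (hQ : TT t (.loc (nm a 1 i) P) α Q) : ∃ k, 1 ≤ k ∧ k < 8 ∧ α.2.1 = nm a k i := by
  cases hQ with
  | abs _ _ => exact ⟨1, le_rfl, by omega, rfl⟩
  | loc _ hQ => obtain ⟨k, h1, h2, h3⟩ := h _ _ hQ; exact ⟨k, by omega, h2, h3⟩

variable {a m : ℕ} {rules : Multiset Tr} {κ : Tr} {ρ : ℕ → Tr} {P P' : Tr}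

/-- Rules offer inputs only, so no two of them synchronize. A rule acts at names `nm a 0 q`, a
counter at names of a different kind, and two counters at names with different indices. -/
theorem no_env_sync (hr : ∀ r ∈ rules, IsRule t a r) (hρ : ∀ i < m, Owned t a i (ρ i))
    {x y x' y' : Tr} {R : Multiset Tr} {α : Lab} (h : rules + regItems a m ρ = x ::ₘ y ::ₘ R)
    (hx : TT t x α x') (hy : TT t y α.dual y') : False := by
  have key : ∀ {x y x' y' : Tr} {α : Lab}, x ∈ rules → y ∈ regItems a m ρ → TT t x α x' →
      TT t y α.dual y' → False := by
    intro x y x' y' α hx hy hx' hy'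
    obtain ⟨i, hi, rfl⟩ := Multiset.mem_map.1 hy
    obtain ⟨-, q, hq⟩ := (hr x hx).2 _ _ hx'
    obtain ⟨k, h1, h2, h3⟩ := (hρ i (Multiset.mem_range.1 hi)).loc_name hy'
    have := (nm_inj (by omega) h2 (hq.symm.trans h3)).1
    omega
  rcases add_eq_cons h with ⟨A', h1, h2⟩ | ⟨B', h1, h2⟩ <;>
    rcases add_eq_cons h2.symm with ⟨A'', h3, -⟩ | ⟨B'', h3, -⟩
  · have h4 := ((hr x (by simp [h1])).2 _ _ hx).1
    have h5 := ((hr y (by simp [h1, h3])).2 _ _ hy).1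
    simp [Lab.dual, h4] at h5
  · exact key (x := x) (y := y) (by simp [h1]) (by simp [h3]) hx hy
  · exact key (x := y) (y := x) (by simp [h3]) (by simp [h1]) hy (by rwa [Lab.dual_dual hx.kind_le])
  · obtain ⟨i, hi, rfl⟩ := Multiset.mem_map.1 (show x ∈ regItems a m ρ by simp [h1])
    rw [regItems_eq a (Multiset.mem_range.1 hi), Multiset.cons_inj_right] at h1
    obtain ⟨j, hj, rfl⟩ := Multiset.mem_map.1 (h1.symm ▸ (by simp [h3] : y ∈ B'))
    obtain ⟨hj, hj'⟩ := (Multiset.nodup_range m).mem_erase_iff.1 hj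
    obtain ⟨k, -, h2, h3⟩ := (hρ i (Multiset.mem_range.1 hi)).loc_name hx
    obtain ⟨k', -, h4, h5⟩ := (hρ j (Multiset.mem_range.1 hj')).loc_name hy
    exact hj (nm_inj h4 h2 (h5.symm.trans h3)).2

/-- As the environment does not interact with itself, the control component takes part in every
reduction that is not internal to a counter. By `hκ'` it never updates the outer location of a
counter, so the counters stay in place. -/
theorem IsWorld.step_cases (h : IsWorld a m rules κ ρ P) (hκ : ∃ c, κ = .leaf c)
    (hr : ∀ r ∈ rules, IsRule t a r) (hρ : ∀ i < m, Owned t a i (ρ i))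
    (hκ' : ∀ α Q i, TT t κ α Q → α.2.1 ≠ nm a 1 i) (hP : TStep t P P') :
    (∃ α r κ' r' S, rules = r ::ₘ S ∧ TT t κ α κ' ∧ TT t r α.dual r' ∧
      P'.items = κ'.items + r'.items + (S + regItems a m ρ)) ∨
    (∃ i < m, ∃ α κ' ρ', TT t κ α κ' ∧ TT t (ρ i) α.dual ρ' ∧
      P'.items = κ'.items + (rules + regItems a m (Function.update ρ i ρ'))) ∨
    ∃ i < m, ∃ ρ', TStep t (ρ i) ρ' ∧ IsWorld a m rules κ (Function.update ρ i ρ') P' := by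
  have sync : ∀ {α : Lab} {y κ' y' : Tr} {R : Multiset Tr}, rules + regItems a m ρ = y ::ₘ R →
      TT t κ α κ' → TT t y α.dual y' → P'.items = κ'.items + y'.items + R →
      (∃ α r κ' r' S, rules = r ::ₘ S ∧ TT t κ α κ' ∧ TT t r α.dual r' ∧
        P'.items = κ'.items + r'.items + (S + regItems a m ρ)) ∨
      (∃ i < m, ∃ α κ' ρ', TT t κ α κ' ∧ TT t (ρ i) α.dual ρ' ∧
        P'.items = κ'.items + (rules + regItems a m (Function.update ρ i ρ'))) := by
    intro α y κ' y' R h1 h2 h3 h4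
    rcases add_eq_cons h1 with ⟨S, hS, rfl⟩ | ⟨S, hS, rfl⟩
    · exact .inl ⟨α, y, κ', y', S, hS, h2, h3, h4⟩
    · obtain ⟨i, hi, rfl⟩ := Multiset.mem_map.1 (show y ∈ regItems a m ρ by simp [hS])
      have hi := Multiset.mem_range.1 hi
      rw [regItems_eq a hi, Multiset.cons_inj_right] at hS
      generalize hβ : α.dual = β at h3
      cases h3 with
      | abs _ _ => exact absurd (congrArg (·.2.1) hβ) (hκ' _ _ i h2)
      | @loc _ _ ρ' _ h3 =>
        refine .inr ⟨i, hi, _, κ', ρ', h2, hβ ▸ h3, ?_⟩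
        rw [h4, regItems_update a hi, hS]
        simp only [Tr.items, ← Multiset.singleton_add]
        abel
  rcases hP.items with ⟨x, Q, R, h1, h2, h3⟩ | ⟨α, x, y, x', y', R, h1, h2, h3, h4⟩
  · right; right
    rw [h, ← Multiset.singleton_add] at h1
    rcases add_eq_cons h1 with ⟨S, hS, -⟩ | ⟨S, hS, rfl⟩
    · obtain ⟨c, rfl⟩ := hκ
      obtain rfl := ((Multiset.singleton_eq_cons_iff _).1 hS).1
      exact absurd h2 TStep.not_leaf
    rcases add_eq_cons hS with ⟨S', hS', -⟩ | ⟨S', hS', rfl⟩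
    · obtain ⟨⟨c, rfl⟩, -⟩ := hr x (by simp [hS'])
      exact absurd h2 TStep.not_leaf
    obtain ⟨i, hi, rfl⟩ := Multiset.mem_map.1 (show x ∈ regItems a m ρ by simp [hS'])
    have hi := Multiset.mem_range.1 hi
    rw [regItems_eq a hi, Multiset.cons_inj_right] at hS'
    cases h2 with
    | @loc _ _ ρ' h2 =>
      refine ⟨i, hi, ρ', h2, ?_⟩
      rw [IsWorld, h3, regItems_update a hi, hS']
      simp only [Tr.items, ← Multiset.singleton_add]
      abel
  · rw [← or_assoc]; left
    rw [h] at h1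
    by_cases hx : x = κ
    · subst hx
      exact sync ((Multiset.cons_inj_right _).1 h1) h2 h3 h4
    by_cases hy : y = κ
    · subst hy
      rw [Multiset.cons_swap] at h1
      exact sync ((Multiset.cons_inj_right _).1 h1) h3 (by rwa [Lab.dual_dual h2.kind_le])
        (by rw [h4, add_comm x'.items])
    exfalso
    have hR : κ ∈ R := by
      have : κ ∈ x ::ₘ y ::ₘ R := h1 ▸ Multiset.mem_cons_self _ _
      simpa [Ne.symm hx, Ne.symm hy] using this
    obtain ⟨R', rfl⟩ := Multiset.exists_cons_of_mem hR
    rw [Multiset.cons_swap y, Multiset.cons_swap x, Multiset.cons_inj_right] at h1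
    exact no_env_sync hr hρ h1 h2 h3

theorem IsWorld.sync_reg (h : IsWorld a m rules κ ρ P) {i : ℕ} (hi : i < m) {α : Lab} {κ' ρ' : Tr}
    (h1 : TT t κ α κ') (h2 : TT t (ρ i) α.dual ρ') : ∃ P', TStep t P P' ∧
      P'.items = κ'.items + (rules + regItems a m (Function.update ρ i ρ')) := by
  rw [IsWorld, regItems_eq a hi, Multiset.add_cons] at h
  obtain ⟨P', h3, h4⟩ := TStep.of_items_sync h h1 (.loc _ h2)
  refine ⟨P', h3, ?_⟩
  rw [h4, regItems_update a hi]
  simp only [Tr.items, ← Multiset.singleton_add]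
  abel

theorem IsWorld.step_reg (h : IsWorld a m rules κ ρ P) {i : ℕ} (hi : i < m) {ρ' : Tr}
    (h2 : TStep t (ρ i) ρ') :
    ∃ P', TStep t P P' ∧ IsWorld a m rules κ (Function.update ρ i ρ') P' := by
  rw [IsWorld, regItems_eq a hi, Multiset.add_cons, Multiset.cons_swap] at h
  obtain ⟨P', h3, h4⟩ := TStep.of_items h (.loc _ h2)
  refine ⟨P', h3, ?_⟩
  rw [IsWorld, h4, regItems_update a hi]
  simp only [Tr.items, ← Multiset.singleton_add]
  abel

theorem IsWorld.sync_rule {S : Multiset Tr} {r : Tr} (h : IsWorld a m (r ::ₘ S) κ ρ P) {α : Lab}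
    {κ' r' : Tr} (h1 : TT t κ α κ') (h2 : TT t r α.dual r') : ∃ P', TStep t P P' ∧
      P'.items = κ'.items + r'.items + (S + regItems a m ρ) := by
  rw [IsWorld, Multiset.cons_add] at h
  exact TStep.of_items_sync h h1 h2

theorem IsWorld.barb (h : IsWorld a m rules κ ρ P) {e : Barb} (hκ : TBarb t κ e) :
    TBarb t P e := by
  obtain ⟨Q, hQ⟩ := hκ
  obtain ⟨P', hP, -⟩ := TT.of_items h hQ
  exact ⟨P', hP⟩

/-- The name of a barb. -/
def Barb.name (e : Barb) : ℕ := e.lab.2.1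

/-- Rules and counters use names of the form `nm`, which avoid the name of the barb, so only the
control component decides about error states. -/
theorem IsWorld.not_barb {e : Barb} (h : IsWorld e.name m rules κ ρ P)
    (hr : ∀ r ∈ rules, IsRule t e.name r) (hρ : ∀ i < m, Owned t e.name i (ρ i))
    (hκ : ¬ TBarb t κ e) : ¬ TBarb t P e := by
  rintro ⟨P', hP⟩
  obtain ⟨x, Q, R, h1, h2, -⟩ := hP.items
  have hx : x ∈ κ ::ₘ (rules + regItems e.name m ρ) := by rw [← h, h1]; simp
  rcases Multiset.mem_cons.1 hx with rfl | hx
  · exact hκ ⟨_, h2⟩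
  rcases Multiset.mem_add.1 hx with hx | hx
  · obtain ⟨-, q, hq⟩ := (hr x hx).2 _ _ h2
    exact nm_ne hq.symm
  · obtain ⟨i, hi, rfl⟩ := Multiset.mem_map.1 hx
    obtain ⟨k, -, -, h3⟩ := (hρ i (Multiset.mem_range.1 hi)).loc_name h2
    exact nm_ne h3.symm

end

end Evol

-- Undecidability: simulation of machines over an abstract encoding of counters.

namespace Evol

open Relation

/-! ## Safety -/

section

variable {t : Topology}

/-- No computation enters an infinite sequence of error states. -/
def Safe (t : Topology) (e : Barb) (P : Tr) : Prop :=
  ∀ Q, ReflTransGen (TStep t) P Q → Acc (fun y x => TStep t x y ∧ TBarb t x e) Q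

theorem Safe.intro {e : Barb} {P : Tr} (h : ∀ P', TStep t P P' → Safe t e P') : Safe t e P := by
  intro Q hQ
  rcases hQ.cases_head with rfl | ⟨P', h1, h2⟩
  · exact ⟨_, fun y hy => h y hy.1 y .refl⟩
  · exact h P' h1 Q h2

theorem acc_tr_iff {e : Barb} {P : Term} (hP : Good t P) :
    Acc (fun y x => TStep t x y ∧ TBarb t x e) P.tr ↔
      Acc (fun y x => Step t x y ∧ HasBarb t x e) P := by
  constructor
  · intro h
    generalize hT : P.tr = T at h
    induction h generalizing P with
    | intro T _ ih =>
      subst hT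
      refine ⟨_, fun Q hQ => ?_⟩
      obtain ⟨h1, h2, -⟩ := step_to_tree hQ.1 hP
      exact ih _ ⟨h1, (hasBarb_iff hP e).1 hQ.2⟩ h2 rfl
  · intro h
    induction h with
    | intro P _ ih =>
      refine ⟨_, fun T hT => ?_⟩
      obtain ⟨Q, h1, rfl⟩ := tree_to_step hP hT.1
      exact ih Q ⟨h1, (hasBarb_iff hP e).2 hT.2⟩ (step_to_tree h1 hP).2.1

/-- An infinite sequence of error states is a descending chain, so its absence is accessibility;
both reachability and accessibility transfer along the bisimulation. -/
theorem eventualAdaptation_iff {e : Barb} {P : Term} (hP : Good t P) :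
    EventualAdaptation t P e ↔ Safe t e P.tr := by
  have h1 : ∀ {Q : Term}, ReflTransGen (Step t) P Q → Good t Q ∧ ReflTransGen (TStep t) P.tr Q.tr := by
    intro Q h
    induction h with
    | refl => exact ⟨hP, .refl⟩
    | tail _ h ih =>
      obtain ⟨h1, h2, -⟩ := step_to_tree h ih.1
      exact ⟨h2, ih.2.tail h1⟩
  have h2 : ∀ {T : Tr}, ReflTransGen (TStep t) P.tr T → ∃ Q, ReflTransGen (Step t) P Q ∧ Q.tr = T := by
    intro T h
    induction h with
    | refl => exact ⟨P, .refl, rfl⟩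
    | tail _ h ih =>
      obtain ⟨Q, h3, rfl⟩ := ih
      obtain ⟨Q', h4, h5⟩ := tree_to_step (h1 h3).1 h
      exact ⟨Q', h3.tail h4, h5⟩
  constructor
  · intro h T hT
    obtain ⟨Q, h3, rfl⟩ := h2 hT
    rw [acc_tr_iff (h1 h3).1]
    by_contra hc
    obtain ⟨f, rfl, hf⟩ := not_acc_iff_exists_descending_chain.1 hc
    exact h ⟨f, h3, fun i => (hf i).1, fun i => (hf i).2⟩
  · rintro h ⟨f, h3, h4, h5⟩
    have := h _ (h1 h3).2
    rw [acc_tr_iff (h1 h3).1] at this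
    exact not_acc_iff_exists_descending_chain.2 ⟨f, rfl, fun i => ⟨h4 i, h5 i⟩⟩ this

theorem mem_calculus_iff {v : Variant} {P : Term} :
    P ∈ calculus v t ↔ IsProc v P ∧ (t = .static → P.Static) := by
  cases t <;> simp [calculus]

/-! ## Guarded processes with an error barb -/

/-- A barb as a guard. -/
def Barb.guard : Barb → Prefix
  | .inl a => .inp a
  | .inr a => .out a

theorem Barb.guard_lab (e : Barb) : e.guard.lab = e.lab := by cases e <;> rfl

/-- The process `π.P`, which has the additional summand `e.0` if `b` is true. -/
def guarded (e : Barb) (b : Bool) (π : Prefix) (P : Term) : Term :=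
  .sum (.cons π P (if b then .cons e.guard .zero .nil else .nil))

variable {e : Barb} {b : Bool} {π : Prefix} {K : Term}

theorem tt_guarded {α : Lab} {Q : Tr} : TT t (guarded e b π K).tr α Q ↔
    (α = π.lab ∧ Q = K.tr) ∨ (b = true ∧ α = e.lab ∧ Q = Term.zero.tr) := by
  rw [guarded, Term.tr_sum]
  have h : TT t (.leaf (Term.sum (.cons π K (if b then .cons e.guard .zero .nil else .nil))).code)
      α Q ↔ (α, Q) ∈ acts (Term.sum (.cons π K (if b then .cons e.guard .zero .nil else .nil))).code :=
    ⟨fun h => by cases h with | leaf h => exact h, .leaf⟩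
  rw [h, mem_acts_sum]
  constructor
  · rintro ⟨ρ, P, hm, rfl, rfl⟩
    cases hm with
    | head => exact .inl ⟨rfl, rfl⟩
    | tail _ _ hm =>
      cases b with
      | false => cases hm
      | true =>
        cases hm with
        | head => exact .inr ⟨rfl, e.guard_lab, rfl⟩
        | tail _ _ hm => cases hm
  · rintro (⟨rfl, rfl⟩ | ⟨rfl, rfl, rfl⟩)
    · exact ⟨_, _, .head _ _ _, rfl, rfl⟩
    · exact ⟨_, _, .tail _ _ (.head _ _ _), e.guard_lab.symm, rfl⟩

theorem guarded_tr : (guarded e b π K).tr = .leaf (guarded e b π K).code := Term.tr_sum _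

theorem items_guarded : (guarded e b π K).tr.items = {(guarded e b π K).tr} := by
  rw [guarded_tr, Tr.items, if_neg]
  simp [guarded, Term.code, zeroCode, Term.zero, Branches.code]

theorem items_zero : Term.zero.tr.items = 0 := by
  rw [Term.zero, Term.tr_sum, Tr.items, if_pos]; rfl

theorem tbarb_guarded : TBarb t (guarded e true π K).tr e :=
  ⟨_, tt_guarded.2 (.inr ⟨rfl, rfl, rfl⟩)⟩

theorem guarded_mem {v : Variant} (hπ : IsPrefix v π) (hs : t = .static → π.Static)
    (hK : K ∈ calculus v t) (hl : K.locs = []) :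
    guarded e b π K ∈ calculus v t ∧ (guarded e b π K).locs = [] := by
  have hg : IsPrefix v e.guard := by cases e <;> constructor
  have hgs : e.guard.Static := by cases e <;> trivial
  rw [mem_calculus_iff] at hK ⊢
  refine ⟨⟨.sum (.cons hπ hK.1 ?_), fun ht => ⟨hs ht, ⟨hK.2 ht, hl⟩, ?_⟩⟩, ?_⟩
  · cases b
    · exact .nil
    · exact .cons hg (.sum .nil) .nil
  · cases b
    · trivial
    · exact ⟨hgs, ⟨trivial, rfl⟩, trivial⟩
  · cases b <;> simp [guarded, Term.locs, Branches.locs, hl, Term.zero]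

theorem zero_mem {v : Variant} : Term.zero ∈ calculus v t :=
  mem_calculus_iff.2 ⟨.sum .nil, fun _ => trivial⟩

theorem exists_guarded_code (e : Barb) (b : Bool) (π : Prefix) :
    ∃ g : ℕ → ℕ, Primrec g ∧ ∀ K : Term, (guarded e b π K).code = g K.code := by
  refine ⟨fun c => Nat.pair 3 (Nat.pair π.code (Nat.pair c
    (if b then Branches.cons e.guard .zero .nil else .nil).code) + 1), ?_, fun K => rfl⟩
  fun_prop

/-! ## Encodings of counters -/

/-- The effect of an operation on the value of its counter. -/
def Op.Eff : Op → ℕ → ℕ → Prop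
  | inc _, n, n' => n' = n + 1
  | dec _, n, n' => n = n' + 1
  | reset _, _, n' => n' = 0

theorem Op.Act.eff {o : Op} {s s' : Multiset ℕ} (h : o.Act s s') :
    o.Eff (s.count o.idx) (s'.count o.idx) ∧ ∀ j ≠ o.idx, s'.count j = s.count j := by
  cases o with
  | inc i =>
    obtain rfl : s' = i ::ₘ s := h
    exact ⟨Multiset.count_cons_self _ _, fun j hj => Multiset.count_cons_of_ne hj _⟩
  | dec i =>
    obtain rfl : s = i ::ₘ s' := h
    exact ⟨Multiset.count_cons_self _ _, fun j hj => (Multiset.count_cons_of_ne hj _).symm⟩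
  | reset i =>
    obtain rfl : s' = s.filter (· ≠ i) := h
    exact ⟨by simp [Eff, idx], fun j hj => Multiset.count_filter_of_pos hj⟩

theorem Op.Eff.exists_act {o : Op} {s : Multiset ℕ} {n : ℕ} (h : o.Eff (s.count o.idx) n) :
    ∃ s', o.Act s s' ∧ s'.count o.idx = n ∧ ∀ j ≠ o.idx, s'.count j = s.count j := by
  have key : ∀ s', o.Act s s' → (∀ n', o.Eff (s.count o.idx) n' → n' = n) →
      ∃ s', o.Act s s' ∧ s'.count o.idx = n ∧ ∀ j ≠ o.idx, s'.count j = s.count j :=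
    fun s' h' hn => ⟨s', h', hn _ h'.eff.1, h'.eff.2⟩
  cases o with
  | inc i => exact key (i ::ₘ s) rfl fun n' h' => h'.trans h.symm
  | dec i =>
    have h : s.count i = n + 1 := h
    obtain ⟨s', rfl⟩ := Multiset.exists_cons_of_mem (Multiset.count_pos.1 (by omega : 0 < s.count i))
    exact key s' rfl fun n' h' => Nat.succ.inj (h'.symm.trans h)
  | reset i => exact key (s.filter (· ≠ i)) rfl fun n' h' => h'.trans h.symm

/-- The steps of a control component and a counter. -/
def LocStep (t : Topology) (x y : Tr × Tr) : Prop :=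
  (∃ α, TT t x.1 α y.1 ∧ TT t x.2 α.dual y.2) ∨ (y.1 = x.1 ∧ TStep t x.2 y.2)

/-- The component is a leaf that interacts with nothing but counter `i`. -/
def ControlFor (t : Topology) (a i : ℕ) (κ : Tr) : Prop :=
  (∃ c, κ = .leaf c) ∧ ∀ α Q, TT t κ α Q → α.2.1 = a ∨ ∃ k, 2 ≤ k ∧ k < 8 ∧ α.2.1 = nm a k i

/-- All interactions of the control component with counter `i` lead to a goal, or get stuck. -/
inductive Leads (t : Topology) (a i : ℕ) (goal : Tr × Tr → Prop) : Tr × Tr → Prop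
  | goal {x : Tr × Tr} : goal x → Leads t a i goal x
  | step {x : Tr × Tr} : ControlFor t a i x.1 → Owned t a i x.2 →
      (∀ y, LocStep t x y → y.1.items = {y.1}) → (∀ y, LocStep t x y → Leads t a i goal y) →
      Leads t a i goal x

/-- The steps of a control component and a counter, through error states if `b` is true. -/
def BarbStep (t : Topology) (e : Barb) (b : Bool) (x y : Tr × Tr) : Prop :=
  LocStep t x y ∧ x.1.items = {x.1} ∧ y.1.items = {y.1} ∧ (b = true → TBarb t x.1 e)

/-- An encoding of counters and their operations in a calculus. -/
structure Coding (v : Variant) (t : Topology) (e : Barb) where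
  /-- The process that executes an operation and continues as a given process. -/
  pre : Bool → Op → Term → Term
  pre_guarded : ∀ b o K, ∃ π P, pre b o K = guarded e b π P ∧
    ∃ k, 2 ≤ k ∧ k < 8 ∧ π.lab.2.1 = nm e.name k o.idx
  /-- `IsReg i n ρ`: the contents `ρ` of the component for counter `i` represent the value `n`. -/
  IsReg : ℕ → ℕ → Tr → Prop
  /-- The initial contents of the component for a counter. -/
  reg : ℕ → Term
  isReg_reg : ∀ i, IsReg i 0 (reg i).tr
  owned : ∀ {i n ρ}, IsReg i n ρ → Owned t e.name i ρ
  quiet : ∀ {i n ρ ρ'}, IsReg i n ρ → ¬ TStep t ρ ρ'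
  inc_step : ∀ {b i n ρ K y}, IsReg i n ρ → LocStep t ((pre b (.inc i) K).tr, ρ) y →
    y.1 = K.tr ∧ IsReg i (n + 1) y.2
  sound : ∀ {b o n ρ b' π P}, IsReg o.idx n ρ → Leads t e.name o.idx
    (fun y => y.1 = (guarded e b' π P).tr ∧ ∃ n', o.Eff n n' ∧ IsReg o.idx n' y.2)
    ((pre b o (guarded e b' π P)).tr, ρ)
  complete : ∀ {b o n n' ρ b' π P}, IsReg o.idx n ρ → o.Eff n n' → ∃ ρ', IsReg o.idx n' ρ' ∧
    TransGen (BarbStep t e b) ((pre b o (guarded e b' π P)).tr, ρ) ((guarded e b' π P).tr, ρ')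
  code : ∀ b o, ∃ g : ℕ → ℕ, Primrec g ∧ ∀ K : Term, (pre b o K).code = g K.code
  pre_mem : ∀ {b o K}, K ∈ calculus v t → K.locs = [] →
    pre b o K ∈ calculus v t ∧ (pre b o K).locs = []
  reg_mem : ∀ i, reg i ∈ calculus v t

namespace Coding

variable {v : Variant} (C : Coding v t e)

/-- The control component that executes a list of operations and enters the control state `q`;
it is an error state if `b` is true. -/
def ctl (b : Bool) : List Op → ℕ → Term
  | [], q => guarded e b (.out (nm e.name 0 q)) .zero
  | o :: w, q => C.pre b o (ctl b w q)

theorem ctl_guarded (b : Bool) (w : List Op) (q : ℕ) : ∃ π P, C.ctl b w q = guarded e b π P := by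
  cases w with
  | nil => exact ⟨_, _, rfl⟩
  | cons o w => obtain ⟨π, P, h, -⟩ := C.pre_guarded b o (C.ctl b w q); exact ⟨π, P, h⟩

theorem control (b : Bool) (o : Op) (K : Term) : ControlFor t e.name o.idx (C.pre b o K).tr := by
  obtain ⟨π, P, h, h'⟩ := C.pre_guarded b o K
  rw [h]
  refine ⟨⟨_, guarded_tr⟩, fun α Q hQ => ?_⟩
  rcases tt_guarded.1 hQ with ⟨rfl, -⟩ | ⟨-, rfl, -⟩
  · exact .inr h'
  · exact .inl rfl

/-- The control component on the way to `q`; all control states but `0` are error states. -/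
def control' (w : List Op) (q : ℕ) : Term := C.ctl (decide (q ≠ 0)) w q

/-- The component for a rule. -/
def rule (r : Rule) : Term := .repl (.inp (nm e.name 0 r.1)) (C.control' r.2.1 r.2.2)

theorem tt_rule {r : Rule} {α : Lab} {Q : Tr} : TT t (C.rule r).tr α Q ↔
    α = (0, nm e.name 0 r.1, .leaf 0) ∧
      Q = .par (C.control' r.2.1 r.2.2).tr (C.rule r).tr := by
  rw [rule, Term.tr_repl]
  have h : ∀ c, TT t (.leaf c) α Q ↔ (α, Q) ∈ acts c := fun c =>
    ⟨fun h => by cases h with | leaf h => exact h, .leaf⟩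
  rw [h, acts_repl]
  simp [Prefix.lab]

theorem items_rule (r : Rule) : (C.rule r).tr.items = {(C.rule r).tr} := by
  rw [rule, Term.tr_repl, Tr.items, if_neg]
  simp [Term.code, zeroCode, Term.zero, Branches.code]

/-- The components for rules. -/
def ruleItems (R : List Rule) : Multiset Tr := (R : Multiset Rule).map fun r => (C.rule r).tr

theorem isRule_of_mem {R : List Rule} : ∀ r ∈ C.ruleItems R, IsRule t e.name r := by
  intro r hr
  obtain ⟨r, -, rfl⟩ := Multiset.mem_map.1 hr
  refine ⟨⟨_, Term.tr_repl _ _⟩, fun α Q h => ?_⟩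
  rw [(C.tt_rule.1 h).1]
  exact ⟨rfl, _, rfl⟩

/-- The tree represents the state of a machine with rules `R` which still has to execute `w` before
it enters the control state `q`. -/
def Sim (m : ℕ) (R : List Rule) (w : List Op) (q : ℕ) (s : Multiset ℕ) (P : Tr) : Prop :=
  ∃ ρ : ℕ → Tr, (∀ i < m, C.IsReg i (s.count i) (ρ i)) ∧
    IsWorld e.name m (C.ruleItems R) (C.control' w q).tr ρ P

variable {C} {m : ℕ} {R : List Rule}

/-- The output that announces `q` can only meet the input of a rule for `q`. The alternative summand
of the control component finds no partner, because nothing else acts at the name of the barb. -/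
theorem Sim.step_nil {q : ℕ} {s : Multiset ℕ} {P P' : Tr} (h : C.Sim m R [] q s P)
    (hP : TStep t P P') : ∃ w q', (q, w, q') ∈ R ∧ C.Sim m R w q' s P' := by
  obtain ⟨ρ, h1, h2⟩ := h
  have hlab : ∀ α Q, TT t (C.control' [] q).tr α Q →
      (α = (1, nm e.name 0 q, .leaf 0) ∧ Q = Term.zero.tr) ∨ α = e.lab := by
    intro α Q h
    rcases tt_guarded.1 h with h | ⟨-, h, -⟩
    · exact .inl h
    · exact .inr h
  rcases h2.step_cases ⟨_, guarded_tr⟩ C.isRule_of_mem (fun i hi => C.owned (h1 i hi)) (by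
    intro α Q i h
    rcases hlab α Q h with ⟨rfl, -⟩ | rfl
    · intro h; have := (nm_inj (by omega) (by omega) h).1; omega
    · exact nm_ne.symm) hP with
    ⟨α, r, κ', r', S, h3, h4, h5, h6⟩ | ⟨i, hi, α, κ', ρ', h4, h5, h6⟩ | ⟨i, hi, ρ', h3, -⟩
  · obtain ⟨r, hr, rfl⟩ := Multiset.mem_map.1
      (show _ ∈ C.ruleItems R by rw [h3]; exact Multiset.mem_cons_self _ _)
    obtain ⟨h7, rfl⟩ := C.tt_rule.1 h5
    rcases hlab _ _ h4 with ⟨rfl, rfl⟩ | rfl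
    · simp only [Lab.dual, Prod.mk.injEq] at h7
      have hq := (nm_inj (by omega) (by omega) h7.2.1).2
      refine ⟨r.2.1, r.2.2, by rw [hq]; exact hr, ρ, h1, ?_⟩
      obtain ⟨π, K, hK⟩ := C.ctl_guarded (decide (r.2.2 ≠ 0)) r.2.1 r.2.2
      have hK' : (C.control' r.2.1 r.2.2).tr.items = {(C.control' r.2.1 r.2.2).tr} := by
        rw [control', hK]; exact items_guarded
      rw [IsWorld, h6, h3, items_zero, Tr.items, C.items_rule, hK']
      simp only [← Multiset.singleton_add]
      abel
    · exact absurd (congrArg (·.2.1) h7) nm_ne.symm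
  · obtain ⟨k, hk, hk', hk''⟩ := C.owned (h1 i hi) _ _ h5
    rcases hlab _ _ h4 with ⟨rfl, -⟩ | rfl
    · have := (nm_inj (by omega) hk' hk'').1; omega
    · exact absurd hk''.symm nm_ne
  · exact absurd h3 (C.quiet (h1 i hi))

/-- The interactions of a control component for counter `i` are local steps. -/
theorem IsWorld.local_step {a i : ℕ} {rules : Multiset Tr} {κ P P' : Tr} {ρ : ℕ → Tr}
    (h : IsWorld a m rules κ ρ P) (hr : ∀ r ∈ rules, IsRule t a r)
    (hρ : ∀ j < m, Owned t a j (ρ j)) (hq : ∀ j < m, j ≠ i → ∀ ρ', ¬ TStep t (ρ j) ρ')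
    (hκ : ControlFor t a i κ) (hi : ∀ y, LocStep t (κ, ρ i) y → y.1.items = {y.1})
    (hP : TStep t P P') :
    ∃ y, LocStep t (κ, ρ i) y ∧ IsWorld a m rules y.1 (Function.update ρ i y.2) P' := by
  rcases h.step_cases hκ.1 hr hρ (by
    intro α Q j h
    rcases hκ.2 α Q h with h | ⟨k, hk, hk', h⟩
    · rw [h]; exact nm_ne.symm
    · rw [h]; intro h; have := (nm_inj hk' (by omega) h).1; omega) hP with
    ⟨α, r, κ', r', S, h3, h4, h5, h6⟩ | ⟨j, hj, α, κ', ρ', h4, h5, h6⟩ | ⟨j, hj, ρ', h3, h4⟩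
  · obtain ⟨-, q, hq⟩ := (hr r (by simp [h3])).2 _ _ h5
    rcases hκ.2 _ _ h4 with h | ⟨k, hk, hk', h⟩
    · exact absurd (hq.symm.trans h) nm_ne
    · have := (nm_inj hk' (by omega) (h.symm.trans hq)).1; omega
  · obtain ⟨k, hk, hk', hk''⟩ := hρ j hj _ _ h5
    rcases hκ.2 _ _ h4 with h | ⟨k1, hk1, hk1', h⟩
    · exact absurd (hk''.symm.trans h) nm_ne
    · obtain rfl := (nm_inj hk1' hk' (h.symm.trans hk'')).2
      have hy : LocStep t (κ, ρ i) (κ', ρ') := .inl ⟨_, h4, h5⟩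
      refine ⟨_, hy, ?_⟩
      rw [IsWorld, h6, hi _ hy, Multiset.singleton_add]
  · by_cases hji : j = i
    · subst hji
      exact ⟨(κ, ρ'), .inr ⟨rfl, h3⟩, h4⟩
    · exact absurd h3 (hq j hj hji ρ')

/-- Induction on `Leads`: being inductive, it excludes an infinite dialogue with the counter, and
dialogues that get stuck are harmless. Arriving at a goal means that the operation has been
executed. -/
theorem Sim.safe_cons {o : Op} {w : List Op} {q : ℕ} {s : Multiset ℕ} {P : Tr} (ho : o.idx < m)
    (h : C.Sim m R (o :: w) q s P)
    (hs : ∀ s' P', o.Act s s' → C.Sim m R w q s' P' → Safe t e P') : Safe t e P := by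
  obtain ⟨ρ, h1, h2⟩ := h
  obtain ⟨π, K, hK⟩ := C.ctl_guarded (decide (q ≠ 0)) w q
  have hL := C.sound (b := decide (q ≠ 0)) (b' := decide (q ≠ 0)) (π := π) (P := K) (h1 _ ho)
  have h2 : IsWorld e.name m (C.ruleItems R) ((C.pre (decide (q ≠ 0)) o (C.ctl (decide (q ≠ 0)) w q))).tr
    ρ P := h2
  rw [hK] at h2
  have key : ∀ x, Leads t e.name o.idx (fun y => y.1 = (guarded e (decide (q ≠ 0)) π K).tr ∧
      ∃ n', o.Eff (s.count o.idx) n' ∧ C.IsReg o.idx n' y.2) x → ∀ ρ : ℕ → Tr, ∀ P,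
      (∀ j < m, j ≠ o.idx → C.IsReg j (s.count j) (ρ j)) → ρ o.idx = x.2 →
      IsWorld e.name m (C.ruleItems R) x.1 ρ P → Safe t e P := by
    intro x hx
    induction hx with
    | goal hx =>
      rename_i x
      intro ρ P h3 h4 h5
      obtain ⟨h6, n', h7, h8⟩ := hx
      obtain ⟨s', h9, rfl, h11⟩ := h7.exists_act
      refine hs s' P h9 ⟨ρ, fun i hi => ?_, ?_⟩
      · by_cases hio : i = o.idx
        · subst hio; rwa [h4]
        · rw [h11 i hio]; exact h3 i hi hio
      · rw [control', hK, ← h6]; exact h5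
    | step hx1 hx2 hx3 _ ih =>
      rename_i x _
      obtain ⟨κ, ρi⟩ := x
      intro ρ P h3 h4 h5
      simp only at h4
      subst h4
      refine Safe.intro fun P' hP' => ?_
      obtain ⟨y, h6, h7⟩ := IsWorld.local_step h5 C.isRule_of_mem (fun j hj => by
        by_cases hjo : j = o.idx
        · subst hjo; exact hx2
        · exact C.owned (h3 j hj hjo)) (fun j hj hjo ρ' => C.quiet (h3 j hj hjo)) hx1 hx3 hP'
      refine ih y h6 _ P' (fun j hj hjo => ?_) (Function.update_self _ _ _) h7
      rw [Function.update_of_ne hjo]; exact h3 j hj hjo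
  exact key _ hL ρ P (fun j hj _ => h1 j hj) rfl h2

theorem Sim.safe_run {w : List Op} {q : ℕ} (hw : ∀ o ∈ w, o.idx < m) {s : Multiset ℕ} {P : Tr}
    (h : C.Sim m R w q s P)
    (hs : ∀ s' P', Run Op.Act w s s' → C.Sim m R [] q s' P' → Safe t e P') : Safe t e P := by
  induction w generalizing s P with
  | nil => exact hs s P rfl h
  | cons o w ih =>
    exact h.safe_cons (hw o (.head _)) fun s' P' h1 h2 =>
      ih (fun o ho => hw o (.tail _ ho)) h2 fun s'' P'' h3 h4 => hs _ _ ⟨_, h1, h3⟩ h4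

/-- The rules of the generation phase. -/
def genRules : List Rule := [(0, [.inc 0], 0), (0, [], 1)]

/-- Well-founded induction along the machine: a reduction picks a rule, and the operations of the
rule are then executed in their lossy semantics, which is a machine step. Rules of the generation
phase do not apply outside control state `0`. -/
theorem Sim.safe (hR : ∀ r ∈ R, r.1 ≠ 0 ∧ r.2.2 ≠ 0 ∧ ∀ o ∈ r.2.1, o.idx < m)
    {q : ℕ} {s : Multiset ℕ} (hacc : Acc (fun y x => MStep R x y) (q, s)) (hq : q ≠ 0) {P : Tr}
    (h : C.Sim m (genRules ++ R) [] q s P) : Safe t e P := by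
  generalize hx : (q, s) = x at hacc
  induction hacc generalizing q s P with
  | intro x _ ih =>
    subst hx
    refine Safe.intro fun P' hP' => ?_
    obtain ⟨w, q', hr, h'⟩ := h.step_nil hP'
    have hr : (q, w, q') ∈ R := by
      rcases List.mem_append.1 hr with hr | hr
      · simp [genRules, hq] at hr
      · exact hr
    obtain ⟨-, h2, h3⟩ := hR _ hr
    exact h'.safe_run h3 fun s' P' h4 h5 => ih (q', s') ⟨w, hr, h4⟩ h2 h5 rfl

/-- On the way to control state `0` the control component carries no error summand. -/
theorem Sim.not_barb {w : List Op} {s : Multiset ℕ} {P : Tr} (h : C.Sim m R w 0 s P) :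
    ¬ TBarb t P e := by
  obtain ⟨ρ, h1, h2⟩ := h
  refine h2.not_barb C.isRule_of_mem (fun i hi => C.owned (h1 i hi)) ?_
  rintro ⟨Q, hQ⟩
  cases w with
  | nil =>
    rcases tt_guarded.1 hQ with ⟨h, -⟩ | ⟨h, -⟩
    · exact nm_ne (congrArg (·.2.1) h).symm
    · simp at h
  | cons o w =>
    obtain ⟨π, K, hK, k, -, -, hk⟩ := C.pre_guarded (decide (0 ≠ 0)) o (C.ctl (decide (0 ≠ 0)) w 0)
    rw [control', ctl, hK] at hQ
    rcases tt_guarded.1 hQ with ⟨h, -⟩ | ⟨h, -⟩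
    · rw [← h] at hk; exact nm_ne hk.symm
    · simp at h

/-- The generation phase has to be followed reduction by reduction, since its computations may be
infinite. This is why an encoding must perform increments in a single step. -/
theorem Sim.step_inc {i : ℕ} (hi : i < m) {w : List Op} {q : ℕ} {s : Multiset ℕ} {P P' : Tr}
    (h : C.Sim m R (.inc i :: w) q s P) (hP : TStep t P P') : C.Sim m R w q (i ::ₘ s) P' := by
  obtain ⟨ρ, h1, h2⟩ := h
  obtain ⟨π, K, hK⟩ := C.ctl_guarded (decide (q ≠ 0)) w q
  have hκ := C.control (decide (q ≠ 0)) (.inc i) (C.ctl (decide (q ≠ 0)) w q)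
  obtain ⟨y, h3, h4⟩ := IsWorld.local_step h2 C.isRule_of_mem (fun j hj => C.owned (h1 j hj))
    (fun j hj _ ρ' => C.quiet (h1 j hj)) hκ (fun y hy => by
      rw [(C.inc_step (h1 i hi) hy).1, hK]; exact items_guarded) hP
  obtain ⟨h5, h6⟩ := C.inc_step (h1 i hi) h3
  refine ⟨_, fun j hj => ?_, h5 ▸ h4⟩
  change C.IsReg j _ (Function.update ρ i y.2 j)
  by_cases hji : j = i
  · subst hji; rwa [Function.update_self, Multiset.count_cons_self]
  · rw [Function.update_of_ne hji, Multiset.count_cons_of_ne hji]; exact h1 j hj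

/-- Trees reached while the supply is generated are no error states, so no sequence of error states
starts there; endless generation is harmless. -/
theorem safe_of_gen (hm : 0 < m) (hR : ∀ r ∈ R, r.1 ≠ 0)
    (hS : ∀ s P, C.Sim m (genRules ++ R) [] 1 s P → Safe t e P) {s : Multiset ℕ} {P : Tr}
    (h : C.Sim m (genRules ++ R) [] 0 s P) : Safe t e P := by
  suffices H : ∀ Q, ReflTransGen (TStep t) P Q → (∃ s, C.Sim m (genRules ++ R) [] 0 s Q ∨
      C.Sim m (genRules ++ R) [.inc 0] 0 s Q) ∨ Safe t e Q by
    intro Q hQ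
    rcases H Q hQ with ⟨s, h | h⟩ | h
    · exact ⟨_, fun y hy => absurd hy.2 h.not_barb⟩
    · exact ⟨_, fun y hy => absurd hy.2 h.not_barb⟩
    · exact h Q .refl
  intro Q hQ
  induction hQ with
  | refl => exact .inl ⟨s, .inl h⟩
  | @tail Q Q' _ hQ ih =>
    rcases ih with ⟨s, h | h⟩ | h
    · obtain ⟨w, q', hr, h'⟩ := h.step_nil hQ
      rcases List.mem_append.1 hr with hr | hr
      · simp only [genRules, List.mem_cons, Prod.mk.injEq, true_and, List.not_mem_nil,
          or_false] at hr
        rcases hr with ⟨rfl, rfl⟩ | ⟨rfl, rfl⟩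
        · exact .inl ⟨s, .inr h'⟩
        · exact .inr (hS _ _ h')
      · exact absurd rfl (hR _ hr)
    · exact .inl ⟨_, .inl (h.step_inc hm hQ)⟩
    · exact .inr fun Q'' hQ'' => h Q'' (.head hQ hQ'')

/-! ### From machines to processes -/

/-- The steps of trees, from error states if `b` is true. -/
def _root_.Evol.ErrStep (t : Topology) (e : Barb) (b : Bool) (P P' : Tr) : Prop :=
  TStep t P P' ∧ (b = true → TBarb t P e)

theorem Sim.exists_step_nil {q q' : ℕ} {w : List Op} {s : Multiset ℕ} {P : Tr}
    (h : C.Sim m R [] q s P) (hr : (q, w, q') ∈ R) :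
    ∃ P', ErrStep t e (decide (q ≠ 0)) P P' ∧ C.Sim m R w q' s P' := by
  obtain ⟨ρ, h1, h2⟩ := h
  have hmem : (C.rule (q, w, q')).tr ∈ C.ruleItems R := Multiset.mem_map_of_mem _ hr
  obtain ⟨S, hS⟩ := Multiset.exists_cons_of_mem hmem
  have hbarb : decide (q ≠ 0) = true → TBarb t P e := by
    intro hb
    refine h2.barb ?_
    rw [control', hb]
    exact tbarb_guarded
  have h3 := h2
  rw [hS] at h3
  obtain ⟨P', h4, h5⟩ := IsWorld.sync_rule h3 (tt_guarded.2 (.inl ⟨rfl, rfl⟩)) (C.tt_rule.2 ⟨rfl, rfl⟩)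
  refine ⟨P', ⟨h4, hbarb⟩, ρ, h1, ?_⟩
  obtain ⟨π, K, hK⟩ := C.ctl_guarded (decide (q' ≠ 0)) w q'
  have hK' : (C.control' w q').tr.items = {(C.control' w q').tr} := by
    rw [control', hK]; exact items_guarded
  rw [IsWorld, h5, hS, items_zero, Tr.items, C.items_rule, hK']
  simp only [← Multiset.singleton_add]
  abel

theorem IsWorld.lift {a i : ℕ} {rules : Multiset Tr} {b : Bool} (hi : i < m) {x y : Tr × Tr}
    (hxy : BarbStep t e b x y) {ρ : ℕ → Tr} {P : Tr} (h : IsWorld a m rules x.1 ρ P)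
    (hx : ρ i = x.2) : ∃ P', ErrStep t e b P P' ∧
      IsWorld a m rules y.1 (Function.update ρ i y.2) P' := by
  obtain ⟨κ, ρi⟩ := x
  obtain ⟨κ', ρi'⟩ := y
  obtain ⟨h1, h2, h3, h4⟩ := hxy
  simp only at hx h1 h2 h3 h4 h
  subst hx
  rcases h1 with ⟨α, h5, h6⟩ | ⟨h5, h6⟩
  · obtain ⟨P', h7, h8⟩ := h.sync_reg hi h5 h6
    refine ⟨P', ⟨h7, fun hb => h.barb (h4 hb)⟩, ?_⟩
    rw [IsWorld, h8, h3, Multiset.singleton_add]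
  · simp only at h5
    subst h5
    obtain ⟨P', h7, h8⟩ := h.step_reg hi h6
    exact ⟨P', ⟨h7, fun hb => h.barb (h4 hb)⟩, h8⟩

theorem Sim.exists_step_cons {o : Op} {q : ℕ} {w : List Op} {s s' : Multiset ℕ} {P : Tr}
    (ho : o.idx < m) (h : C.Sim m R (o :: w) q s P) (hs : o.Act s s') :
    ∃ P', ReflTransGen (ErrStep t e (decide (q ≠ 0))) P P' ∧ C.Sim m R w q s' P' := by
  obtain ⟨ρ, h1, h2⟩ := h
  obtain ⟨π, K, hK⟩ := C.ctl_guarded (decide (q ≠ 0)) w q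
  obtain ⟨ρ', h3, h4⟩ := C.complete (b := decide (q ≠ 0)) (b' := decide (q ≠ 0)) (π := π) (P := K)
    (h1 _ ho) hs.eff.1
  rw [control', ctl, hK] at h2
  have key : ∀ y, TransGen (BarbStep t e (decide (q ≠ 0)))
      ((C.pre (decide (q ≠ 0)) o (guarded e (decide (q ≠ 0)) π K)).tr, ρ o.idx) y →
      ∃ P', ReflTransGen (ErrStep t e (decide (q ≠ 0))) P P' ∧
        IsWorld e.name m (C.ruleItems R) y.1 (Function.update ρ o.idx y.2) P' := by
    intro y hy
    induction hy with
    | single hy =>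
      obtain ⟨P', h5, h6⟩ := IsWorld.lift ho hy h2 rfl
      exact ⟨P', .single h5, h6⟩
    | tail _ hy ih =>
      obtain ⟨P', h5, h6⟩ := ih
      obtain ⟨P'', h7, h8⟩ := IsWorld.lift ho hy h6 (Function.update_self _ _ _)
      exact ⟨P'', h5.tail h7, by rwa [Function.update_idem] at h8⟩
  obtain ⟨P', h5, h6⟩ := key _ h4
  refine ⟨P', h5, _, fun j hj => ?_, by rw [control', hK]; exact h6⟩
  by_cases hjo : j = o.idx
  · subst hjo; rwa [Function.update_self]
  · rw [Function.update_of_ne hjo, hs.eff.2 j hjo]; exact h1 j hj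

theorem Sim.exists_run {q : ℕ} {w : List Op} (hw : ∀ o ∈ w, o.idx < m) {s s' : Multiset ℕ} {P : Tr}
    (h : C.Sim m R w q s P) (hs : Run Op.Act w s s') :
    ∃ P', ReflTransGen (ErrStep t e (decide (q ≠ 0))) P P' ∧ C.Sim m R [] q s' P' := by
  induction w generalizing s P with
  | nil => obtain rfl : s' = s := hs; exact ⟨P, .refl, h⟩
  | cons o w ih =>
    obtain ⟨u, h1, h2⟩ := hs
    obtain ⟨P', h3, h4⟩ := h.exists_step_cons (hw o (.head _)) h1
    obtain ⟨P'', h5, h6⟩ := ih (fun o ho => hw o (.tail _ ho)) h4 h2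
    exact ⟨P'', h3.trans h5, h6⟩

/-- A machine step is matched by one or more reductions, all starting in error states: the choice of
the rule and the dialogues with the counters. So termination of the sequences of error states gives
termination of the machine. -/
theorem Sim.acc (hR : ∀ r ∈ R, r.1 ≠ 0 ∧ r.2.2 ≠ 0 ∧ ∀ o ∈ r.2.1, o.idx < m)
    {P : Tr} (hacc : Acc (fun y x => TStep t x y ∧ TBarb t x e) P)
    {q : ℕ} {s : Multiset ℕ} (hq : q ≠ 0) (h : C.Sim m (genRules ++ R) [] q s P) :
    Acc (fun y x => MStep R x y) (q, s) := by
  -- A machine step takes several reductions, so the induction is along their transitive closure.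
  replace hacc := hacc.transGen
  induction hacc generalizing q s with
  | intro P _ ih =>
    refine ⟨_, ?_⟩
    rintro ⟨q', s'⟩ ⟨w, hr, hw⟩
    obtain ⟨P', h1, h2⟩ := h.exists_step_nil (List.mem_append_right _ hr)
    obtain ⟨P'', h3, h4⟩ := h2.exists_run (hR _ hr).2.2 hw
    have hq' : decide (q ≠ 0) = true := by simpa using hq
    have hq'' : decide (q' ≠ 0) = true := by simpa using (hR _ hr).2.1
    rw [hq'] at h1
    rw [hq''] at h3
    have h5 : TransGen (ErrStep t e true) P P'' := .head' h1 h3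
    refine ih P'' ?_ (hR _ hr).2.1 h4
    clear h3 h4 ih
    induction h5 with
    | single h => exact .single ⟨h.1, h.2 rfl⟩
    | tail _ h ih => exact .head ⟨h.1, h.2 rfl⟩ ih

theorem Sim.exists_gen (hm : 0 < m) {P : Tr} (h : C.Sim m (genRules ++ R) [] 0 0 P) (N : ℕ) :
    ∃ P', ReflTransGen (TStep t) P P' ∧ C.Sim m (genRules ++ R) [] 1 (.replicate N 0) P' := by
  have key : ∃ P', ReflTransGen (TStep t) P P' ∧
      C.Sim m (genRules ++ R) [] 0 (.replicate N 0) P' := by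
    induction N with
    | zero => exact ⟨P, .refl, h⟩
    | succ N ih =>
      obtain ⟨P1, h1, h2⟩ := ih
      obtain ⟨P2, h3, h4⟩ := h2.exists_step_nil (w := [.inc 0]) (q' := 0) (by simp [genRules])
      obtain ⟨P3, h5, h6⟩ := h4.exists_run (s' := .replicate (N + 1) 0) (by simpa [Op.idx] using hm)
        ⟨_, rfl, Multiset.replicate_succ _ _⟩
      exact ⟨P3, (h1.tail h3.1).trans (ReflTransGen.mono (fun _ _ h => h.1) _ _ h5), h6⟩
  obtain ⟨P1, h1, h2⟩ := key
  obtain ⟨P2, h3, h4⟩ := h2.exists_step_nil (w := []) (q' := 1) (by simp [genRules])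
  exact ⟨P2, h1.tail h3.1, h4⟩

/-! ### The processes -/

/-- Parallel composition. -/
def parList : List Term → Term
  | [] => .zero
  | P :: L => .par P (parList L)

theorem items_parList (L : List Term) : (parList L).tr.items = (L.map fun P => P.tr.items).sum := by
  induction L with
  | nil => exact items_zero
  | cons P L ih => rw [parList, Term.tr_par, Tr.items, ih]; rfl

theorem parList_mem {L : List Term} (h : ∀ P ∈ L, P ∈ calculus v t) : parList L ∈ calculus v t := by
  induction L with
  | nil => exact zero_mem
  | cons P L ih =>
    have h1 := mem_calculus_iff.1 (h P (.head _))
    have h2 := mem_calculus_iff.1 (ih fun Q hQ => h Q (.tail _ hQ))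
    exact mem_calculus_iff.2 ⟨.par h1.1 h2.1, fun ht => ⟨h1.2 ht, h2.2 ht⟩⟩

variable (C) in
/-- The process for a machine. -/
def process (m : ℕ) (R : List Rule) : Term :=
  parList (C.control' [] 0 :: (R.map C.rule ++
    (List.range m).map fun i => .loc (nm e.name 1 i) (C.reg i)))

theorem sim_process (m : ℕ) (R : List Rule) : C.Sim m R [] 0 0 (C.process m R).tr := by
  refine ⟨fun i => (C.reg i).tr, fun i _ => by simpa using C.isReg_reg i, ?_⟩
  have h1 : (C.control' [] 0).tr.items = {(C.control' [] 0).tr} := items_guarded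
  have h2 : ((R.map C.rule).map fun P => P.tr.items).sum = C.ruleItems R := by
    induction R with
    | nil => rfl
    | cons r R ih =>
      rw [List.map_cons, List.map_cons, List.sum_cons, ih, C.items_rule]; rfl
  have h3 : ∀ L : List ℕ, ((L.map fun i => Term.loc (nm e.name 1 i) (C.reg i)).map
      fun P => P.tr.items).sum = (L : Multiset ℕ).map fun i => .loc (nm e.name 1 i) (C.reg i).tr := by
    intro L
    induction L with
    | nil => rfl
    | cons i L ih =>
      rw [List.map_cons, List.map_cons, List.sum_cons, ih, Term.tr_loc]; rfl
  rw [IsWorld, process, items_parList, List.map_cons, List.sum_cons, List.map_append, List.sum_append,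
    h1, h2, h3, Multiset.singleton_add]
  rfl

theorem ctl_mem (b : Bool) (w : List Op) (q : ℕ) :
    C.ctl b w q ∈ calculus v t ∧ (C.ctl b w q).locs = [] := by
  induction w with
  | nil => exact guarded_mem (.out _) (fun _ => trivial) zero_mem rfl
  | cons o w ih => exact C.pre_mem ih.1 ih.2

theorem process_mem (m : ℕ) (R : List Rule) : C.process m R ∈ calculus v t := by
  refine parList_mem fun P hP => ?_
  rcases List.mem_cons.1 hP with rfl | hP
  · exact (C.ctl_mem _ _ _).1
  rcases List.mem_append.1 hP with hP | hP
  · obtain ⟨r, -, rfl⟩ := List.mem_map.1 hP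
    obtain ⟨h1, h2⟩ := C.ctl_mem (decide (r.2.2 ≠ 0)) r.2.1 r.2.2
    rw [mem_calculus_iff] at h1
    exact mem_calculus_iff.2 ⟨.repl (.inp _) h1.1, fun ht => ⟨trivial, h1.2 ht, h2⟩⟩
  · obtain ⟨i, -, rfl⟩ := List.mem_map.1 hP
    have h := mem_calculus_iff.1 (C.reg_mem i)
    exact mem_calculus_iff.2 ⟨.loc _ h.1, h.2⟩

variable (C) in
theorem primrec_ctl_load (b : Bool) (w : List Op) (q : ℕ) :
    Primrec fun n => (C.ctl b (w ++ load n) q).code := by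
  induction w with
  | nil =>
    obtain ⟨g, hg, hg'⟩ := C.code b (.dec 0)
    obtain ⟨h, hh, hh'⟩ := C.code b (.inc 2)
    refine (Primrec.nat_rec₁ (f := fun _ c => g (h c)) (C.ctl b [] q).code
      ((hg.comp (hh.comp Primrec.snd)).to₂)).of_eq fun n => ?_
    induction n with
    | zero => rfl
    | succ n ih => simp only [List.nil_append, load, ctl, hg', hh'] at ih ⊢; rw [ih]
  | cons o w ih =>
    obtain ⟨g, hg, hg'⟩ := C.code b o
    exact (hg.comp ih).of_eq fun n => (hg' _).symm

variable (C) in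
-- The input occurs only in the sequence that loads it, and prefixing an operation acts on codes by
-- a primitive recursive function.
theorem primrec_process (m : ℕ) (R : List Rule) (w : List Op) (q : ℕ) :
    Primrec fun n => (C.process m (genRules ++ (1, w ++ load n, q) :: R)).code := by
  have h := C.primrec_ctl_load (decide (q ≠ 0)) w q
  simp only [process, genRules, List.cons_append, List.nil_append, List.map_cons, parList,
    Term.code, rule, control', Prefix.code]
  fun_prop

/-- A decision procedure composed with the computable construction of the process would decide `K`.
If `K n` holds, some supply lets the machine diverge through error states; if not, the machine
terminates from every state. -/
theorem not_eventualAdaptationDecidable (C : Coding v t e) :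
    ¬ EventualAdaptationDecidable v t e := by
  rintro ⟨f, hf, h⟩
  obtain ⟨K, R, w, q, m, hK, hm, hq, hw, hR, hKR⟩ := exists_undecidable_machine
  have hload : ∀ n, ∀ o ∈ load n, o.idx < m := by
    intro n
    induction n with
    | zero => simp [load]
    | succ n ih => simp only [load, List.forall_mem_cons, Op.idx]; exact ⟨by omega, hm, ih⟩
  have hR' : ∀ n, ∀ r ∈ (1, w ++ load n, q) :: R,
      r.1 ≠ 0 ∧ r.2.2 ≠ 0 ∧ ∀ o ∈ r.2.1, o.idx < m := by
    intro n r hr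
    rcases List.mem_cons.1 hr with rfl | hr
    · refine ⟨one_ne_zero, hq, fun o ho => ?_⟩
      rcases List.mem_append.1 ho with ho | ho
      · exact hw o ho
      · exact hload n o ho
    · exact hR r hr
  have key : ∀ n, f (C.process m (genRules ++ (1, w ++ load n, q) :: R)).code = true ↔ ¬ K n := by
    intro n
    have hmem := C.process_mem m (genRules ++ (1, w ++ load n, q) :: R)
    refine (h _ hmem).trans ((eventualAdaptation_iff (good_of_mem_calculus hmem)).trans ?_)
    have hsim := C.sim_process m (genRules ++ (1, w ++ load n, q) :: R)
    constructor
    · intro hs hn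
      obtain ⟨N, hN⟩ := (hKR n).1 hn
      obtain ⟨P, h1, h2⟩ := hsim.exists_gen (by omega) N
      exact hN (h2.acc (hR' n) (hs P h1) one_ne_zero)
    · intro hn
      exact safe_of_gen (by omega) (fun r hr => (hR' n r hr).1)
        (fun s P h' => h'.safe (hR' n) ((hKR n).2 hn _) one_ne_zero) hsim
  refine hK (ComputablePred.computable_iff.2 ⟨fun n =>
    !f (C.process m (genRules ++ (1, w ++ load n, q) :: R)).code,
    Primrec.not.to_comp.comp (hf.comp (C.primrec_process m R w q).to_comp), ?_⟩)
  funext n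
  rw [← iff_iff_eq]
  have := key n
  by_cases hn : K n <;> simp [hn] at this ⊢ <;> exact this

end Coding

end

end Evol

-- Undecidability: counters for the static topology.

namespace Evol

/-! ## Local steps of guarded control components -/

section

variable {t : Topology} {e : Barb} {b : Bool} {π : Prefix} {K : Term}

theorem controlFor_guarded {i : ℕ} (h : ∃ k, 2 ≤ k ∧ k < 8 ∧ π.lab.2.1 = nm e.name k i) :
    ControlFor t e.name i (guarded e b π K).tr := by
  refine ⟨⟨_, guarded_tr⟩, fun α Q hQ => ?_⟩
  rcases tt_guarded.1 hQ with ⟨rfl, -⟩ | ⟨-, rfl, -⟩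
  · exact .inr h
  · exact .inl rfl

theorem locStep_guarded {i : ℕ} {ρ : Tr} (hρ : Owned t e.name i ρ) {y : Tr × Tr}
    (h : LocStep t ((guarded e b π K).tr, ρ) y) :
    (y.1 = K.tr ∧ TT t ρ π.lab.dual y.2) ∨ (y.1 = (guarded e b π K).tr ∧ TStep t ρ y.2) := by
  rcases h with ⟨α, h1, h2⟩ | h
  · rcases tt_guarded.1 h1 with ⟨rfl, h3⟩ | ⟨-, rfl, -⟩
    · exact .inl ⟨h3, h2⟩
    · obtain ⟨k, -, -, h3⟩ := hρ _ _ h2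
      exact absurd h3.symm nm_ne
  · exact .inr h

theorem barbStep_guarded {ρ ρ' κ : Tr} (hκ : κ.items = {κ}) (h : K.tr = κ)
    (h' : TT t ρ π.lab.dual ρ') : BarbStep t e b ((guarded e b π K).tr, ρ) (κ, ρ') := by
  subst h
  refine ⟨.inl ⟨_, tt_guarded.2 (.inl ⟨rfl, rfl⟩), h'⟩, items_guarded, hκ, ?_⟩
  rintro rfl
  exact tbarb_guarded

/-! ## Transitions of soups -/

/-- Labelled transitions of soups of parallel components. -/
def ST (t : Topology) (S : Multiset Tr) (α : Lab) (S' : Multiset Tr) : Prop :=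
  ∃ x R Q, S = x ::ₘ R ∧ TT t x α Q ∧ S' = Q.items + R

theorem TT.st {P P' : Tr} {α : Lab} (h : TT t P α P') : ST t P.items α P'.items := by
  obtain ⟨x, Q, R, h1, h2, h3⟩ := h.items
  exact ⟨x, R, Q, h1, h2, h3⟩

theorem ST.exists_tt {P : Tr} {S' : Multiset Tr} {α : Lab} (h : ST t P.items α S') :
    ∃ P', TT t P α P' ∧ P'.items = S' := by
  obtain ⟨x, R, Q, h1, h2, rfl⟩ := h
  exact TT.of_items h1 h2

/-- Reductions of soups of parallel components. -/
def SStep (t : Topology) (S S' : Multiset Tr) : Prop :=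
  (∃ x R Q, S = x ::ₘ R ∧ TStep t x Q ∧ S' = Q.items + R) ∨
    ∃ α x y R x' y', S = x ::ₘ y ::ₘ R ∧ TT t x α x' ∧ TT t y α.dual y' ∧
      S' = x'.items + y'.items + R

theorem TStep.sstep {P P' : Tr} (h : TStep t P P') : SStep t P.items P'.items := by
  rcases h.items with ⟨x, Q, R, h1, h2, h3⟩ | ⟨α, x, y, x', y', R, h1, h2, h3, h4⟩
  · exact .inl ⟨x, R, Q, h1, h2, h3⟩
  · exact .inr ⟨α, x, y, R, x', y', h1, h2, h3, h4⟩

theorem SStep.exists_tstep {P : Tr} {S' : Multiset Tr} (h : SStep t P.items S') :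
    ∃ P', TStep t P P' ∧ P'.items = S' := by
  rcases h with ⟨x, R, Q, h1, h2, rfl⟩ | ⟨α, x, y, R, x', y', h1, h2, h3, rfl⟩
  · exact TStep.of_items h1 h2
  · exact TStep.of_items_sync h1 h2 h3

theorem tt_repl {c : Term} {α : Lab} {Q : Tr} : TT t (Term.repl π c).tr α Q ↔
    α = π.lab ∧ Q = .par c.tr (Term.repl π c).tr := by
  rw [Term.tr_repl]
  have h : ∀ c, TT t (.leaf c) α Q ↔ (α, Q) ∈ acts c := fun c =>
    ⟨fun h => by cases h with | leaf h => exact h, .leaf⟩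
  rw [h, acts_repl]
  simp

theorem items_repl (c : Term) : (Term.repl π c).tr.items = {(Term.repl π c).tr} := by
  rw [Term.tr_repl, Tr.items, if_neg]
  simp [Term.code, zeroCode, Term.zero, Branches.code]

theorem Tr.nloc_eq_zero : ∀ {P : Tr}, (∀ x ∈ P.items, x.nloc = 0) → P.nloc = 0
  | .leaf _, _ => rfl
  | .loc a P, h => h _ (Multiset.mem_singleton_self _)
  | .par P Q, h => by
      rw [Tr.nloc, Tr.nloc_eq_zero fun x hx => h x (Multiset.mem_add.2 (.inl hx)),
        Tr.nloc_eq_zero fun x hx => h x (Multiset.mem_add.2 (.inr hx))]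

end

/-! ## Counters in a static topology -/

namespace StaticCounter

variable (e : Barb)

/-- One unit of counter `i`. -/
def unit (i : ℕ) : Term := guarded e false (.out (nm e.name 4 i)) .zero

/-- The process that counter `i` consists of when it is zero. -/
def supply (i : ℕ) : Term := .repl (.inp (nm e.name 3 i)) (unit e i)

/-- The counter `i`, with value zero. -/
def reg (i : ℕ) : Term := .loc (nm e.name 2 i) (supply e i)

/-- The guard that implements an operation. -/
def guard : Op → Prefix
  | .inc i => .out (nm e.name 3 i)
  | .dec i => .inp (nm e.name 4 i)
  | .reset i => .upd (nm e.name 2 i) (reg e i)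

/-- The soup inside the location of counter `i`. -/
def soup (i n : ℕ) : Multiset Tr := (supply e i).tr ::ₘ .replicate n (unit e i).tr

/-- The tree represents counter `i` with value `n`. -/
def IsReg (i n : ℕ) (ρ : Tr) : Prop := ∃ T, ρ = .loc (nm e.name 2 i) T ∧ T.items = soup e i n

variable {e} {t : Topology} {i n : ℕ}

theorem tt_unit {α : Lab} {Q : Tr} (h : TT t (unit e i).tr α Q) :
    α = (1, nm e.name 4 i, .leaf 0) ∧ Q = Term.zero.tr := by
  rcases tt_guarded.1 h with h | ⟨h, -⟩
  · exact h
  · cases h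

theorem mem_soup {x : Tr} (h : x ∈ soup e i n) : x = (supply e i).tr ∨ x = (unit e i).tr := by
  rcases Multiset.mem_cons.1 h with h | h
  · exact .inl h
  · exact .inr (Multiset.eq_of_mem_replicate h)

theorem st_soup {α : Lab} {S : Multiset Tr} (h : ST t (soup e i n) α S) :
    (α = (0, nm e.name 3 i, .leaf 0) ∧ S = soup e i (n + 1)) ∨
      (α = (1, nm e.name 4 i, .leaf 0) ∧ ∃ n', n = n' + 1 ∧ S = soup e i n') := by
  obtain ⟨x, R, Q, h1, h2, rfl⟩ := h
  rw [soup, ← Multiset.singleton_add] at h1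
  rcases add_eq_cons h1 with ⟨A, h3, rfl⟩ | ⟨A, h3, rfl⟩
  · obtain ⟨rfl, rfl⟩ := Multiset.singleton_eq_cons_iff _ |>.1 h3
    obtain ⟨rfl, rfl⟩ := tt_repl.1 h2
    refine .inl ⟨rfl, ?_⟩
    rw [Tr.items, items_repl, unit, items_guarded, soup, Multiset.replicate_succ]
    simp only [← Multiset.singleton_add, supply, unit]
    abel
  · have hx := Multiset.eq_of_mem_replicate (h3 ▸ Multiset.mem_cons_self x A :
      x ∈ Multiset.replicate n (unit e i).tr)
    subst hx
    obtain ⟨rfl, rfl⟩ := tt_unit h2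
    cases n with
    | zero => simp at h3
    | succ n =>
      rw [Multiset.replicate_succ, Multiset.cons_inj_right] at h3
      refine .inr ⟨rfl, n, rfl, ?_⟩
      rw [items_zero, ← h3]; simp [soup]

theorem st_inc (t : Topology) (e : Barb) (i n : ℕ) :
    ST t (soup e i n) (0, nm e.name 3 i, .leaf 0) (soup e i (n + 1)) := by
  refine ⟨_, _, _, rfl, tt_repl.2 ⟨rfl, rfl⟩, ?_⟩
  rw [Tr.items, items_repl, unit, items_guarded, soup, Multiset.replicate_succ]
  simp only [← Multiset.singleton_add, supply, unit]
  abel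

theorem st_dec (t : Topology) (e : Barb) (i n : ℕ) :
    ST t (soup e i (n + 1)) (1, nm e.name 4 i, .leaf 0) (soup e i n) := by
  refine ⟨(unit e i).tr, (supply e i).tr ::ₘ .replicate n (unit e i).tr, _, ?_,
    tt_guarded.2 (.inl ⟨rfl, rfl⟩), ?_⟩
  · rw [soup, Multiset.replicate_succ, Multiset.cons_swap]
  · rw [items_zero, zero_add]; rfl

theorem IsReg.tt {ρ ρ' : Tr} {α : Lab} (h : IsReg e i n ρ) (hρ : TT t ρ α ρ') :
    (α = (0, nm e.name 3 i, .leaf 0) ∧ IsReg e i (n + 1) ρ') ∨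
    (α = (1, nm e.name 4 i, .leaf 0) ∧ ∃ n', n = n' + 1 ∧ IsReg e i n' ρ') ∨
    ∃ U T, α = (3, nm e.name 2 i, U) ∧ ρ' = U.fill T := by
  obtain ⟨T, rfl, hT⟩ := h
  cases hρ with
  | abs _ _ => exact .inr (.inr ⟨_, _, rfl, rfl⟩)
  | loc _ h =>
    have := h.st
    rw [hT] at this
    rcases st_soup this with ⟨h1, h2⟩ | ⟨h1, n', h2, h3⟩
    · exact .inl ⟨h1, _, rfl, h2⟩
    · exact .inr (.inl ⟨h1, n', h2, _, rfl, h3⟩)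

theorem IsReg.owned {ρ : Tr} (h : IsReg e i n ρ) : Owned t e.name i ρ := by
  intro α Q hQ
  rcases h.tt hQ with ⟨rfl, -⟩ | ⟨rfl, -⟩ | ⟨U, T, rfl, -⟩
  · exact ⟨3, by omega, by omega, rfl⟩
  · exact ⟨4, by omega, by omega, rfl⟩
  · exact ⟨2, by omega, by omega, rfl⟩

/-- The supply only inputs at kind `3` and the units only output at kind `4`, so the contents cannot
react by themselves. -/
theorem IsReg.quiet {ρ ρ' : Tr} (h : IsReg e i n ρ) : ¬ TStep t ρ ρ' := by
  obtain ⟨T, rfl, hT⟩ := h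
  intro hs
  cases hs with
  | loc _ hs =>
    have hs := hs.sstep
    rw [hT] at hs
    rcases hs with ⟨x, R, Q, h1, h2, -⟩ | ⟨α, x, y, R, x', y', h1, h2, h3, -⟩
    · rcases mem_soup (h1 ▸ Multiset.mem_cons_self x R : x ∈ soup e i n) with rfl | rfl
      · rw [supply, Term.tr_repl] at h2; exact TStep.not_leaf h2
      · rw [unit, guarded_tr] at h2; exact TStep.not_leaf h2
    · have h4 : ∀ {z z' : Tr} {α : Lab}, z ∈ soup e i n → TT t z α z' →
          α = (0, nm e.name 3 i, .leaf 0) ∨ α = (1, nm e.name 4 i, .leaf 0) := by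
        intro z z' α hz hz'
        rcases mem_soup hz with rfl | rfl
        · exact .inl (tt_repl.1 hz').1
        · exact .inr (tt_unit hz').1
      have h5 := h4 (by rw [h1]; simp) h2
      have h6 := h4 (by rw [h1]; simp) h3
      rcases h5 with rfl | rfl <;> rcases h6 with h6 | h6 <;>
        simp [Lab.dual, nm] at h6

/-- The pattern of a reset has no hole, so filling it forgets the old contents and yields a fresh
counter. -/
theorem IsReg.of_guard {o : Op} {ρ ρ' : Tr} (h : IsReg e o.idx n ρ)
    (hρ : TT t ρ (guard e o).lab.dual ρ') : ∃ n', o.Eff n n' ∧ IsReg e o.idx n' ρ' := by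
  rcases h.tt hρ with ⟨h1, h2⟩ | ⟨h1, n', h2, h3⟩ | ⟨U, T, h1, rfl⟩
  · cases o with
    | inc i => exact ⟨_, rfl, h2⟩
    | dec i => simp [guard, Prefix.lab, Lab.dual] at h1
    | reset i => simp [guard, Prefix.lab, Lab.dual] at h1
  · cases o with
    | inc i => simp [guard, Prefix.lab, Lab.dual, nm] at h1
    | dec i => exact ⟨_, h2, h3⟩
    | reset i => simp [guard, Prefix.lab, Lab.dual] at h1
  · cases o with
    | inc i => simp [guard, Prefix.lab, Lab.dual] at h1
    | dec i => simp [guard, Prefix.lab, Lab.dual] at h1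
    | reset i =>
      simp only [guard, Prefix.lab, Lab.dual, Prod.mk.injEq] at h1
      refine ⟨0, rfl, (supply e i).tr, ?_, ?_⟩
      · rw [← h1.2.2, reg, Term.tr_loc, Tr.fill, supply, Term.tr_repl, Tr.fill, if_neg]
        · rfl
        · simp [Term.code, holeCode]
      · rw [supply, items_repl]; rfl

theorem IsReg.exists_tt_guard {o : Op} {n' : ℕ} {ρ : Tr} (h : IsReg e o.idx n ρ) (ho : o.Eff n n') :
    ∃ ρ', TT t ρ (guard e o).lab.dual ρ' ∧ IsReg e o.idx n' ρ' := by
  obtain ⟨T, rfl, hT⟩ := h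
  cases o with
  | inc i =>
    obtain rfl : n' = n + 1 := ho
    obtain ⟨T', h1, h2⟩ := ST.exists_tt (hT ▸ st_inc t e i n)
    exact ⟨_, .loc _ h1, T', rfl, h2⟩
  | dec i =>
    obtain rfl : n = n' + 1 := ho
    obtain ⟨T', h1, h2⟩ := ST.exists_tt (hT ▸ st_dec t e i n')
    exact ⟨_, .loc _ h1, T', rfl, h2⟩
  | reset i =>
    obtain rfl : n' = 0 := ho
    -- The contents are free of locations, which is why the static topology permits discarding them.
    have h1 : TT t (.loc (nm e.name 2 i) T) (3, nm e.name 2 i, (reg e i).tr)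
        ((reg e i).tr.fill T) := .abs _ fun _ => .inl <| Tr.nloc_eq_zero fun x hx => by
      rw [hT] at hx
      rcases mem_soup hx with rfl | rfl
      · rw [supply, Term.tr_repl]; rfl
      · rw [unit, guarded_tr]; rfl
    obtain ⟨n', h2, h3⟩ := IsReg.of_guard (o := .reset i) ⟨T, rfl, hT⟩ h1
    obtain rfl : n' = 0 := h2
    exact ⟨_, h1, h3⟩

theorem guard_name (o : Op) : ∃ k, 2 ≤ k ∧ k < 8 ∧ (guard e o).lab.2.1 = nm e.name k o.idx := by
  cases o with
  | inc i => exact ⟨3, by omega, by omega, rfl⟩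
  | dec i => exact ⟨4, by omega, by omega, rfl⟩
  | reset i => exact ⟨2, by omega, by omega, rfl⟩

theorem supply_mem (e : Barb) (i : ℕ) : supply e i ∈ calculus .unguarded .static := by
  obtain ⟨h1, h2⟩ := guarded_mem (e := e) (b := false) (v := .unguarded) (t := .static)
    (.out (nm e.name 4 i)) (fun _ => trivial) zero_mem rfl
  exact ⟨.repl (.inp _) h1.1, trivial, h1.2, h2⟩

theorem reg_mem (e : Barb) (i : ℕ) : reg e i ∈ calculus .unguarded .static :=
  ⟨.loc _ (supply_mem e i).1, (supply_mem e i).2⟩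

theorem guard_mem (o : Op) : IsPrefix .unguarded (guard e o) ∧ (guard e o).Static := by
  cases o with
  | inc i => exact ⟨.out _, trivial⟩
  | dec i => exact ⟨.inp _, trivial⟩
  | reset i =>
    exact ⟨.upd _ (.proc (reg_mem e i).1), (reg_mem e i).2, by
      simp [reg, supply, unit, guarded, Term.locs, Branches.locs, Term.zero]⟩

/-- The encoding of counters in the calculus with unguarded patterns and static topology. -/
def coding (e : Barb) : Coding .unguarded .static e where
  pre b o K := guarded e b (guard e o) K
  pre_guarded b o K := ⟨_, _, rfl, guard_name o⟩
  IsReg := IsReg e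
  reg := reg e
  isReg_reg i := ⟨(supply e i).tr, Term.tr_loc _ _, by rw [supply, items_repl]; simp [soup, supply]⟩
  owned h := h.owned
  quiet h := h.quiet
  inc_step {b i n ρ K y} h hy := by
    rcases locStep_guarded h.owned hy with ⟨h1, h2⟩ | ⟨-, h2⟩
    · obtain ⟨n', rfl, h3⟩ := IsReg.of_guard (o := .inc i) h h2
      exact ⟨h1, h3⟩
    · exact absurd h2 h.quiet
  sound {b o n ρ b' π P} h := by
    have key : ∀ y, LocStep .static ((guarded e b (guard e o) (guarded e b' π P)).tr, ρ) y →
        y.1 = (guarded e b' π P).tr ∧ ∃ n', o.Eff n n' ∧ IsReg e o.idx n' y.2 := by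
      intro y hy
      rcases locStep_guarded h.owned hy with ⟨h1, h2⟩ | ⟨-, h2⟩
      · exact ⟨h1, IsReg.of_guard h h2⟩
      · exact absurd h2 h.quiet
    exact .step (controlFor_guarded (guard_name o)) h.owned
      (fun y hy => by rw [(key y hy).1]; exact items_guarded) fun y hy => .goal (key y hy)
  complete {b o n n' ρ b' π P} h ho := by
    obtain ⟨ρ', h1, h2⟩ := IsReg.exists_tt_guard h ho
    exact ⟨ρ', h2, .single (barbStep_guarded items_guarded rfl h1)⟩
  code b o := exists_guarded_code _ _ _
  pre_mem {b o K} hK hl := guarded_mem (guard_mem o).1 (fun _ => (guard_mem o).2) hK hl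
  reg_mem := reg_mem e

end StaticCounter

end Evol

-- Undecidability: counters for preserving patterns.

namespace Evol

/-! ## Predicates on soups -/

section

variable {t : Topology} {a : ℕ} {p q : Multiset Tr → Prop} {m : Option Lab}

/-- Moves of soups: transitions with a label, or reductions. -/
def Move (t : Topology) : Option Lab → Multiset Tr → Multiset Tr → Prop
  | some α, S, S' => ST t S α S'
  | none, S, S' => SStep t S S'

/-- What soups with the property `p` become. -/
def Post (t : Topology) (m : Option Lab) (p : Multiset Tr → Prop) (S' : Multiset Tr) : Prop :=
  ∃ S, p S ∧ Move t m S S'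

/-- The soups that may obtain the property `p`. -/
def Pre (t : Topology) (m : Option Lab) (p : Multiset Tr → Prop) (S : Multiset Tr) : Prop :=
  ∃ S', Move t m S S' ∧ p S'

/-- The soup is a location `a` the contents of which have the property `p`. -/
def Wrap (a : ℕ) (p : Multiset Tr → Prop) (S : Multiset Tr) : Prop :=
  ∃ Q, S = {.loc a Q} ∧ p Q.items

/-- The soup consists of `c` and a soup that has the property `p`. -/
def With (c : Tr) (p : Multiset Tr → Prop) (S : Multiset Tr) : Prop :=
  ∃ T, S = c ::ₘ T ∧ p T

theorem wrap_mono (a : ℕ) : Monotone (Wrap a) := fun _ _ h _ ⟨Q, h1, h2⟩ => ⟨Q, h1, h _ h2⟩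

theorem wrap_bot (a : ℕ) : Wrap a ⊥ = ⊥ := by
  funext S; exact eq_false fun ⟨_, _, h⟩ => h

theorem iterate_wrap_bot (a d : ℕ) : (Wrap a)^[d] ⊥ = ⊥ :=
  Function.iterate_fixed (wrap_bot a) d

theorem post_empty_le : Post t m (· = 0) ≤ ⊥ := by
  rintro S' ⟨S, rfl, h⟩
  cases m with
  | some α => obtain ⟨x, R, Q, h, -⟩ := h; exact Multiset.zero_ne_cons h
  | none => rcases h with ⟨x, R, Q, h, -⟩ | ⟨α, x, y, R, x', y', h, -⟩ <;> exact Multiset.zero_ne_cons h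

theorem post_wrap {S' : Multiset Tr} (h : Post t m (Wrap a p) S') :
    (∃ U Q, m = some (3, a, U) ∧ p Q.items ∧ S' = (U.fill Q).items) ∨ Wrap a (Post t m p) S' := by
  obtain ⟨_, ⟨Q, rfl, hQ⟩, h⟩ := h
  cases m with
  | some α =>
    obtain ⟨x, R, Q', h1, h2, rfl⟩ := h
    obtain ⟨rfl, rfl⟩ := Multiset.singleton_eq_cons_iff _ |>.1 h1
    cases h2 with
    | abs _ _ => exact .inl ⟨_, Q, rfl, hQ, by simp⟩
    | @loc _ _ Q' _ h2 => exact .inr ⟨Q', by simp [Tr.items], _, hQ, h2.st⟩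
  | none =>
    rcases h with ⟨x, R, Q', h1, h2, rfl⟩ | ⟨α, x, y, R, x', y', h1, -⟩
    · obtain ⟨rfl, rfl⟩ := Multiset.singleton_eq_cons_iff _ |>.1 h1
      cases h2 with
      | @loc _ _ Q' h2 => exact .inr ⟨Q', by simp [Tr.items], _, hQ, h2.sstep⟩
    · simp at h1

/-- Moving `Post` inwards here, and `Pre` outwards in `wrap_pre_le`, reduces statements about nested
locations of any depth to their innermost contents. -/
theorem post_wrap_le (h : ∀ α ∈ m, α.2.1 ≠ a) : Post t m (Wrap a p) ≤ Wrap a (Post t m p) := by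
  intro S' hS'
  rcases post_wrap hS' with ⟨U, Q, rfl, -⟩ | h'
  · exact absurd rfl (h _ rfl)
  · exact h'

theorem post_iterate_wrap_le (h : ∀ α ∈ m, α.2.1 ≠ a) (d : ℕ) :
    Post t m ((Wrap a)^[d] p) ≤ (Wrap a)^[d] (Post t m p) := by
  induction d with
  | zero => exact le_rfl
  | succ d ih =>
    rw [Function.iterate_succ_apply', Function.iterate_succ_apply']
    exact (post_wrap_le h).trans (wrap_mono a ih)

theorem wrap_pre_le : Wrap a (Pre t m q) ≤ Pre t m (Wrap a q) := by
  rintro _ ⟨Q, rfl, S', h, hq⟩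
  cases m with
  | some α =>
    obtain ⟨Q', h1, rfl⟩ := ST.exists_tt h
    exact ⟨_, ⟨_, 0, _, rfl, .loc a h1, rfl⟩, Q', by simp [Tr.items], hq⟩
  | none =>
    obtain ⟨Q', h1, rfl⟩ := SStep.exists_tstep h
    exact ⟨_, .inl ⟨_, 0, _, rfl, .loc a h1, rfl⟩, Q', by simp [Tr.items], hq⟩

theorem iterate_wrap_pre_le (d : ℕ) : (Wrap a)^[d] (Pre t m q) ≤ Pre t m ((Wrap a)^[d] q) := by
  induction d with
  | zero => exact le_rfl
  | succ d ih =>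
    rw [Function.iterate_succ_apply', Function.iterate_succ_apply']
    exact (wrap_mono a ih).trans wrap_pre_le

theorem wrap_le_pre {U : Tr} (h : ∀ Q : Tr, p Q.items → q (U.fill Q).items) :
    Wrap a p ≤ Pre .dynamic (some (3, a, U)) q := by
  rintro _ ⟨Q, rfl, hQ⟩
  exact ⟨_, ⟨_, 0, _, rfl, .abs a nofun, rfl⟩, by simpa using h Q hQ⟩

theorem post_with {c : Tr} {α : Lab} {S' : Multiset Tr} (h : Post t (some α) (With c p) S') :
    (∃ c' T, TT t c α c' ∧ p T ∧ S' = c'.items + T) ∨ With c (Post t (some α) p) S' := by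
  obtain ⟨_, ⟨T, rfl, hT⟩, x, R, Q, h1, h2, rfl⟩ := h
  rw [← Multiset.singleton_add] at h1
  rcases add_eq_cons h1 with ⟨A, h3, rfl⟩ | ⟨A, rfl, rfl⟩
  · obtain ⟨rfl, rfl⟩ := Multiset.singleton_eq_cons_iff _ |>.1 h3
    exact .inl ⟨Q, T, h2, hT, by simp⟩
  · exact .inr ⟨Q.items + A, by simp, _, hT, x, A, Q, rfl, h2, rfl⟩

theorem post_none_with {c : ℕ} {S' : Multiset Tr} (h : Post t none (With (.leaf c) p) S') :
    (∃ α c' T, TT t (.leaf c) α c' ∧ Post t (some α.dual) p T ∧ S' = c'.items + T) ∨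
      With (.leaf c) (Post t none p) S' := by
  obtain ⟨_, ⟨T, rfl, hT⟩, h⟩ := h
  rcases h with ⟨x, R, Q, h1, h2, rfl⟩ | ⟨α, x, y, R, x', y', h1, h2, h3, rfl⟩ <;>
    rw [← Multiset.singleton_add] at h1 <;>
    rcases add_eq_cons h1 with ⟨A, h4, h5⟩ | ⟨A, h4, h5⟩
  · obtain ⟨rfl, rfl⟩ := Multiset.singleton_eq_cons_iff _ |>.1 h4
    exact absurd h2 TStep.not_leaf
  · subst h4 h5
    exact .inr ⟨Q.items + A, by simp, _, hT, .inl ⟨x, A, Q, rfl, h2, rfl⟩⟩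
  · obtain ⟨rfl, rfl⟩ := Multiset.singleton_eq_cons_iff _ |>.1 h4
    obtain rfl : T = y ::ₘ R := by simpa using h5.symm
    exact .inl ⟨α, x', y'.items + R, h2, ⟨_, hT, y, R, y', rfl, h3, rfl⟩, by rw [add_assoc]⟩
  · rcases add_eq_cons h5.symm with ⟨B, h6, rfl⟩ | ⟨B, rfl, rfl⟩
    · obtain ⟨rfl, rfl⟩ := Multiset.singleton_eq_cons_iff _ |>.1 h6
      refine .inl ⟨α.dual, y', x'.items + A, h3, ⟨_, hT, x, A, x', h4, ?_, rfl⟩, by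
        rw [zero_add, ← add_assoc, add_comm x'.items]⟩
      rwa [Lab.dual_dual h2.kind_le]
    · exact .inr ⟨x'.items + y'.items + B, by simp, _, hT,
        .inr ⟨α, x, y, B, x', y', h4, h2, h3, rfl⟩⟩

theorem with_le_pre {c c' : Tr} {α : Lab} (h : TT t c α c') (hq : ∀ T, p T → q (c'.items + T)) :
    With c p ≤ Pre t (some α) q := by
  rintro _ ⟨T, rfl, hT⟩
  exact ⟨_, ⟨c, T, c', rfl, h, rfl⟩, hq T hT⟩

theorem with_pre_le {c c' : Tr} {α : Lab} (h : TT t c α c') (hc : c'.items = {c'}) :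
    With c (Pre t (some α.dual) q) ≤ Pre t none (With c' q) := by
  rintro _ ⟨_, rfl, _, ⟨y, R, y', rfl, h', rfl⟩, hq⟩
  exact ⟨_, .inr ⟨α, c, y, R, c', y', rfl, h, h', rfl⟩, _, by
    rw [hc, add_assoc, Multiset.singleton_add], hq⟩

theorem owned_of_post {i : ℕ} {P : Tr} (hP : p P.items)
    (h : ∀ α : Lab, (∀ k, 2 ≤ k → k < 8 → α.2.1 ≠ nm a k i) → Post t (some α) p ≤ ⊥) :
    Owned t a i P := by
  intro α Q hQ
  by_contra! hc
  exact h α hc _ ⟨_, hP, hQ.st⟩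

end

/-! ## Counters in a dynamic topology -/

namespace DynamicCounter

/-- The innermost location of counter `i`. -/
def Core (a i : ℕ) : Multiset Tr → Prop := Wrap (nm a 4 i) (· = 0)

/-- The locations of counter `i` that surround its innermost location. -/
def Tower (a i n : ℕ) : (Multiset Tr → Prop) → Multiset Tr → Prop := (Wrap (nm a 2 i))^[n]

/-- The locations that represent the value `n`. -/
def Body (a i n : ℕ) : Multiset Tr → Prop := Wrap (nm a 3 i) (Tower a i n (Core a i))

/-- The tree represents counter `i` with value `n`. -/
def IsReg (a i n : ℕ) (ρ : Tr) : Prop := ∃ d, Tower a i d (Body a i n) ρ.items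

variable (e : Barb)

/-- The process that signals that counter `i` has been decremented. -/
def ack (i : ℕ) : Term := guarded e false (.out (nm e.name 5 i)) .zero

/-- The process that decrements counter `i`. -/
def drop (i : ℕ) : Term := guarded e false (.upd (nm e.name 2 i) .hole) (ack e i)

/-- The process that executes an operation and continues as `K`. -/
def pre (b : Bool) : Op → Term → Term
  | .inc i, K => guarded e b (.upd (nm e.name 4 i) (.loc (nm e.name 2 i) (.loc (nm e.name 4 i) .hole))) K
  | .dec i, K => guarded e b (.upd (nm e.name 3 i) (.par (.loc (nm e.name 3 i) .hole) (drop e i)))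
      (guarded e b (.inp (nm e.name 5 i)) K)
  | .reset i, K => guarded e b (.upd (nm e.name 3 i) .hole)
      (guarded e b (.upd (nm e.name 4 i) (.loc (nm e.name 3 i) (.loc (nm e.name 4 i) .hole))) K)

variable {e} {a i n d : ℕ} {p q : Multiset Tr → Prop} {m : Option Lab}

theorem tower_mono : Monotone (Tower a i d) := (wrap_mono _).iterate d

/-- The innermost contents are inactive, so the nested locations can do nothing but absorb updates
at their own names. -/
theorem post_tower_core_le (h : ∀ α ∈ m, α.2.1 ≠ nm a 2 i ∧ α.2.1 ≠ nm a 4 i) :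
    Post .dynamic m (Tower a i n (Core a i)) ≤ ⊥ := by
  refine (post_iterate_wrap_le (fun α hα => (h α hα).1) n).trans ?_
  rw [← iterate_wrap_bot (nm a 2 i) n]
  refine (wrap_mono _).iterate n ?_
  rw [← wrap_bot (nm a 4 i)]
  exact (post_wrap_le fun α hα => (h α hα).2).trans (wrap_mono _ post_empty_le)

theorem post_body_le (h : ∀ α ∈ m, α.2.1 ≠ nm a 2 i ∧ α.2.1 ≠ nm a 3 i ∧ α.2.1 ≠ nm a 4 i) :
    Post .dynamic m (Body a i n) ≤ ⊥ := by
  rw [← wrap_bot (nm a 3 i)]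
  exact (post_wrap_le fun α hα => (h α hα).2.1).trans (wrap_mono _
    (post_tower_core_le fun α hα => ⟨(h α hα).1, (h α hα).2.2⟩))

theorem post_tower_le_bot (hm : ∀ α ∈ m, α.2.1 ≠ nm a 2 i) (h : Post .dynamic m p ≤ ⊥) :
    Post .dynamic m (Tower a i d p) ≤ ⊥ :=
  (post_iterate_wrap_le hm d).trans ((tower_mono h).trans (iterate_wrap_bot _ d).le)

theorem guarded_fill {b : Bool} {π : Prefix} {K : Term} {Q : Tr} :
    (guarded e b π K).tr.fill Q = (guarded e b π K).tr := by
  rw [guarded_tr, Tr.fill, if_neg]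
  simp [guarded, Term.code, holeCode]

/-! ### Updates of the locations of a counter -/

theorem post_core {U : Tr} {S : Multiset Tr} (h : Post .dynamic (some (3, nm a 4 i, U)) (Core a i) S) :
    ∃ Q : Tr, Q.items = 0 ∧ S = (U.fill Q).items := by
  rcases post_wrap h with ⟨U', Q, h1, h2, h3⟩ | ⟨Q, -, h⟩
  · cases h1; exact ⟨Q, h2, h3⟩
  · exact (post_empty_le _ h).elim

theorem post_tower_core {U : Tr} (h : ∀ Q : Tr, Q.items = 0 → q (U.fill Q).items) :
    Post .dynamic (some (3, nm a 4 i, U)) (Tower a i n (Core a i)) ≤ Tower a i n q := by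
  refine (post_iterate_wrap_le ?_ n).trans (tower_mono fun S hS => ?_)
  · rintro _ ⟨⟩; simp [nm]
  · obtain ⟨Q, h1, rfl⟩ := post_core hS; exact h Q h1

theorem post_body {U : Tr} {S : Multiset Tr}
    (h : Post .dynamic (some (3, nm a 3 i, U)) (Body a i n) S) :
    ∃ Q : Tr, Tower a i n (Core a i) Q.items ∧ S = (U.fill Q).items := by
  rcases post_wrap h with ⟨U', Q, h1, h2, h3⟩ | ⟨Q, -, h⟩
  · cases h1; exact ⟨Q, h2, h3⟩
  · refine (post_tower_core_le ?_ _ h).elim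
    rintro _ ⟨⟩; simp [nm]

theorem hole_fill {Q : Tr} : (Tr.leaf holeCode).fill Q = Q := by rw [Tr.fill, if_pos rfl]

/-- All locations of the tower have the same name, so it does not matter which of them is dissolved.
-/
theorem post_tower_hole : Post .dynamic (some (3, nm a 2 i, .leaf holeCode)) (Tower a i n (Core a i)) ≤
    fun S => ∃ n', n = n' + 1 ∧ Tower a i n' (Core a i) S := by
  induction n with
  | zero =>
    intro S h
    refine ((post_wrap_le ?_).trans (wrap_mono _ post_empty_le) |>.trans (wrap_bot _).le) S h |>.elim
    rintro _ ⟨⟩; simp [nm]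
  | succ n ih =>
    intro S h
    rw [Tower, Function.iterate_succ_apply'] at h
    rcases post_wrap h with ⟨U, Q, h1, h2, rfl⟩ | h
    · cases h1; exact ⟨n, rfl, by rwa [hole_fill]⟩
    · obtain ⟨Q, rfl, hQ⟩ := h
      obtain ⟨n', rfl, h'⟩ := ih _ hQ
      refine ⟨n' + 1, rfl, ?_⟩
      rw [Tower, Function.iterate_succ_apply']
      exact ⟨Q, rfl, h'⟩

theorem post_body_hole : Post .dynamic (some (3, nm a 2 i, .leaf holeCode)) (Body a i n) ≤
    fun S => ∃ n', n = n' + 1 ∧ Body a i n' S := by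
  intro S h
  obtain ⟨Q, rfl, hQ⟩ := post_wrap_le (by rintro _ ⟨⟩; simp [nm]) _ h
  obtain ⟨n', rfl, h'⟩ := post_tower_hole _ hQ
  exact ⟨n', rfl, Q, rfl, h'⟩

theorem body_le_pre_hole :
    Body a i (n + 1) ≤ Pre .dynamic (some (3, nm a 2 i, .leaf holeCode)) (Body a i n) := by
  refine (wrap_mono _ ?_).trans wrap_pre_le
  rw [Tower, Function.iterate_succ_apply']
  exact wrap_le_pre fun Q hQ => by rwa [hole_fill]

/-! ### Increments -/

/-- The pattern of increments. -/
theorem grow_fill {u z : ℕ} {Q : Tr} :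
    (Term.loc u (.loc z .hole)).tr.fill Q = .loc u (.loc z Q) := by
  simp [Tr.fill]

theorem tower_core_succ {Q : Tr} (hQ : Q.items = 0) : Tower a i 1 (Core a i)
    ((Term.loc (nm a 2 i) (.loc (nm a 4 i) .hole)).tr.fill Q).items := by
  rw [grow_fill]
  exact ⟨_, rfl, _, rfl, hQ⟩

theorem tower_tower (n : ℕ) : Tower a i d (Tower a i n p) = Tower a i (d + n) p :=
  (Function.iterate_add_apply _ _ _ _).symm

/-- The new location is inserted around the innermost one. This is inside the boundary, so it counts
for the value. -/
theorem post_body_inc : Post .dynamic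
    (some (3, nm a 4 i, (Term.loc (nm a 2 i) (.loc (nm a 4 i) .hole)).tr)) (Body a i n) ≤
      Body a i (n + 1) := by
  rw [Body, Body, ← tower_tower 1]
  refine (post_wrap_le ?_).trans (wrap_mono _ (post_tower_core fun Q hQ => tower_core_succ hQ))
  rintro _ ⟨⟩; simp [nm]

theorem tower_core_le_pre {U : Tr} (h : ∀ Q : Tr, Q.items = 0 → q (U.fill Q).items) :
    Tower a i n (Core a i) ≤ Pre .dynamic (some (3, nm a 4 i, U)) (Tower a i n q) :=
  (tower_mono (wrap_le_pre h)).trans (iterate_wrap_pre_le n)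

theorem body_le_pre_inc : Body a i n ≤ Pre .dynamic
    (some (3, nm a 4 i, (Term.loc (nm a 2 i) (.loc (nm a 4 i) .hole)).tr)) (Body a i (n + 1)) := by
  rw [Body, Body, ← tower_tower 1]
  exact (wrap_mono _ (tower_core_le_pre fun Q hQ => tower_core_succ hQ)).trans wrap_pre_le

/-! ### Registers -/

theorem IsReg.owned {ρ : Tr} (h : IsReg a i n ρ) : Owned .dynamic a i ρ := by
  obtain ⟨d, h⟩ := h
  refine owned_of_post h fun α hα => post_tower_le_bot ?_ (post_body_le ?_)
  · rintro _ ⟨⟩; exact hα 2 (by omega) (by omega)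
  · rintro _ ⟨⟩
    exact ⟨hα 2 (by omega) (by omega), hα 3 (by omega) (by omega), hα 4 (by omega) (by omega)⟩

theorem IsReg.quiet {ρ ρ' : Tr} (h : IsReg a i n ρ) : ¬ TStep .dynamic ρ ρ' := by
  obtain ⟨d, h⟩ := h
  exact fun hs => post_tower_le_bot (m := none) nofun (post_body_le nofun) _ ⟨_, h, hs.sstep⟩

theorem tower_post {ρ ρ' : Tr} {α : Lab} (h : Tower a i d p ρ.items) (hs : TT .dynamic ρ α ρ')
    (hα : α.2.1 ≠ nm a 2 i) : Tower a i d (Post .dynamic (some α) p) ρ'.items :=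
  post_iterate_wrap_le (by rintro _ ⟨⟩; exact hα) d _ ⟨_, h, hs.st⟩

theorem tower_pre {ρ : Tr} {α : Lab} (h : Tower a i d p ρ.items)
    (hp : p ≤ Pre .dynamic (some α) q) : ∃ ρ', TT .dynamic ρ α ρ' ∧ Tower a i d q ρ'.items := by
  obtain ⟨S, h1, h2⟩ := iterate_wrap_pre_le d _ (tower_mono hp _ h)
  obtain ⟨ρ', h3, rfl⟩ := ST.exists_tt h1
  exact ⟨ρ', h3, h2⟩

theorem tower_pre_none {ρ : Tr} (h : Tower a i d p ρ.items) (hp : p ≤ Pre .dynamic none q) :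
    ∃ ρ', TStep .dynamic ρ ρ' ∧ Tower a i d q ρ'.items := by
  obtain ⟨S, h1, h2⟩ := iterate_wrap_pre_le d _ (tower_mono hp _ h)
  obtain ⟨ρ', h3, rfl⟩ := SStep.exists_tstep h1
  exact ⟨ρ', h3, h2⟩

theorem lab_upd (c : ℕ) (U : Term) : (Prefix.upd c U).lab.dual = (3, c, U.tr) := rfl

theorem inc_step {b : Bool} {ρ : Tr} {K : Term} {y : Tr × Tr} (h : IsReg e.name i n ρ)
    (hy : LocStep .dynamic ((pre e b (.inc i) K).tr, ρ) y) :
    y.1 = K.tr ∧ IsReg e.name i (n + 1) y.2 := by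
  rcases locStep_guarded h.owned hy with ⟨h1, h2⟩ | ⟨-, h2⟩
  · obtain ⟨d, h⟩ := h
    exact ⟨h1, d, tower_mono post_body_inc _ (tower_post h h2 (by simp [nm]))⟩
  · exact absurd h2 h.quiet

/-! ### Decrements -/

theorem tt_ack {α : Lab} {Q : Tr} (h : TT .dynamic (ack e i).tr α Q) :
    α = (1, nm e.name 5 i, .leaf 0) ∧ Q = Term.zero.tr := by
  rcases tt_guarded.1 h with h | ⟨h, -⟩
  · exact h
  · cases h

theorem tt_drop {α : Lab} {Q : Tr} (h : TT .dynamic (drop e i).tr α Q) :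
    α = (2, nm e.name 2 i, .leaf holeCode) ∧ Q = (ack e i).tr := by
  rcases tt_guarded.1 h with ⟨h, h'⟩ | ⟨h, -⟩
  · rw [← Term.tr_hole]; exact ⟨h, h'⟩
  · cases h

theorem drop_le_pre : With (drop e i).tr (Body e.name i (n + 1)) ≤
    Pre .dynamic none (With (ack e i).tr (Body e.name i n)) := by
  have h : TT .dynamic (drop e i).tr (2, nm e.name 2 i, .leaf holeCode) (ack e i).tr :=
    tt_guarded.2 (.inl ⟨by rw [← Term.tr_hole]; rfl, rfl⟩)
  refine le_trans ?_ (with_pre_le h items_guarded)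
  rintro _ ⟨T, rfl, hT⟩
  exact ⟨T, rfl, body_le_pre_hole _ hT⟩

theorem ack_le_pre : With (ack e i).tr (Body e.name i n) ≤
    Pre .dynamic (some (1, nm e.name 5 i, .leaf 0)) (Body e.name i n) := by
  have h : TT .dynamic (ack e i).tr (1, nm e.name 5 i, .leaf 0) Term.zero.tr :=
    tt_guarded.2 (.inl ⟨rfl, rfl⟩)
  exact with_le_pre h fun T hT => by rwa [items_zero, zero_add]

theorem split_fill {Q : Tr} :
    ((Term.par (.loc (nm e.name 3 i) .hole) (drop e i)).tr.fill Q).items =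
      (drop e i).tr ::ₘ {.loc (nm e.name 3 i) Q} := by
  rw [Term.tr_par, Tr.fill, drop, guarded_fill, Tr.items, items_guarded, add_comm]
  simp [Tr.fill, Tr.items]

/-- The decrementing process is released beside the boundary and inside the garbage of earlier
resets. An update synchronizes only with a parallel component, so it cannot reach the enclosing
garbage, although that has the same name, and it has to dissolve a location of the current value. -/
theorem post_body_dec : Post .dynamic
    (some (3, nm e.name 3 i, (Term.par (.loc (nm e.name 3 i) .hole) (drop e i)).tr))
      (Body e.name i n) ≤ With (drop e i).tr (Body e.name i n) := by
  intro S h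
  obtain ⟨Q, h1, rfl⟩ := post_body h
  exact ⟨_, split_fill, Q, rfl, h1⟩

theorem body_le_pre_dec : Body e.name i n ≤ Pre .dynamic
    (some (3, nm e.name 3 i, (Term.par (.loc (nm e.name 3 i) .hole) (drop e i)).tr))
      (With (drop e i).tr (Body e.name i n)) :=
  wrap_le_pre fun Q hQ => ⟨_, split_fill, Q, rfl, hQ⟩

theorem owned_with {c : Tr} {ρ : Tr}
    (hc : ∀ α Q, TT .dynamic c α Q → ∃ k, 2 ≤ k ∧ k < 8 ∧ α.2.1 = nm a k i)
    (h : Tower a i d (With c (Body a i n)) ρ.items) : Owned .dynamic a i ρ := by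
  refine owned_of_post h fun α hα => post_tower_le_bot ?_ fun S hS => ?_
  · rintro _ ⟨⟩; exact hα 2 (by omega) (by omega)
  · rcases post_with hS with ⟨c', T, h1, -⟩ | ⟨T, -, h1⟩
    · obtain ⟨k, h2, h3, h4⟩ := hc _ _ h1
      exact hα k h2 h3 h4
    · refine (post_body_le ?_ _ h1).elim
      rintro _ ⟨⟩
      exact ⟨hα 2 (by omega) (by omega), hα 3 (by omega) (by omega), hα 4 (by omega) (by omega)⟩

theorem post_ack_le : Post .dynamic (some (1, nm e.name 5 i, .leaf 0))
    (With (ack e i).tr (Body e.name i n)) ≤ Body e.name i n := by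
  intro S hS
  rcases post_with hS with ⟨c', T, h1, h2, rfl⟩ | ⟨T, -, h1⟩
  · rw [(tt_ack h1).2, items_zero, zero_add]; exact h2
  · refine (post_body_le ?_ _ h1).elim
    rintro _ ⟨⟩; simp [nm]

theorem post_none_ack_le : Post .dynamic none (With (ack e i).tr (Body e.name i n)) ≤ ⊥ := by
  intro S hS
  rw [ack, guarded_tr] at hS
  rcases post_none_with hS with ⟨α, c', T, h1, h2, -⟩ | ⟨T, -, h1⟩
  · rw [← guarded_tr] at h1
    obtain ⟨rfl, -⟩ := tt_ack h1
    refine (post_body_le ?_ _ h2).elim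
    rintro _ ⟨⟩; simp [nm, Lab.dual]
  · exact (post_body_le (m := none) nofun _ h1).elim

theorem post_drop_le : Post .dynamic (some (1, nm e.name 5 i, .leaf 0))
    (With (drop e i).tr (Body e.name i n)) ≤ ⊥ := by
  intro S hS
  rcases post_with hS with ⟨c', T, h1, -⟩ | ⟨T, -, h1⟩
  · have := (tt_drop h1).1; simp at this
  · refine (post_body_le ?_ _ h1).elim
    rintro _ ⟨⟩; simp [nm]

/-- At value zero there is nothing to dissolve and the dialogue is stuck, as a decrement should be.
-/
theorem post_none_drop_le : Post .dynamic none (With (drop e i).tr (Body e.name i n)) ≤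
    fun S => ∃ n', n = n' + 1 ∧ With (ack e i).tr (Body e.name i n') S := by
  intro S hS
  rw [drop, guarded_tr] at hS
  rcases post_none_with hS with ⟨α, c', T, h1, h2, rfl⟩ | ⟨T, -, h1⟩
  · rw [← guarded_tr] at h1
    obtain ⟨rfl, rfl⟩ := tt_drop h1
    obtain ⟨n', rfl, h3⟩ := post_body_hole _ h2
    exact ⟨n', rfl, T, by rw [ack, items_guarded, Multiset.singleton_add], h3⟩
  · exact (post_body_le (m := none) nofun _ h1).elim

/-- The existential commutes with the tower because the predecessor of `n` is unique. -/
theorem tower_exists {r : ℕ → Multiset Tr → Prop} {S : Multiset Tr}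
    (h : Tower a i d (fun S => ∃ n', n = n' + 1 ∧ r n' S) S) :
    ∃ n', n = n' + 1 ∧ Tower a i d (r n') S := by
  cases n with
  | zero =>
    refine ((tower_mono (b := ⊥) ?_).trans (iterate_wrap_bot _ d).le) S h |>.elim
    rintro S ⟨n', h, -⟩; simp at h
  | succ n =>
    refine ⟨n, rfl, tower_mono ?_ _ h⟩
    rintro S ⟨n', h, h'⟩
    obtain rfl := Nat.succ.inj h
    exact h'

/-! ### The encoding -/

/-- Interactions with a guarded control component lead to a goal if both its synchronizations with
the counter and the reductions of the counter do. -/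
theorem leads_guarded {k : ℕ} (hk : 2 ≤ k) (hk' : k < 8) {b b' : Bool} {π π' : Prefix} {P : Term}
    (h : π.lab.2.1 = nm e.name k i) {ρ : Tr} {goal : Tr × Tr → Prop} (hρ : Owned .dynamic e.name i ρ)
    (h1 : ∀ ρ', TT .dynamic ρ π.lab.dual ρ' →
      Leads .dynamic e.name i goal ((guarded e b' π' P).tr, ρ'))
    (h2 : ∀ ρ', TStep .dynamic ρ ρ' →
      Leads .dynamic e.name i goal ((guarded e b π (guarded e b' π' P)).tr, ρ')) :
    Leads .dynamic e.name i goal ((guarded e b π (guarded e b' π' P)).tr, ρ) := by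
  refine .step (controlFor_guarded ⟨k, hk, hk', h⟩) hρ (fun y hy => ?_) fun y hy => ?_ <;>
    rcases locStep_guarded hρ hy with ⟨h3, h4⟩ | ⟨h3, h4⟩
  · rw [h3]; exact items_guarded
  · rw [h3]; exact items_guarded
  · obtain ⟨y, y'⟩ := y; obtain rfl := h3; exact h1 _ h4
  · obtain ⟨y, y'⟩ := y; obtain rfl := h3; exact h2 _ h4

theorem owned_tower_core {ρ : Tr} (h : Tower a i d (Core a i) ρ.items) : Owned .dynamic a i ρ := by
  refine owned_of_post h fun α hα => post_tower_core_le ?_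
  rintro _ ⟨⟩
  exact ⟨hα 2 (by omega) (by omega), hα 4 (by omega) (by omega)⟩

theorem body_zero {Q : Tr} (hQ : Q.items = 0) :
    Body a i 0 ((Term.loc (nm a 3 i) (.loc (nm a 4 i) .hole)).tr.fill Q).items := by
  rw [grow_fill]
  exact ⟨_, rfl, _, rfl, hQ⟩

theorem sound {b : Bool} {o : Op} {ρ : Tr} {b' : Bool} {π : Prefix} {P : Term}
    (h : IsReg e.name o.idx n ρ) : Leads .dynamic e.name o.idx
      (fun y => y.1 = (guarded e b' π P).tr ∧ ∃ n', o.Eff n n' ∧ IsReg e.name o.idx n' y.2)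
      ((pre e b o (guarded e b' π P)).tr, ρ) := by
  cases o with
  | inc i =>
    refine leads_guarded (k := 4) (by omega) (by omega) rfl h.owned (fun ρ' hρ' => .goal ?_)
      fun ρ' hρ' => absurd hρ' h.quiet
    obtain ⟨h1, h2⟩ := inc_step (e := e) (b := b) (K := guarded e b' π P) h
      (y := ((guarded e b' π P).tr, ρ')) (.inl ⟨_, tt_guarded.2 (.inl ⟨rfl, rfl⟩), hρ'⟩)
    exact ⟨h1, _, rfl, h2⟩
  | dec i =>
    refine leads_guarded (k := 3) (by omega) (by omega) rfl h.owned (fun ρ' hρ' => ?_)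
      fun ρ' hρ' => absurd hρ' h.quiet
    obtain ⟨d, h⟩ := h
    have h1 := tower_mono post_body_dec _ (tower_post h hρ' (by simp [nm]))
    clear h hρ'
    refine leads_guarded (k := 5) (by omega) (by omega) rfl
      (owned_with (fun α Q hQ => ⟨2, by omega, by omega, by rw [(tt_drop hQ).1]⟩) h1)
      (fun ρ'' hρ'' => ?_) fun ρ'' hρ'' => ?_
    -- The acknowledgement is not available before a location has been dissolved.
    · exact ((tower_mono post_drop_le).trans (iterate_wrap_bot _ d).le _
        (tower_post h1 hρ'' (by simp [nm]))).elim
    obtain ⟨n', rfl, h2⟩ := tower_exists (tower_mono post_none_drop_le _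
      (post_iterate_wrap_le (m := none) nofun d _ ⟨_, h1, hρ''.sstep⟩))
    refine leads_guarded (k := 5) (by omega) (by omega) rfl
      (owned_with (fun α Q hQ => ⟨5, by omega, by omega, by rw [(tt_ack hQ).1]⟩) h2)
      (fun ρ3 hρ3 => .goal ⟨rfl, n', rfl, d, ?_⟩) fun ρ3 hρ3 => ?_
    · exact tower_mono post_ack_le _ (tower_post h2 hρ3 (by simp [nm]))
    · exact ((tower_mono post_none_ack_le).trans (iterate_wrap_bot _ d).le _
        (post_iterate_wrap_le (m := none) nofun d _ ⟨_, h2, hρ3.sstep⟩)).elim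
  | reset i =>
    refine leads_guarded (k := 3) (by omega) (by omega) rfl h.owned (fun ρ' hρ' => ?_)
      fun ρ' hρ' => absurd hρ' h.quiet
    obtain ⟨d, h⟩ := h
    -- Dissolving the boundary merges the `n` locations of the value with the `d` locations of
    -- garbage.
    have h1 : Tower e.name i (d + n) (Core e.name i) ρ'.items := by
      rw [← tower_tower]
      refine tower_mono (fun S hS => ?_) _ (tower_post h hρ' (by rw [lab_upd]; simp [nm]))
      obtain ⟨Q, h1, rfl⟩ := post_body hS
      rwa [Term.tr_hole, hole_fill]
    refine leads_guarded (k := 4) (by omega) (by omega) rfl (owned_tower_core h1)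
      -- The new boundary is put directly around the innermost location, so the value is zero and
      -- all former locations are garbage.
      (fun ρ'' hρ'' => .goal ⟨rfl, 0, rfl, d + n, ?_⟩) fun ρ'' hρ'' => ?_
    · exact post_tower_core (fun Q hQ => body_zero hQ) _ ⟨_, h1, hρ''.st⟩
    · exact (post_tower_core_le (m := none) nofun _ ⟨_, h1, hρ''.sstep⟩).elim

theorem complete {b : Bool} {o : Op} {n' : ℕ} {ρ : Tr} {b' : Bool} {π : Prefix} {P : Term}
    (h : IsReg e.name o.idx n ρ) (ho : o.Eff n n') : ∃ ρ', IsReg e.name o.idx n' ρ' ∧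
      Relation.TransGen (BarbStep .dynamic e b)
        ((pre e b o (guarded e b' π P)).tr, ρ) ((guarded e b' π P).tr, ρ') := by
  obtain ⟨d, h⟩ := h
  cases o with
  | inc i =>
    obtain rfl : n' = n + 1 := ho
    obtain ⟨ρ', h1, h2⟩ := tower_pre h body_le_pre_inc
    exact ⟨ρ', ⟨d, h2⟩, .single (barbStep_guarded items_guarded rfl h1)⟩
  | dec i =>
    obtain rfl : n = n' + 1 := ho
    obtain ⟨ρ1, h1, h2⟩ := tower_pre h body_le_pre_dec
    obtain ⟨ρ2, h3, h4⟩ := tower_pre_none h2 drop_le_pre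
    obtain ⟨ρ3, h5, h6⟩ := tower_pre h4 ack_le_pre
    refine ⟨ρ3, ⟨d, h6⟩, .head (barbStep_guarded items_guarded rfl h1)
      (.head (b := (_, ρ2)) ⟨.inr ⟨rfl, h3⟩, items_guarded, items_guarded, ?_⟩
        (.single (barbStep_guarded items_guarded rfl h5)))⟩
    rintro rfl
    exact tbarb_guarded
  | reset i =>
    obtain rfl : n' = 0 := ho
    obtain ⟨ρ1, h1, h2⟩ := tower_pre h (q := Tower e.name i n (Core e.name i)) <|
      wrap_le_pre (U := Term.hole.tr) fun Q hQ => by rwa [Term.tr_hole, hole_fill]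
    replace h2 : Tower e.name i d (Tower e.name i n (Core e.name i)) ρ1.items := h2
    rw [tower_tower] at h2
    obtain ⟨S, h3, h4⟩ := tower_core_le_pre (fun Q hQ => body_zero hQ) _ h2
    obtain ⟨ρ2, h5, rfl⟩ := ST.exists_tt h3
    exact ⟨ρ2, ⟨_, h4⟩, .head (barbStep_guarded items_guarded rfl h1)
      (.single (barbStep_guarded items_guarded rfl h5))⟩

/-- Every pattern used has exactly one hole, as the preserving grammar demands; hence resets
displace the old value instead of deleting it. -/
theorem pre_mem {b : Bool} {o : Op} {K : Term} (hK : K ∈ calculus .preserving .dynamic)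
    (hl : K.locs = []) :
    pre e b o K ∈ calculus .preserving .dynamic ∧ (pre e b o K).locs = [] := by
  have hack (i : ℕ) := guarded_mem (e := e) (b := false) (v := .preserving) (t := .dynamic)
    (.out (nm e.name 5 i)) nofun zero_mem rfl
  have hdrop (i : ℕ) := guarded_mem (e := e) (b := false) (v := .preserving) (t := .dynamic)
    (.upd (nm e.name 2 i) .hole) nofun (hack i).1 (hack i).2
  cases o with
  | inc i => exact guarded_mem (.upd _ (.loc _ (.loc _ .hole))) nofun hK hl
  | dec i =>
    have h := guarded_mem (e := e) (b := b) (t := .dynamic) (.inp (nm e.name 5 i)) nofun hK hl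
    exact guarded_mem (.upd _ (.parProc (.loc _ .hole) (hdrop i).1)) nofun h.1 h.2
  | reset i =>
    have h := guarded_mem (e := e) (b := b) (t := .dynamic)
      (.upd (nm e.name 4 i) (.loc (nm e.name 3 i) (.loc (nm e.name 4 i) .hole))) nofun hK hl
    exact guarded_mem (.upd _ .hole) nofun h.1 h.2

theorem exists_pre_code (b : Bool) (o : Op) :
    ∃ g : ℕ → ℕ, Primrec g ∧ ∀ K : Term, (pre e b o K).code = g K.code := by
  cases o with
  | inc i => exact exists_guarded_code _ _ _
  | dec i =>
    obtain ⟨g, hg, hg'⟩ := exists_guarded_code e b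
      (.upd (nm e.name 3 i) (.par (.loc (nm e.name 3 i) .hole) (drop e i)))
    obtain ⟨h, hh, hh'⟩ := exists_guarded_code e b (.inp (nm e.name 5 i))
    exact ⟨_, hg.comp hh, fun K => by rw [pre, hg', hh']⟩
  | reset i =>
    obtain ⟨g, hg, hg'⟩ := exists_guarded_code e b (.upd (nm e.name 3 i) .hole)
    obtain ⟨h, hh, hh'⟩ := exists_guarded_code e b
      (.upd (nm e.name 4 i) (.loc (nm e.name 3 i) (.loc (nm e.name 4 i) .hole)))
    exact ⟨_, hg.comp hh, fun K => by rw [pre, hg', hh']⟩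

/-- The encoding of counters in the calculus with preserving patterns and dynamic topology. -/
def coding (e : Barb) : Coding .preserving .dynamic e where
  pre := pre e
  pre_guarded b o K := by
    cases o with
    | inc i => exact ⟨_, _, rfl, 4, by omega, by omega, rfl⟩
    | dec i => exact ⟨_, _, rfl, 3, by omega, by omega, rfl⟩
    | reset i => exact ⟨_, _, rfl, 3, by omega, by omega, rfl⟩
  IsReg := IsReg e.name
  reg i := .loc (nm e.name 3 i) (.loc (nm e.name 4 i) .zero)
  isReg_reg i := ⟨0, _, by rw [Term.tr_loc, Term.tr_loc]; rfl, _, rfl, items_zero⟩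
  owned h := h.owned
  quiet h := h.quiet
  inc_step h hy := inc_step h hy
  sound h := sound h
  complete h ho := complete h ho
  code := exists_pre_code
  pre_mem hK hl := pre_mem hK hl
  reg_mem i := IsProc.loc _ (.loc _ (.sum .nil))

end DynamicCounter

end Evol

namespace Evol

/-- Every preserving process is unguarded. -/
theorem EventualAdaptationDecidable.preserving {e : Barb}
    (h : EventualAdaptationDecidable .unguarded .dynamic e) :
    EventualAdaptationDecidable .preserving .dynamic e := by
  obtain ⟨f, hf, h⟩ := h
  exact ⟨f, hf, fun P hP => h P (IsProc.toUnguarded hP)⟩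

end Evol

theorem mainTheorem3 :
    ((∀ e : Evol.Barb, ¬ Evol.EventualAdaptationDecidable .unguarded .dynamic e) ∧
      (∀ e : Evol.Barb, ¬ Evol.EventualAdaptationDecidable .unguarded .static e) ∧
      (∀ e : Evol.Barb, ¬ Evol.EventualAdaptationDecidable .preserving .dynamic e)) ∧
    (Evol.BoundedAdaptationDecidable .unguarded .dynamic ∧
      Evol.BoundedAdaptationDecidable .unguarded .static ∧
      Evol.BoundedAdaptationDecidable .preserving .dynamic) :=
  ⟨⟨fun e h => (Evol.DynamicCounter.coding e).not_eventualAdaptationDecidable h.preserving,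
      fun e => (Evol.StaticCounter.coding e).not_eventualAdaptationDecidable,
      fun e => (Evol.DynamicCounter.coding e).not_eventualAdaptationDecidable⟩,
    Evol.boundedAdaptationDecidable _ _, Evol.boundedAdaptationDecidable _ _,
    Evol.boundedAdaptationDecidable _ _⟩
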